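/- Let $X$ be a smooth quintic threefold, $e$ the hyperplane class, so that $H^{\rm even}(X,\mathbb C)=\mathbb C[e]/(e^4)$ with $\int_Xe^3=5$, $\mathrm{ch}(\mathcal O_X(m))=e^{me}$ and $\mathrm{td}(X)=\mathrm{td}(\mathcal O(1))^5/\mathrm{td}(\mathcal O(5))$. Let $D$ be the region $-2\pi<\arg z<0$ (with $\log z$ and powers of $z$ taken on this branch) and $\theta=z\,d/dz$. A *period* is a holomorphic solution on $D$ of the Picard–Fuchs equation of the mirror quintic, $$\theta^4F-5^5z(\theta+\tfrac15)(\theta+\tfrac25)(\theta+\tfrac35)(\theta+\tfrac45)F=0 .$$ Put $\alpha=e^{2\pi i/5}$ and, for $j=0,\dots,4$, $$\varpi_j=-\frac15\sum_{m\ge1}\frac{\alpha^{(2+j)m}\,\Gamma(m/5)}{\Gamma(m)\,\Gamma(1-m/5)^4}\,z^{-m/5}.$$ For $-\frac15<\epsilon<0$ define, with integrals along the line $\mathrm{Re}\,s=\epsilon$ oriented upwards, $$\Phi_0=\frac1{2\pi i}\int\frac{\Gamma(5s+1)\Gamma(-s)}{\Gamma(s+1)^4}(e^{\pi i}z)^s\,ds,\qquad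 \Phi_1=-\frac1{2\pi i}\cdot\frac1{2\pi i}\int\frac{\Gamma(5s+1)\Gamma(-s)^2}{\Gamma(s+1)^3}z^s\,ds,$$ $$\Phi_2=-\frac1{2\pi^2}\cdot\frac1{2\pi i}\int\frac{\Gamma(5s+1)\Gamma(-s)^3}{\Gamma(s+1)^2}(e^{\pi i}z)^s\,ds,\qquad \Phi_3=\frac{-6}{(2\pi i)^3}\cdot\frac1{2\pi i}\int\frac{\Gamma(5s+1)\Gamma(-s)^4}{\Gamma(s+1)}z^s\,ds,$$ and let $t=B+iJ=\Phi_1/\Phi_0$ be the mirror map. A function $Z$ on $D$ is called the *central charge* of an object with Chern character $\mathrm{ch}$ if it is a period of the form $Z=\sum_{k=0}^3b_k\Phi_k$ with constants $b_k$, and $$Z-\int_Xe^{-te}\,\mathrm{ch}\,\sqrt{\mathrm{td}(X)}-b_3\cdot\Bigl(-\frac{30i\zeta(3)}{\pi^3}\Bigr)\longrightarrow0\quad(z\to0\text{ in }D),$$ that is, it is given by the large radius formula up to vanishing corrections and up to the constant four-loop correction, which is the $\zeta(3)$ term coming from $\Phi_3$. Then the following hold. 1. The series for the $\varpi_j$ converge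 for $|z|\ge5^{-5}$ and continue analytically to $D$; the continuations (again called $\varpi_j$) are periods, $\varpi_0+\dots+\varpi_4=0$, and $\varpi_0,\dots,\varpi_3$ is a basis of the space of periods. 2. The Barnes integrals converge for $z\in D$. We have $\Phi_0=\sum_{n\ge0}\frac{(5n)!}{n!^5}z^n$ for $|z|\le5^{-5}$ and, as $z\to0$ in $D$, $$\Phi_1=\tfrac1{2\pi i}\log z+O(z\log z),\qquad \Phi_2=-\tfrac1{4\pi^2}(\log z)^2+\tfrac1{2\pi i}\log z-\tfrac56+O(z(\log z)^2),$$ $$\Phi_3=\tfrac{i}{8\pi^3}(\log z)^3+\tfrac{7i}{4\pi}\log z-\tfrac{30i\zeta(3)}{\pi^3}+O(z(\log z)^3).$$ On all of $D$, $\Phi_0=\varpi_0$, $\Phi_1=-\frac15(\varpi_0-3\varpi_1-2\varpi_2-\varpi_3)$, $\Phi_2=\frac25(-2\varpi_0+\varpi_2+\varpi_3)$, $\Phi_3=-\frac65(2\varpi_1+2\varpi_2+\varpi_3)$. 3. For every integer $m$, $\int_Xe^{-te}\mathrm{ch}(\mathcal O_X(m))\sqrt{\mathrm{td}(X)}=\frac5{12}(m-t)(2m^2+2t^2-4mt+5)$,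 and $\mathcal O_X(m)$ has exactly one central charge on $D$, namely $$Z(\mathcal O_X(m))=\tfrac56m(m^2+5)\Phi_0-\tfrac52(m^2+m+2)\Phi_1+\tfrac52m\Phi_2-\tfrac56\Phi_3$$ $$=\tfrac16(5m^3+3m^2+16m+6)\varpi_0-\tfrac12(3m^2+3m+2)\varpi_1-m^2\varpi_2-\tfrac12m(m-1)\varpi_3 .$$ In particular $Z(\mathcal O_X)=\varpi_0-\varpi_1$. 4. As $z\to5^{-5}$ in $D$ with $\arg z\to0$, every $\varpi_j$ tends to the value of its (convergent) series at $z=5^{-5}$, $\arg z=0$. For real $z\ge5^{-5}$ with $\arg z=0$ the series $\varpi_1$ is the complex conjugate of the series $\varpi_0$. At $z=5^{-5}$ the series $\sum_n\frac{(5n)!}{n!^5}z^n$ converges and its sum, a real number, equals $\varpi_0$. Hence $\varpi_0=\varpi_1$ there, and $Z(\mathcal O_X)\to0$ at the conifold point $z=5^{-5}$: $\mathcal O_X$ becomes massless. -/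

import Mathlib

open Filter Topology Asymptotics

noncomputable section

namespace Quintic

/-! ### Even cohomology of the quintic threefold

The even cohomology of a smooth quintic threefold `X` in four-dimensional projective space is
`ℂ[e]/(e ^ 4)`, where `e` is the hyperplane class and `∫_X e ^ 3 = 5`.  A class is represented by a
power series in `e`; only its coefficients up to `e ^ 3` matter for integration over `X`. -/

/-- `∫_X : H^even(X, ℂ) → ℂ`, which picks the coefficient of `e ^ 3`, times `∫_X e ^ 3 = 5`. -/
def integralX (f : PowerSeries ℂ) : ℂ := 5 * PowerSeries.coeff 3 f

/-- `exp (a e)`. -/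
def expClass (a : ℂ) : PowerSeries ℂ := PowerSeries.rescale a (PowerSeries.exp ℂ)

/-- The Chern character of the line bundle `𝒪_X(m)`, whose first Chern class is `m e`. -/
def chO (m : ℤ) : PowerSeries ℂ := expClass m

/-- The Todd class `x / (1 - exp (-x))` of a line bundle with first Chern class `x = a e`. -/
def toddLine (a : ℂ) : PowerSeries ℂ := PowerSeries.rescale a (bernoulli'PowerSeries ℂ)

/-- The Todd class of (the tangent bundle of) `X`.  By the Euler sequence and the normal bundle
sequence, `td(X) = td(𝒪(1)) ^ 5 / td(𝒪(5))`. -/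
def toddX : PowerSeries ℂ := toddLine 1 ^ 5 * (toddLine 5)⁻¹

/-- The square root of a power series `f` with constant term `1`: the binomial series
`(1 + (f - 1)) ^ (1 / 2)`. -/
def sqrtClass (f : PowerSeries ℂ) : PowerSeries ℂ :=
  (PowerSeries.binomialSeries ℂ (1 / 2 : ℚ)).subst (f - 1)

theorem sqrtClass_sq (f : PowerSeries ℂ) (hf : PowerSeries.constantCoeff f = 1) :
    sqrtClass f ^ 2 = f := by
  have hs : PowerSeries.HasSubst (f - 1) :=
    PowerSeries.HasSubst.of_constantCoeff_zero' (by simp [hf])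
  have h1 : PowerSeries.binomialSeries ℂ (1 / 2 : ℚ) * PowerSeries.binomialSeries ℂ (1 / 2 : ℚ)
      = 1 + PowerSeries.X := by
    rw [← PowerSeries.binomialSeries_add]
    have h2 : (1 / 2 + 1 / 2 : ℚ) = ((1 : ℕ) : ℚ) := by norm_num
    rw [h2, PowerSeries.binomialSeries_nat, pow_one]
  rw [sqrtClass, sq, ← PowerSeries.subst_mul hs, h1, PowerSeries.subst_add hs,
    PowerSeries.subst_X hs]
  have h3 : PowerSeries.subst (f - 1) (1 : PowerSeries ℂ) = 1 := by
    rw [← PowerSeries.coe_substAlgHom hs, map_one]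
  rw [h3]
  ring

/-- The large radius expression `∫_X exp (-t e) ch √td(X)` for the central charge of an object with
Chern character `ch`, at the complexified Kähler class `t e = (B + i J) e`. -/
def classicalCharge (ch : PowerSeries ℂ) (t : ℂ) : ℂ :=
  integralX (expClass (-t) * ch * sqrtClass toddX)

/-! ### Periods of the mirror family

All functions are written in terms of `u = log z`, so that `z = exp u`, `z d/dz = d/du`, and a power
`z ^ s` on the chosen branch is `exp (s u)`. -/

/-- The region `-2 π < arg z < 0`, in the coordinate `u = log z`. -/
def strip : Set ℂ := {u | -(2 * Real.pi) < u.im ∧ u.im < 0}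

/-- The logarithm of the conifold point `z = 5 ^ (-5)` (with `arg z = 0`). -/
def logConifold : ℝ := -5 * Real.log 5

theorem exp_logConifold : Real.exp logConifold = (5 : ℝ) ^ (-5 : ℤ) := by
  have h : logConifold = Real.log ((5 : ℝ) ^ (-5 : ℤ)) := by
    rw [Real.log_zpow, logConifold]
    norm_num
  rw [h, Real.exp_log (by positivity)]

/-- The operator `z d/dz + c`. -/
def thetaAdd (c : ℂ) (F : ℂ → ℂ) : ℂ → ℂ := fun u => deriv F u + c * F u

/-- A period on `-2 π < arg z < 0`: a holomorphic solution there of the Picard-Fuchs equation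
`θ⁴ F - 5⁵ z (θ + 1/5) (θ + 2/5) (θ + 3/5) (θ + 4/5) F = 0`, with `θ = z d/dz`. -/
def IsPeriod (F : ℂ → ℂ) : Prop :=
  DifferentiableOn ℂ F strip ∧
    ∀ u ∈ strip,
      thetaAdd 0 (thetaAdd 0 (thetaAdd 0 (thetaAdd 0 F))) u -
        5 ^ 5 * Complex.exp u *
          thetaAdd (1 / 5) (thetaAdd (2 / 5) (thetaAdd (3 / 5) (thetaAdd (4 / 5) F))) u = 0

/-- The term with index `m = n + 1` of the series
`ϖ_j = -(1/5) ∑_{m ≥ 1} α^((2 + j) m) Γ(m/5) / (Γ(m) Γ(1 - m/5)^4) z^(-m/5)`, `α = exp (2 π i / 5)`.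
If `5` divides `m` then `1 / Γ(1 - m/5) = 0`, in agreement with the conventions for
`Complex.Gamma` and division by zero. -/
def varpiTerm (j : Fin 5) (u : ℂ) (n : ℕ) : ℂ :=
  -(1 / 5) *
    (Complex.exp (2 * Real.pi * Complex.I / 5) ^ ((2 + (j : ℕ)) * (n + 1)) *
      Complex.Gamma ((n + 1 : ℕ) / 5) /
        (Complex.Gamma (n + 1 : ℕ) * Complex.Gamma (1 - (n + 1 : ℕ) / 5) ^ 4)) *
    Complex.exp (-((n + 1 : ℕ) / 5) * u)

/-- The sum of the series for `ϖ_j`. -/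
def varpiSeries (j : Fin 5) (u : ℂ) : ℂ := ∑' n : ℕ, varpiTerm j u n

/-- `ϖ j` is, for each `j`, the analytic continuation to the whole region `-2 π < arg z < 0` of the
series for `ϖ_j`, which converges for `|z| > 5 ^ (-5)`. -/
def IsVarpi (ϖ : Fin 5 → ℂ → ℂ) : Prop :=
  ∀ j, DifferentiableOn ℂ (ϖ j) strip ∧
    ∀ u ∈ strip, logConifold < u.re → ϖ j u = varpiSeries j u

/-- The coefficient `(5 n)! / (n !) ^ 5`. -/
def fundCoeff (n : ℕ) : ℝ := (Nat.factorial (5 * n) : ℝ) / (Nat.factorial n : ℝ) ^ 5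

/-- The integrands of the four Barnes integrals, as functions of `u = log z` and `s`.  Here
`(exp (π i) z) ^ s = exp (s (u + π i))`. -/
def barnesIntegrand : Fin 4 → ℂ → ℂ → ℂ
  | 0, u, s => Complex.Gamma (5 * s + 1) * Complex.Gamma (-s) / Complex.Gamma (s + 1) ^ 4 *
      Complex.exp (s * (u + Real.pi * Complex.I))
  | 1, u, s => Complex.Gamma (5 * s + 1) * Complex.Gamma (-s) ^ 2 / Complex.Gamma (s + 1) ^ 3 *
      Complex.exp (s * u)
  | 2, u, s => Complex.Gamma (5 * s + 1) * Complex.Gamma (-s) ^ 3 / Complex.Gamma (s + 1) ^ 2 *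
      Complex.exp (s * (u + Real.pi * Complex.I))
  | 3, u, s => Complex.Gamma (5 * s + 1) * Complex.Gamma (-s) ^ 4 / Complex.Gamma (s + 1) *
      Complex.exp (s * u)

/-- The constants in front of the four Barnes integrals. -/
def barnesPrefactor : Fin 4 → ℂ
  | 0 => 1
  | 1 => -(1 / (2 * Real.pi * Complex.I))
  | 2 => -(1 / (2 * (Real.pi : ℂ) ^ 2))
  | 3 => 1 / (2 * Real.pi * Complex.I) ^ 3 * (-6)

/-- `(1 / (2 π i)) ∫ f(s) ds` along the upward vertical line `Re s = ε`. -/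
def lineIntegral (ε : ℝ) (f : ℂ → ℂ) : ℂ :=
  1 / (2 * Real.pi * Complex.I) * ∫ y : ℝ, f (ε + y * Complex.I) * Complex.I

/-- The periods `Φ_0, Φ_1, Φ_2, Φ_3`, given by Barnes integrals along `Re s = ε`. -/
def Phi (ε : ℝ) (k : Fin 4) (u : ℂ) : ℂ :=
  barnesPrefactor k * lineIntegral ε (barnesIntegrand k u)

/-- The mirror map `t = B + i J = Φ_1 / Φ_0`. -/
def mirrorMap (ε : ℝ) (u : ℂ) : ℂ := Phi ε 1 u / Phi ε 0 u

/-- The value `ζ(3)`. -/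
def zetaThree : ℂ := riemannZeta 3

/-- The constant term `-30 i ζ(3) / π ^ 3` of `Φ_3` at large radius. -/
def loopConstant : ℂ := -(30 * Complex.I * zetaThree / (Real.pi : ℂ) ^ 3)

/-- The large radius limit `z → 0` inside the region `-2 π < arg z < 0`. -/
def largeRadius : Filter ℂ := comap Complex.re atBot ⊓ 𝓟 strip

/-- `Z` is the exact central charge of an object with Chern character `ch`: it is a period, and as
`z → 0` it agrees with `∫_X exp (-t e) ch √td(X)` up to terms which tend to zero and up to the
constant four-loop correction, which is the `ζ(3)` term that the `Φ_3`-component of `Z` carries. -/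
def IsCentralCharge (ε : ℝ) (ch : PowerSeries ℂ) (Z : ℂ → ℂ) : Prop :=
  IsPeriod Z ∧ ∃ b : Fin 4 → ℂ,
    (∀ u ∈ strip, Z u = ∑ k, b k * Phi ε k u) ∧
    Tendsto (fun u => Z u - (classicalCharge ch (mirrorMap ε u) + b 3 * loopConstant))
      largeRadius (𝓝 0)

end Quintic

end

/-! Everything is read off the kernel `kernel k s` = Γ(5s+1) Γ(-s)^(k+1) / Γ(s+1)^(4-k), whose
integral against e^(sv) along a vertical line is Φ_k up to a constant, with v = u + πi for even k
and v = u for odd k. Two facts about the kernel carry the analysis. First, by reflection it equals,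
up to sign, π / sin(5πs) times (sin(πs)/π)^(4-k) times Γ(-s)^5 / Γ(-5s), and the last factor is a
product of four beta integrals, so its modulus is at most its value at Re s. Hence the kernel decays
like e^(-(k+1)π|Im s|) on vertical strips away from the real axis (`decaysOn_kernel`), without
Stirling's formula. Second, kernel(s+1) is ±5^5 (s+1/5)(s+2/5)(s+3/5)(s+4/5)/(s+1)^4 times kernel(s)
(`kernel_add_one`).

Shifting the line gives three things. To the left one meets the poles of Γ(5s+1); for |z| > 5^(-5)
the remainder vanishes, and Φ_k becomes a combination of the series ϖ_j, because powers of π /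
sin(πm/5) are polynomials in α^m modulo 1 + α^m + … + α^(4m) = 0 (`leftResidue_term_eq`). One step
to the right, with the factor s^4 cancelling the pole at 0, is the Picard–Fuchs equation
(`momentInt_picardFuchs`). One step to the right without that factor produces the residue at 0, a
polynomial in log z, plus an error O(z (log z)^k) (`exists_momentInt_bound`). The polynomial comes
from Γ(5s+1)/Γ(s+1)^5 = 1 + 10ζ(2)s² - 40ζ(3)s³ + O(s⁴) and πs / sin(πs) = 1 + ζ(2)s² + O(s⁴).

The error bound needs |Im v| bounded away from (k+1)π. This fails for k = 0, where the convergent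
power series is used instead, and at one edge of the region for k = 1, where the monodromy relation
between Φ_1 and Φ_0 moves u to the other side.

A solution of the fourth-order equation is fixed by its first four derivatives at a point, since 1 -
5^5 z has no zero in the region; so four independent periods form a basis. Independence of the Φ_k
holds because a polynomial in log z that tends to 0 is 0. The same principle makes the central
charge unique: its large radius limit determines the coefficients b_k. Existence is an identity
between cubic polynomials in log z / (2πi), once the mirror map is known to differ from that
variable by O(z log z).

At the conifold point Φ_1, Φ_2, Φ_3 are still given by convergent Barnes integrals, hence
continuous, and ϖ_0 = Φ_0 is controlled from both sides by series with terms O(n^(-2)). On the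
positive real axis ϖ_1 is the conjugate of ϖ_0, and ϖ_0 is real at the conifold, so the two agree
there and ϖ_0 - ϖ_1 tends to 0. -/

namespace Quintic

/-! ### Contour integrals over rectangles -/

/-- The counterclockwise integral over the boundary of the rectangle `[a, b] × [-T, T]`. -/
noncomputable def rectIntegral (f : ℂ → ℂ) (a b T : ℝ) : ℂ :=
  (∫ x : ℝ in a..b, f (x + (-T : ℝ) * Complex.I)) - (∫ x : ℝ in a..b, f (x + T * Complex.I)) +
    Complex.I • (∫ y : ℝ in (-T)..T, f (b + y * Complex.I)) -
      Complex.I • (∫ y : ℝ in (-T)..T, f (a + y * Complex.I))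

theorem rectIntegral_eq_zero {f : ℂ → ℂ} {a b T : ℝ} (hab : a ≤ b)
    (hf : DifferentiableOn ℂ f {s | a ≤ s.re ∧ s.re ≤ b}) : rectIntegral f a b T = 0 := by
  refine Complex.integral_boundary_rect_eq_zero_of_differentiableOn f ⟨a, -T⟩ ⟨b, T⟩ (hf.mono ?_)
  intro s hs
  have := hs.1
  simp only [Set.uIcc_of_le hab, Set.mem_preimage, Set.mem_Icc] at this
  exact this

section Rect

variable {a b T : ℝ}

theorem intervalIntegrable_horizontal {f : ℂ → ℂ} {t : ℝ} (ht : t ≠ 0) (hab : a ≤ b)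
    (hf : ContinuousOn f ({s | a ≤ s.re ∧ s.re ≤ b} \ {0})) :
    IntervalIntegrable (fun x : ℝ => f (x + t * Complex.I)) MeasureTheory.volume a b := by
  apply ContinuousOn.intervalIntegrable
  refine hf.comp (by fun_prop) ?_
  intro x hx
  rw [Set.uIcc_of_le hab] at hx
  refine ⟨by simpa using hx, ?_⟩
  intro h
  simpa [ht] using congrArg Complex.im h

theorem intervalIntegrable_vertical {f : ℂ → ℂ} {c d e : ℝ} (hc : c ≠ 0) (hac : a ≤ c)
    (hcb : c ≤ b) (hf : ContinuousOn f ({s | a ≤ s.re ∧ s.re ≤ b} \ {0})) :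
    IntervalIntegrable (fun y : ℝ => f (c + y * Complex.I)) MeasureTheory.volume d e := by
  apply ContinuousOn.intervalIntegrable
  refine hf.comp (by fun_prop) ?_
  intro x hx
  refine ⟨by simpa using ⟨hac, hcb⟩, ?_⟩
  intro h
  simpa [hc] using congrArg Complex.re h

theorem rectIntegral_add (ha : a < 0) (hb : 0 < b) (hT : 0 < T) {f g : ℂ → ℂ}
    (hf : ContinuousOn f ({s | a ≤ s.re ∧ s.re ≤ b} \ {0}))
    (hg : ContinuousOn g ({s | a ≤ s.re ∧ s.re ≤ b} \ {0})) :
    rectIntegral (fun s => f s + g s) a b T = rectIntegral f a b T + rectIntegral g a b T := by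
  have hab : a ≤ b := by linarith
  have h1 := intervalIntegrable_horizontal hT.ne' hab hf
  have h2 := intervalIntegrable_horizontal hT.ne' hab hg
  have h3 := intervalIntegrable_horizontal (neg_ne_zero.2 hT.ne') hab hf
  have h4 := intervalIntegrable_horizontal (neg_ne_zero.2 hT.ne') hab hg
  have h5 := intervalIntegrable_vertical (d := -T) (e := T) ha.ne le_rfl hab hf
  have h6 := intervalIntegrable_vertical (d := -T) (e := T) ha.ne le_rfl hab hg
  have h7 := intervalIntegrable_vertical (d := -T) (e := T) hb.ne' hab le_rfl hf
  have h8 := intervalIntegrable_vertical (d := -T) (e := T) hb.ne' hab le_rfl hg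
  simp only [rectIntegral]
  rw [intervalIntegral.integral_add h1 h2, intervalIntegral.integral_add h3 h4,
    intervalIntegral.integral_add h5 h6, intervalIntegral.integral_add h7 h8]
  simp only [smul_eq_mul]
  ring

theorem rectIntegral_const_mul (c : ℂ) (f : ℂ → ℂ) :
    rectIntegral (fun s => c * f s) a b T = c * rectIntegral f a b T := by
  simp only [rectIntegral, intervalIntegral.integral_const_mul, smul_eq_mul]
  ring

theorem rectIntegral_congr (ha : a < 0) (hb : 0 < b) (hT : 0 < T) {f g : ℂ → ℂ}
    (h : ∀ s, a ≤ s.re → s.re ≤ b → s ≠ 0 → f s = g s) :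
    rectIntegral f a b T = rectIntegral g a b T := by
  have hab : a ≤ b := by linarith
  have h1 : ∀ t : ℝ, t ≠ 0 → (∫ x : ℝ in a..b, f (x + t * Complex.I)) =
      ∫ x : ℝ in a..b, g (x + t * Complex.I) := by
    intro t ht
    refine intervalIntegral.integral_congr fun x hx => ?_
    rw [Set.uIcc_of_le hab] at hx
    refine h _ (by simpa using hx.1) (by simpa using hx.2) fun h0 => ?_
    simpa [ht] using congrArg Complex.im h0
  have h2 : ∀ c : ℝ, c ≠ 0 → a ≤ c → c ≤ b → (∫ y : ℝ in (-T)..T, f (c + y * Complex.I)) =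
      ∫ y : ℝ in (-T)..T, g (c + y * Complex.I) := by
    intro c hc hac hcb
    refine intervalIntegral.integral_congr fun x hx => ?_
    refine h _ (by simpa using hac) (by simpa using hcb) fun h0 => ?_
    simpa [hc] using congrArg Complex.re h0
  simp only [rectIntegral]
  rw [h1 T hT.ne', h1 (-T) (neg_ne_zero.2 hT.ne'), h2 a ha.ne le_rfl hab, h2 b hb.ne' hab le_rfl]

/-- The boundary avoids 0, so a single-valued primitive off 0 suffices and the corner values cancel.
This is what disposes of poles of order above one. -/
theorem rectIntegral_eq_zero_of_hasDerivAt (ha : a < 0) (hb : 0 < b) (hT : 0 < T) {F f : ℂ → ℂ}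
    (hF : ∀ s, s ≠ 0 → HasDerivAt F (f s) s)
    (hf : ContinuousOn f ({s | a ≤ s.re ∧ s.re ≤ b} \ {0})) : rectIntegral f a b T = 0 := by
  have hab : a ≤ b := by linarith
  have h1 : ∀ t : ℝ, t ≠ 0 → (∫ x : ℝ in a..b, f (x + t * Complex.I)) =
      F (b + t * Complex.I) - F (a + t * Complex.I) := by
    intro t ht
    refine intervalIntegral.integral_eq_sub_of_hasDerivAt
      (f := fun x : ℝ => F (x + t * Complex.I)) (fun x _ => ?_)
      (intervalIntegrable_horizontal ht hab hf)
    have h0 : (x : ℂ) + t * Complex.I ≠ 0 := fun h => by simpa [ht] using congrArg Complex.im h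
    have h3 : HasDerivAt (fun z : ℂ => F (z + t * Complex.I)) (f (x + t * Complex.I)) (x : ℂ) :=
      (hF _ h0).comp_add_const _ _
    exact h3.comp_ofReal
  have h2 : ∀ c : ℝ, c ≠ 0 → a ≤ c → c ≤ b →
      Complex.I • (∫ y : ℝ in (-T)..T, f (c + y * Complex.I)) =
      F (c + T * Complex.I) - F (c + (-T : ℝ) * Complex.I) := by
    intro c hc hac hcb
    rw [smul_eq_mul, ← intervalIntegral.integral_const_mul]
    refine intervalIntegral.integral_eq_sub_of_hasDerivAt
      (f := fun y : ℝ => F (c + y * Complex.I)) (fun x _ => ?_)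
      ((intervalIntegrable_vertical hc hac hcb hf).const_mul _)
    have h0 : (c : ℂ) + x * Complex.I ≠ 0 := fun h => by simpa [hc] using congrArg Complex.re h
    have h4 : HasDerivAt (fun z : ℂ => (c : ℂ) + z * Complex.I) Complex.I (x : ℂ) := by
      simpa using ((hasDerivAt_id (x : ℂ)).mul_const Complex.I).const_add (c : ℂ)
    have h3 : HasDerivAt (fun z : ℂ => F (c + z * Complex.I))
        (f (c + x * Complex.I) * Complex.I) (x : ℂ) :=
      HasDerivAt.comp (x : ℂ) (hF _ h0) h4
    rw [mul_comm]
    exact h3.comp_ofReal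
  simp only [rectIntegral]
  rw [h1 T hT.ne', h1 (-T) (neg_ne_zero.2 hT.ne'), h2 a ha.ne le_rfl hab, h2 b hb.ne' hab le_rfl]
  ring

/-- The principal logarithm is a primitive on the horizontal and right sides, and log(-s) on the
left side. The two differ by πi, with opposite signs, at the two left corners, which adds up to 2πi.
-/
theorem rectIntegral_inv (ha : a < 0) (hb : 0 < b) (hT : 0 < T) :
    rectIntegral (fun s => s⁻¹) a b T = 2 * Real.pi * Complex.I := by
  have hab : a ≤ b := by linarith
  have hcont : ContinuousOn (fun s : ℂ => s⁻¹) ({s | a ≤ s.re ∧ s.re ≤ b} \ {0}) :=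
    continuousOn_inv₀.mono fun s hs => hs.2
  have h1 : ∀ t : ℝ, t ≠ 0 → (∫ x : ℝ in a..b, ((x : ℂ) + t * Complex.I)⁻¹) =
      Complex.log (b + t * Complex.I) - Complex.log (a + t * Complex.I) := by
    intro t ht
    refine intervalIntegral.integral_eq_sub_of_hasDerivAt
      (f := fun x : ℝ => Complex.log (x + t * Complex.I)) (fun x _ => ?_)
      (intervalIntegrable_horizontal ht hab hcont)
    have h3 : HasDerivAt (fun z : ℂ => Complex.log (z + t * Complex.I))
        ((x + t * Complex.I)⁻¹) (x : ℂ) :=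
      (Complex.hasDerivAt_log (Or.inr (by simpa using ht))).comp_add_const _ _
    exact h3.comp_ofReal
  have h2 : Complex.I • (∫ y : ℝ in (-T)..T, ((b : ℂ) + y * Complex.I)⁻¹) =
      Complex.log (b + T * Complex.I) - Complex.log (b + (-T : ℝ) * Complex.I) := by
    rw [smul_eq_mul, ← intervalIntegral.integral_const_mul]
    refine intervalIntegral.integral_eq_sub_of_hasDerivAt
      (f := fun y : ℝ => Complex.log (b + y * Complex.I)) (fun x _ => ?_)
      ((intervalIntegrable_vertical hb.ne' hab le_rfl hcont).const_mul _)
    have h4 : HasDerivAt (fun z : ℂ => (b : ℂ) + z * Complex.I) Complex.I (x : ℂ) := by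
      simpa using ((hasDerivAt_id (x : ℂ)).mul_const Complex.I).const_add (b : ℂ)
    have h3 := HasDerivAt.comp (x : ℂ)
      (Complex.hasDerivAt_log (z := (b : ℂ) + x * Complex.I) (Or.inl (by simpa using hb))) h4
    rw [mul_comm]
    exact h3.comp_ofReal
  have h5 : Complex.I • (∫ y : ℝ in (-T)..T, ((a : ℂ) + y * Complex.I)⁻¹) =
      Complex.log (-(a + T * Complex.I)) - Complex.log (-(a + (-T : ℝ) * Complex.I)) := by
    rw [smul_eq_mul, ← intervalIntegral.integral_const_mul]
    refine intervalIntegral.integral_eq_sub_of_hasDerivAt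
      (f := fun y : ℝ => Complex.log (-(a + y * Complex.I))) (fun x _ => ?_)
      ((intervalIntegrable_vertical ha.ne le_rfl hab hcont).const_mul _)
    have h4 : HasDerivAt (fun z : ℂ => -((a : ℂ) + z * Complex.I)) (-Complex.I) (x : ℂ) := by
      simpa using (((hasDerivAt_id (x : ℂ)).mul_const Complex.I).const_add (a : ℂ)).fun_neg
    have h3 := HasDerivAt.comp (x : ℂ)
      (Complex.hasDerivAt_log (z := -((a : ℂ) + x * Complex.I)) (Or.inl (by simpa using ha))) h4
    have h6 : Complex.I * ((a : ℂ) + x * Complex.I)⁻¹ =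
        (-((a : ℂ) + x * Complex.I))⁻¹ * -Complex.I := by
      rw [inv_neg]
      ring
    rw [h6]
    exact h3.comp_ofReal
  simp only [rectIntegral]
  rw [h1 T hT.ne', h1 (-T) (neg_ne_zero.2 hT.ne'), h2, h5]
  have key : ∀ z : ℂ, 0 < z.im → Complex.log (-z) = Complex.log z - Real.pi * Complex.I := by
    intro z hz
    rw [Complex.log, Complex.log, Complex.arg_neg_eq_arg_sub_pi_of_im_pos hz, norm_neg]
    push_cast
    ring
  have k1 := key (a + T * Complex.I) (by simpa using hT)
  have k2 := key (-(a + (-T : ℝ) * Complex.I)) (by simpa using hT)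
  rw [neg_neg] at k2
  rw [k1, k2]
  ring

theorem continuousOn_exp_div_pow (v : ℂ) (n : ℕ) : ContinuousOn
    (fun s : ℂ => Complex.exp (s * v) / s ^ n) ({s | a ≤ s.re ∧ s.re ≤ b} \ {0}) := by
  refine ContinuousOn.div (by fun_prop) (by fun_prop) fun s hs => pow_ne_zero _ hs.2

theorem continuousOn_const_mul_exp_div_pow (c v : ℂ) (n : ℕ) : ContinuousOn
    (fun s : ℂ => c * (Complex.exp (s * v) / s ^ n)) ({s | a ≤ s.re ∧ s.re ≤ b} \ {0}) :=
  continuousOn_const.mul (continuousOn_exp_div_pow v n)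

/-- For the simple pole, subtract 1/s and use that the difference quotient of e^(sv) is entire. The
order is raised by integrating the exact derivative of e^(sv) / s^(j+1). -/
theorem rectIntegral_exp_div_pow (ha : a < 0) (hb : 0 < b) (hT : 0 < T) (v : ℂ) (j : ℕ) :
    rectIntegral (fun s => Complex.exp (s * v) / s ^ (j + 1)) a b T =
      2 * Real.pi * Complex.I * (v ^ j / (j.factorial : ℂ)) := by
  induction j with
  | zero =>
    have h1 : rectIntegral (fun s => Complex.exp (s * v) / s ^ (0 + 1)) a b T =
        rectIntegral (fun s => s⁻¹ + dslope (fun s => Complex.exp (s * v)) 0 s) a b T := by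
      refine rectIntegral_congr ha hb hT fun s _ _ hs => ?_
      rw [dslope_of_ne _ hs, slope_def_field]
      simp only [zero_mul, Complex.exp_zero, sub_zero]
      field_simp
      ring
    have hd : DifferentiableOn ℂ (dslope (fun s => Complex.exp (s * v)) 0)
        {s | a ≤ s.re ∧ s.re ≤ b} := by
      refine DifferentiableOn.mono ?_ (Set.subset_univ _)
      rw [Complex.differentiableOn_dslope Filter.univ_mem]
      fun_prop
    rw [h1, rectIntegral_add ha hb hT, rectIntegral_inv ha hb hT,
      rectIntegral_eq_zero (by linarith) hd]
    · simp
    · exact continuousOn_inv₀.mono fun s hs => hs.2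
    · exact hd.continuousOn.mono Set.sdiff_subset
  | succ j ih =>
    have hj : ((j : ℂ) + 1) ≠ 0 := by exact_mod_cast Nat.succ_ne_zero j
    have h0 : rectIntegral (fun s => v * (Complex.exp (s * v) / s ^ (j + 1)) +
        (-((j : ℂ) + 1)) * (Complex.exp (s * v) / s ^ (j + 1 + 1))) a b T = 0 := by
      refine rectIntegral_eq_zero_of_hasDerivAt ha hb hT
        (F := fun s => Complex.exp (s * v) / s ^ (j + 1)) (fun s hs => ?_) ?_
      · have h1 : HasDerivAt (fun s : ℂ => Complex.exp (s * v)) (Complex.exp (s * v) * v) s := by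
          simpa using ((hasDerivAt_id s).mul_const v).cexp
        refine (h1.fun_div (hasDerivAt_pow (j + 1) s) (pow_ne_zero _ hs)).congr_deriv ?_
        push_cast
        field_simp
        ring
      · exact (continuousOn_const_mul_exp_div_pow v v _).add
          (continuousOn_const_mul_exp_div_pow (-((j : ℂ) + 1)) v _)
    rw [rectIntegral_add ha hb hT (continuousOn_const_mul_exp_div_pow v v _)
      (continuousOn_const_mul_exp_div_pow (-((j : ℂ) + 1)) v _), rectIntegral_const_mul,
      rectIntegral_const_mul, ih] at h0
    have h2 : ((j : ℂ) + 1) * rectIntegral (fun s => Complex.exp (s * v) / s ^ (j + 1 + 1)) a b T =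
        v * (2 * Real.pi * Complex.I * (v ^ j / (j.factorial : ℂ))) := by linear_combination -h0
    have hf : (j.factorial : ℂ) ≠ 0 := by exact_mod_cast j.factorial_ne_zero
    rw [Nat.factorial_succ]
    push_cast
    apply mul_left_cancel₀ hj
    rw [h2]
    field_simp
    ring

theorem rectIntegral_sum_exp_div_pow (ha : a < 0) (hb : 0 < b) (hT : 0 < T) (v : ℂ) (n : ℕ)
    (A : ℕ → ℂ) :
    rectIntegral (fun s => (∑ j ∈ Finset.range n, A j / s ^ (j + 1)) * Complex.exp (s * v)) a b T =
      2 * Real.pi * Complex.I * ∑ j ∈ Finset.range n, A j * (v ^ j / (j.factorial : ℂ)) := by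
  induction n with
  | zero => simp [rectIntegral]
  | succ n ih =>
    have hc : ∀ m, ContinuousOn (fun s : ℂ =>
        (∑ j ∈ Finset.range m, A j / s ^ (j + 1)) * Complex.exp (s * v))
        ({s | a ≤ s.re ∧ s.re ≤ b} \ {0}) := by
      intro m
      refine ContinuousOn.mul (continuousOn_finsetSum _ fun j _ => ?_) (by fun_prop)
      exact continuousOn_const.div (by fun_prop) fun s hs => pow_ne_zero _ hs.2
    rw [Finset.sum_range_succ, mul_add, ← ih]
    have h1 := rectIntegral_exp_div_pow ha hb hT v n
    have h2 : 2 * Real.pi * Complex.I * (A n * (v ^ n / (n.factorial : ℂ))) =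
        rectIntegral (fun s => A n * (Complex.exp (s * v) / s ^ (n + 1))) a b T := by
      rw [rectIntegral_const_mul, h1]
      ring
    rw [h2, ← rectIntegral_add ha hb hT (hc n) (continuousOn_const_mul_exp_div_pow (A n) v _)]
    refine rectIntegral_congr ha hb hT fun s _ _ hs => ?_
    rw [Finset.sum_range_succ]
    ring

/-- The residue theorem for one pole: G minus its principal part is bounded near 0, so the
singularity is removable and Cauchy's theorem applies to what is left. -/
theorem rectIntegral_principalPart (ha : a < 0) (hb : 0 < b) (hT : 0 < T) {G : ℂ → ℂ} {n : ℕ}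
    {A : ℕ → ℂ} (v : ℂ)
    (hd : ∀ s : ℂ, a ≤ s.re → s.re ≤ b → s ≠ 0 → DifferentiableAt ℂ G s)
    (hpp : (fun s : ℂ => G s - ∑ j ∈ Finset.range n, A j / s ^ (j + 1))
      =O[𝓝[≠] 0] fun _ => (1 : ℂ)) :
    rectIntegral (fun s => G s * Complex.exp (s * v)) a b T =
      2 * Real.pi * Complex.I * ∑ j ∈ Finset.range n, A j * (v ^ j / (j.factorial : ℂ)) := by
  set S : Set ℂ := {s | a ≤ s.re ∧ s.re ≤ b} with hS
  set H : ℂ → ℂ := fun s => G s - ∑ j ∈ Finset.range n, A j / s ^ (j + 1) with hH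
  have hS0 : S ∈ 𝓝 (0 : ℂ) := by
    have h1 : {s : ℂ | a < s.re} ∈ 𝓝 (0 : ℂ) :=
      (isOpen_lt continuous_const Complex.continuous_re).mem_nhds (by simpa using ha)
    have h2 : {s : ℂ | s.re < b} ∈ 𝓝 (0 : ℂ) :=
      (isOpen_lt Complex.continuous_re continuous_const).mem_nhds (by simpa using hb)
    filter_upwards [h1, h2] with s hs1 hs2
    exact ⟨le_of_lt hs1, le_of_lt hs2⟩
  have hHd : DifferentiableOn ℂ H (S \ {0}) := by
    intro s hs
    have hs0 : s ≠ 0 := hs.2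
    refine ((hd s hs.1.1 hs.1.2 hs0).sub ?_).differentiableWithinAt
    refine DifferentiableAt.fun_sum fun j _ => ?_
    exact (differentiableAt_const _).div (by fun_prop) (pow_ne_zero _ hs0)
  -- `H 0` is only the value dictated by division by zero; boundedness near 0 is all that the
  -- removable singularity criterion needs.
  have ho : (fun z => H z - H 0) =o[𝓝[≠] (0 : ℂ)] fun z => (z - 0)⁻¹ := by
    have h1 : (fun z => H z - H 0) =O[𝓝[≠] (0 : ℂ)] fun _ => (1 : ℂ) :=
      hpp.sub (isBigO_const_const _ one_ne_zero _)
    refine h1.trans_isLittleO ?_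
    rw [isLittleO_const_left]
    refine Or.inr ?_
    have h2 : Tendsto (fun z : ℂ => (z - 0)⁻¹) (𝓝[≠] 0) (Bornology.cobounded ℂ) := by
      simpa using tendsto_inv₀_nhdsNE_zero (α := ℂ)
    exact tendsto_norm_cobounded_atTop.comp h2
  have hup := Complex.differentiableOn_update_limUnder_of_isLittleO hS0 hHd ho
  set K := Function.update H 0 (limUnder (𝓝[≠] 0) H) with hK
  have hKe : DifferentiableOn ℂ (fun s => K s * Complex.exp (s * v)) S :=
    hup.mul (by fun_prop)
  have h1 : rectIntegral (fun s => G s * Complex.exp (s * v)) a b T =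
      rectIntegral (fun s => (∑ j ∈ Finset.range n, A j / s ^ (j + 1)) * Complex.exp (s * v) +
        K s * Complex.exp (s * v)) a b T := by
    refine rectIntegral_congr ha hb hT fun s _ _ hs => ?_
    rw [hK, Function.update_of_ne hs, hH]
    ring
  rw [h1, rectIntegral_add ha hb hT, rectIntegral_sum_exp_div_pow ha hb hT,
    rectIntegral_eq_zero (by linarith) hKe, add_zero]
  · refine ContinuousOn.mul (continuousOn_finsetSum _ fun j _ => ?_) (by fun_prop)
    exact continuousOn_const.div (by fun_prop) fun s hs => pow_ne_zero _ hs.2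
  · exact hKe.continuousOn.mono Set.sdiff_subset

end Rect

/-! ### Integrals along vertical lines -/

/-- `G` is `O(exp (-c |Im s|))` on `S`. -/
def DecaysOn (S : Set ℂ) (c : ℝ) (G : ℂ → ℂ) : Prop :=
  ∃ C, ∀ s ∈ S, ‖G s‖ ≤ C * Real.exp (-c * |s.im|)

/-- The line `Re s = a`. -/
def vline (a : ℝ) : Set ℂ := {s | s.re = a}

/-- The part `|Im s| ≥ 1` of the strip `a ≤ Re s ≤ b`. -/
def tails (a b : ℝ) : Set ℂ := {s | a ≤ s.re ∧ s.re ≤ b ∧ 1 ≤ |s.im|}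

theorem DecaysOn.mono {S S' : Set ℂ} {c : ℝ} {G : ℂ → ℂ} (h : DecaysOn S c G) (hS : S' ⊆ S) :
    DecaysOn S' c G := by
  obtain ⟨C, hC⟩ := h
  exact ⟨C, fun s hs => hC s (hS hs)⟩

theorem DecaysOn.exists_nonneg {S : Set ℂ} {c : ℝ} {G : ℂ → ℂ} (h : DecaysOn S c G) :
    ∃ C, 0 ≤ C ∧ ∀ s ∈ S, ‖G s‖ ≤ C * Real.exp (-c * |s.im|) := by
  obtain ⟨C, hC⟩ := h
  refine ⟨|C|, abs_nonneg C, fun s hs => (hC s hs).trans ?_⟩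
  gcongr
  exact le_abs_self C

theorem DecaysOn.congr {S : Set ℂ} {c : ℝ} {G H : ℂ → ℂ} (h : DecaysOn S c G)
    (hGH : ∀ s ∈ S, H s = G s) : DecaysOn S c H := by
  obtain ⟨C, hC⟩ := h
  exact ⟨C, fun s hs => by rw [hGH s hs]; exact hC s hs⟩

theorem DecaysOn.bounded_mul {S : Set ℂ} {c M : ℝ} {G g : ℂ → ℂ} (h : DecaysOn S c G)
    (hg : ∀ s ∈ S, ‖g s‖ ≤ M) : DecaysOn S c (fun s => g s * G s) := by
  obtain ⟨C, hC0, hC⟩ := h.exists_nonneg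
  refine ⟨|M| * C, fun s hs => ?_⟩
  rw [norm_mul, mul_assoc]
  exact mul_le_mul ((hg s hs).trans (le_abs_self M)) (hC s hs) (norm_nonneg _) (abs_nonneg _)

/-- A linear factor costs an arbitrarily small part of the exponential rate, since |y| ≤ e^(d|y|) /
d for d > 0. -/
theorem DecaysOn.linear_mul {S : Set ℂ} {c c' M : ℝ} {G : ℂ → ℂ} (h : DecaysOn S c G)
    (hc : c' < c) (hS : ∀ s ∈ S, |s.re| ≤ M) (q : ℂ) :
    DecaysOn S c' (fun s => (s + q) * G s) := by
  obtain ⟨C, hC0, hC⟩ := h.exists_nonneg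
  have hd : 0 < c - c' := by linarith
  refine ⟨(|M| + ‖q‖ + 1 / (c - c')) * C, fun s hs => ?_⟩
  have h1 : ‖s + q‖ ≤ (|M| + ‖q‖ + 1 / (c - c')) * Real.exp ((c - c') * |s.im|) := by
    have h2 : ‖s‖ ≤ |s.re| + |s.im| := Complex.norm_le_abs_re_add_abs_im s
    have h3 : |s.re| ≤ |M| := (hS s hs).trans (le_abs_self M)
    have h4 : |s.im| ≤ 1 / (c - c') * Real.exp ((c - c') * |s.im|) := by
      rw [one_div, ← div_eq_inv_mul, le_div_iff₀ hd]
      have := Real.add_one_le_exp ((c - c') * |s.im|)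
      linarith
    have h5 : 1 ≤ Real.exp ((c - c') * |s.im|) := Real.one_le_exp (by positivity)
    calc ‖s + q‖ ≤ ‖s‖ + ‖q‖ := norm_add_le _ _
      _ ≤ (|M| + ‖q‖) * 1 + |s.im| := by linarith
      _ ≤ (|M| + ‖q‖) * Real.exp ((c - c') * |s.im|) +
          1 / (c - c') * Real.exp ((c - c') * |s.im|) := by gcongr
      _ = _ := by ring
  rw [norm_mul]
  calc ‖s + q‖ * ‖G s‖ ≤ ((|M| + ‖q‖ + 1 / (c - c')) * Real.exp ((c - c') * |s.im|)) *
        (C * Real.exp (-c * |s.im|)) := by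
        gcongr
        exact hC s hs
    _ = (|M| + ‖q‖ + 1 / (c - c')) * C *
        (Real.exp ((c - c') * |s.im|) * Real.exp (-c * |s.im|)) := by ring
    _ = _ := by rw [← Real.exp_add]; ring_nf

/-- On the compact segment |Im s| ≤ 1 continuity gives a bound. -/
theorem DecaysOn.of_tails {a c : ℝ} {G : ℂ → ℂ} (h : DecaysOn (tails a a) c G)
    (hG : ContinuousOn G (vline a)) : DecaysOn (vline a) c G := by
  obtain ⟨C, hC0, hC⟩ := h.exists_nonneg
  have hcont : ContinuousOn (fun y : ℝ => ‖G (a + y * Complex.I)‖ * Real.exp (c * |y|))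
      (Set.Icc (-1) 1) := by
    refine ContinuousOn.mul (ContinuousOn.norm (hG.comp (by fun_prop) fun y _ => ?_)) (by fun_prop)
    simp [vline]
  obtain ⟨M, hM⟩ := isCompact_Icc.bddAbove_image hcont
  refine ⟨max C M, fun s hs => ?_⟩
  by_cases h1 : 1 ≤ |s.im|
  · have hs' : s.re = a := hs
    refine (hC s ⟨hs'.ge, hs'.le, h1⟩).trans ?_
    gcongr
    exact le_max_left _ _
  · have h2 := hM (Set.mem_image_of_mem _ (abs_le.1 (not_le.1 h1).le))
    have h3 : (a : ℂ) + s.im * Complex.I = s := by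
      have hs' : s.re = a := hs
      rw [← hs', Complex.re_add_im]
    simp only [h3] at h2
    have h4 : ‖G s‖ ≤ M * Real.exp (-c * |s.im|) := by
      rw [neg_mul, Real.exp_neg, ← div_eq_mul_inv, le_div_iff₀ (Real.exp_pos _)]
      exact h2
    refine h4.trans ?_
    gcongr
    exact le_max_right _ _

theorem integrable_exp_neg_mul_abs {c : ℝ} (hc : 0 < c) :
    MeasureTheory.Integrable (fun y : ℝ => Real.exp (-c * |y|)) := by
  have h1 : MeasureTheory.Integrable (fun y : ℝ => (1 + (c / 2 * y) ^ 2)⁻¹) :=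
    integrable_inv_one_add_sq.comp_mul_left' (by positivity)
  refine h1.mono' (by fun_prop) (Eventually.of_forall fun y => ?_)
  rw [Real.norm_eq_abs, Real.abs_exp, neg_mul, Real.exp_neg]
  have h2 := Real.add_one_le_exp (c / 2 * |y|)
  have h3 : (0 : ℝ) ≤ c / 2 * |y| := by positivity
  refine inv_anti₀ (by positivity) ?_
  calc 1 + (c / 2 * y) ^ 2 = 1 + (c / 2 * |y|) ^ 2 := by rw [mul_pow, mul_pow, sq_abs]
    _ ≤ (c / 2 * |y| + 1) ^ 2 := by nlinarith
    _ ≤ (Real.exp (c / 2 * |y|)) ^ 2 := by gcongr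
    _ = Real.exp (c * |y|) := by rw [← Real.exp_nat_mul]; congr 1; push_cast; ring

theorem norm_exp_line (a y : ℝ) (v : ℂ) :
    ‖Complex.exp ((a + y * Complex.I) * v)‖ = Real.exp (a * v.re - y * v.im) := by
  rw [Complex.norm_exp]
  congr 1
  simp

/-- The exponential grows at most like e^(|Im v||y|) along the line; the margin between this rate
and that of G is what makes all the integrals converge. -/
theorem norm_mul_exp_line_le {G : ℂ → ℂ} {a c c' C y : ℝ} {v : ℂ} (hC : 0 ≤ C)
    (hG : ‖G (a + y * Complex.I)‖ ≤ C * Real.exp (-c * |y|)) (hv : |v.im| ≤ c') :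
    ‖G (a + y * Complex.I) * Complex.exp ((a + y * Complex.I) * v)‖ ≤
      C * Real.exp (a * v.re) * Real.exp (-(c - c') * |y|) := by
  rw [norm_mul, norm_exp_line]
  have h1 : -(y * v.im) ≤ c' * |y| := by
    calc -(y * v.im) ≤ |y * v.im| := neg_le_abs _
      _ = |v.im| * |y| := by rw [abs_mul, mul_comm]
      _ ≤ c' * |y| := by gcongr
  calc _ ≤ C * Real.exp (-c * |y|) * Real.exp (a * v.re + c' * |y|) := by
        gcongr
        linarith
    _ = _ := by
        rw [mul_assoc, mul_assoc, ← Real.exp_add, ← Real.exp_add]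
        ring_nf

section Line

variable {G : ℂ → ℂ} {a c : ℝ}

theorem continuous_line (hG : ContinuousOn G (vline a)) :
    Continuous fun y : ℝ => G (a + y * Complex.I) := by
  rw [← continuousOn_univ]
  exact hG.comp (by fun_prop) fun y _ => by simp [vline]

theorem DecaysOn.line_bound (hd : DecaysOn (vline a) c G) :
    ∃ C, 0 ≤ C ∧ ∀ y : ℝ, ‖G (a + y * Complex.I)‖ ≤ C * Real.exp (-c * |y|) := by
  obtain ⟨C, hC0, hC⟩ := hd.exists_nonneg
  exact ⟨C, hC0, fun y => by simpa using hC (a + y * Complex.I) (by simp [vline])⟩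

theorem integrable_line (hG : ContinuousOn G (vline a)) (hd : DecaysOn (vline a) c G) {v : ℂ}
    (hv : |v.im| < c) : MeasureTheory.Integrable
      (fun y : ℝ => G (a + y * Complex.I) * Complex.exp ((a + y * Complex.I) * v)) := by
  obtain ⟨C, hC0, hC⟩ := hd.line_bound
  refine ((integrable_exp_neg_mul_abs (sub_pos.2 hv)).const_mul (C * Real.exp (a * v.re))).mono'
    ?_ (Eventually.of_forall fun y => norm_mul_exp_line_le hC0 (hC y) le_rfl)
  exact ((continuous_line hG).mul (by fun_prop)).aestronglyMeasurable

theorem norm_lineIntegral_le {C : ℝ} (hC0 : 0 ≤ C)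
    (hC : ∀ y : ℝ, ‖G (a + y * Complex.I)‖ ≤ C * Real.exp (-c * |y|))
    {v : ℂ} {c' : ℝ} (hc : c' < c) (hv : |v.im| ≤ c') :
    ‖lineIntegral a (fun s => G s * Complex.exp (s * v))‖ ≤
      C * (∫ y : ℝ, Real.exp (-(c - c') * |y|)) * Real.exp (a * v.re) := by
  have hint := (integrable_exp_neg_mul_abs (sub_pos.2 hc)).const_mul (C * Real.exp (a * v.re))
  have h1 : ‖∫ y : ℝ, G (a + y * Complex.I) * Complex.exp ((a + y * Complex.I) * v) *
      Complex.I‖ ≤ ∫ y : ℝ, C * Real.exp (a * v.re) * Real.exp (-(c - c') * |y|) := by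
    refine MeasureTheory.norm_integral_le_of_norm_le hint (Eventually.of_forall fun y => ?_)
    rw [norm_mul, Complex.norm_I, mul_one]
    exact norm_mul_exp_line_le hC0 (hC y) hv
  have h2 : ‖(1 / (2 * Real.pi * Complex.I) : ℂ)‖ ≤ 1 := by
    rw [norm_div, norm_mul, norm_mul, Complex.norm_I, Complex.norm_real, Real.norm_eq_abs,
      abs_of_pos Real.pi_pos]
    simp only [norm_one, Complex.norm_ofNat, mul_one]
    rw [div_le_one (by positivity)]
    linarith [Real.pi_gt_three]
  rw [lineIntegral, norm_mul]
  calc _ ≤ 1 * ∫ y : ℝ, C * Real.exp (a * v.re) * Real.exp (-(c - c') * |y|) := by gcongr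
    _ = _ := by
      rw [MeasureTheory.integral_const_mul]
      ring

theorem lineIntegral_isBounded (hd : DecaysOn (vline a) c G) {c' : ℝ} (hc : c' < c) :
    ∃ K, ∀ v : ℂ, |v.im| ≤ c' →
      ‖lineIntegral a (fun s => G s * Complex.exp (s * v))‖ ≤ K * Real.exp (a * v.re) := by
  obtain ⟨C, hC0, hC⟩ := hd.line_bound
  exact ⟨_, fun v hv => norm_lineIntegral_le hC0 hC hc hv⟩

theorem hasDerivAt_lineIntegral (hG : ContinuousOn G (vline a)) (hd : DecaysOn (vline a) c G)
    {v : ℂ} (hv : |v.im| < c) :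
    HasDerivAt (fun v => lineIntegral a (fun s => G s * Complex.exp (s * v)))
      (lineIntegral a (fun s => s * G s * Complex.exp (s * v))) v := by
  -- Two intermediate rates: c₁ bounds |Im w| on a small ball around v, and c₂ is the decay left to
  -- s G(s) after absorbing the factor s.
  set c₁ := (2 * |v.im| + c) / 3 with hc₁
  set c₂ := (|v.im| + 2 * c) / 3 with hc₂
  have h12 : c₁ < c₂ := by linarith
  have h2c : c₂ < c := by linarith
  have hd' : DecaysOn (vline a) c₂ (fun s => s * G s) := by
    have := hd.linear_mul h2c (M := |a|) (fun s hs => by rw [show s.re = a from hs]) 0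
    simpa using this
  obtain ⟨C, hC0, hC⟩ := hd'.line_bound
  have hc1pos : 0 < c₁ - |v.im| := by linarith
  refine HasDerivAt.const_mul _ ?_
  set r := min 1 (c₁ - |v.im|) with hr
  have hr0 : 0 < r := lt_min one_pos hc1pos
  have hGc := continuous_line hG
  refine (hasDerivAt_integral_of_dominated_loc_of_deriv_le (Metric.ball_mem_nhds v hr0)
    (F := fun v (y : ℝ) => G (a + y * Complex.I) * Complex.exp ((a + y * Complex.I) * v) *
      Complex.I)
    (F' := fun v (y : ℝ) => (a + y * Complex.I) * G (a + y * Complex.I) *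
      Complex.exp ((a + y * Complex.I) * v) * Complex.I)
    (bound := fun y => C * Real.exp (|a| * (|v.re| + 1)) * Real.exp (-(c₂ - c₁) * |y|))
    ?_ ?_ ?_ ?_ ?_ ?_).2
  · exact Eventually.of_forall fun w =>
      (((hGc.mul (by fun_prop)).mul continuous_const)).aestronglyMeasurable
  · exact (integrable_line hG hd hv).mul_const _
  · exact (((((by fun_prop : Continuous fun y : ℝ => (a : ℂ) + y * Complex.I).mul hGc).mul
      (by fun_prop)).mul continuous_const)).aestronglyMeasurable
  · refine Eventually.of_forall fun y w hw => ?_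
    rw [Metric.mem_ball, dist_eq_norm] at hw
    have him : |w.im| ≤ c₁ := by
      have h1 : |(w - v).im| ≤ ‖w - v‖ := Complex.abs_im_le_norm _
      have h2 : |w.im| ≤ |(w - v).im| + |v.im| := by
        rw [Complex.sub_im]
        simpa using abs_add_le (w.im - v.im) v.im
      have h3 : r ≤ c₁ - |v.im| := min_le_right _ _
      linarith
    have hre : |w.re| ≤ |v.re| + 1 := by
      have h1 : |(w - v).re| ≤ ‖w - v‖ := Complex.abs_re_le_norm _
      have h2 : |w.re| ≤ |(w - v).re| + |v.re| := by
        rw [Complex.sub_re]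
        simpa using abs_add_le (w.re - v.re) v.re
      have h3 : r ≤ 1 := min_le_left _ _
      linarith
    rw [norm_mul, Complex.norm_I, mul_one]
    refine (norm_mul_exp_line_le (G := fun s => s * G s) hC0 (hC y) him).trans ?_
    have h4 : a * w.re ≤ |a| * (|v.re| + 1) := calc
      a * w.re ≤ |a * w.re| := le_abs_self _
      _ = |a| * |w.re| := abs_mul _ _
      _ ≤ _ := by gcongr
    gcongr
  · exact (integrable_exp_neg_mul_abs (sub_pos.2 h12)).const_mul _
  · refine Eventually.of_forall fun y w _ => ?_
    have h1 : HasDerivAt (fun w : ℂ => Complex.exp ((a + y * Complex.I) * w))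
        (Complex.exp ((a + y * Complex.I) * w) * (a + y * Complex.I)) w := by
      simpa using ((hasDerivAt_id w).const_mul ((a : ℂ) + y * Complex.I)).cexp
    refine ((h1.const_mul (G (a + y * Complex.I))).mul_const Complex.I).congr_deriv ?_
    ring

end Line

/-! ### Moving the line of integration across a pole -/

/-- The integral over the rectangle of height 2T does not depend on T, and its horizontal sides tend
to 0. The sign is negative because a counterclockwise boundary descends along the left line. -/
theorem lineIntegral_sub_lineIntegral_zero {G : ℂ → ℂ} {a b c : ℝ} {n : ℕ} {A : ℕ → ℂ} {v : ℂ}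
    (ha : a < 0) (hb : 0 < b)
    (hd : ∀ s : ℂ, a ≤ s.re → s.re ≤ b → s ≠ 0 → DifferentiableAt ℂ G s)
    (hpp : (fun s : ℂ => G s - ∑ j ∈ Finset.range n, A j / s ^ (j + 1))
      =O[𝓝[≠] 0] fun _ => (1 : ℂ))
    (hdec : DecaysOn (tails a b) c G) (hv : |v.im| < c) :
    lineIntegral a (fun s => G s * Complex.exp (s * v)) -
      lineIntegral b (fun s => G s * Complex.exp (s * v)) =
      -∑ j ∈ Finset.range n, A j * (v ^ j / (j.factorial : ℂ)) := by
  have hab : a < b := by linarith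
  have hline : ∀ x : ℝ, x ≠ 0 → a ≤ x → x ≤ b → MeasureTheory.Integrable
      (fun y : ℝ => G (x + y * Complex.I) * Complex.exp ((x + y * Complex.I) * v)) := by
    intro x hx hax hxb
    have hc : ContinuousOn G (vline x) := by
      intro s hs
      have hs' : s.re = x := hs
      refine (hd s (by linarith) (by linarith) fun h => hx ?_).continuousAt.continuousWithinAt
      rw [← hs', h, Complex.zero_re]
    refine integrable_line hc (DecaysOn.of_tails (hdec.mono ?_) hc) hv
    intro s hs
    exact ⟨hax.trans hs.1, hs.2.1.trans hxb, hs.2.2⟩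
  have hlim : ∀ x : ℝ, x ≠ 0 → a ≤ x → x ≤ b →
      Tendsto (fun T : ℝ => ∫ y : ℝ in (-T)..T,
        G (x + y * Complex.I) * Complex.exp ((x + y * Complex.I) * v)) atTop
        (𝓝 (∫ y : ℝ, G (x + y * Complex.I) * Complex.exp ((x + y * Complex.I) * v))) :=
    fun x hx hax hxb => MeasureTheory.intervalIntegral_tendsto_integral (hline x hx hax hxb)
      tendsto_neg_atTop_atBot tendsto_id
  obtain ⟨C, hC0, hC⟩ := hdec.exists_nonneg
  set M := Real.exp ((|a| + |b|) * |v.re|) with hM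
  have hhor : ∀ t : ℝ, 1 ≤ |t| →
      ‖∫ x : ℝ in a..b, G (x + t * Complex.I) * Complex.exp ((x + t * Complex.I) * v)‖ ≤
        C * M * Real.exp (-(c - |v.im|) * |t|) * |b - a| := by
    intro t ht
    refine intervalIntegral.norm_integral_le_of_norm_le_const fun x hx => ?_
    rw [Set.uIoc_of_le hab.le] at hx
    have h1 : ‖G (x + t * Complex.I)‖ ≤ C * Real.exp (-c * |t|) := by
      have := hC (x + t * Complex.I) ⟨by simpa using hx.1.le, by simpa using hx.2, by simpa using ht⟩
      simpa using this
    refine (norm_mul_exp_line_le hC0 h1 le_rfl).trans ?_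
    have hx' : |x| ≤ |a| + |b| := by
      rw [abs_le]
      have := neg_abs_le a
      have := le_abs_self b
      have := abs_nonneg a
      have := abs_nonneg b
      constructor <;> linarith [hx.1, hx.2]
    have h4 : x * v.re ≤ (|a| + |b|) * |v.re| := calc
      x * v.re ≤ |x * v.re| := le_abs_self _
      _ = |x| * |v.re| := abs_mul _ _
      _ ≤ _ := by gcongr
    rw [hM]
    gcongr
  have hexp : Tendsto (fun T : ℝ => C * M * Real.exp (-(c - |v.im|) * |T|) * |b - a|) atTop
      (𝓝 0) := by
    have h1 : Tendsto (fun T : ℝ => Real.exp (-(c - |v.im|) * |T|)) atTop (𝓝 0) := by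
      refine Real.tendsto_exp_atBot.comp ?_
      exact tendsto_abs_atTop_atTop.const_mul_atTop_of_neg (by linarith)
    simpa using (h1.const_mul (C * M)).mul_const |b - a|
  have hh1 : Tendsto (fun T : ℝ => ∫ x : ℝ in a..b,
      G (x + T * Complex.I) * Complex.exp ((x + T * Complex.I) * v)) atTop (𝓝 0) := by
    refine squeeze_zero_norm' ?_ hexp
    filter_upwards [eventually_ge_atTop (1 : ℝ)] with T hT
    exact hhor T (hT.trans (le_abs_self T))
  have hh2 : Tendsto (fun T : ℝ => ∫ x : ℝ in a..b,
      G (x + (-T : ℝ) * Complex.I) * Complex.exp ((x + (-T : ℝ) * Complex.I) * v)) atTop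
      (𝓝 0) := by
    refine squeeze_zero_norm' ?_ hexp
    filter_upwards [eventually_ge_atTop (1 : ℝ)] with T hT
    rw [← abs_neg T]
    exact hhor (-T) (by rw [abs_neg]; exact hT.trans (le_abs_self T))
  have hrect : Tendsto (fun T => rectIntegral (fun s => G s * Complex.exp (s * v)) a b T) atTop
      (𝓝 (0 - 0 +
        Complex.I • (∫ y : ℝ, G (b + y * Complex.I) * Complex.exp ((b + y * Complex.I) * v)) -
        Complex.I • ∫ y : ℝ, G (a + y * Complex.I) * Complex.exp ((a + y * Complex.I) * v))) :=
    ((hh2.sub hh1).add ((hlim b hb.ne' hab.le le_rfl).const_smul _)).sub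
      ((hlim a ha.ne le_rfl hab.le).const_smul _)
  have hrect2 : Tendsto (fun T => rectIntegral (fun s => G s * Complex.exp (s * v)) a b T) atTop
      (𝓝 (2 * Real.pi * Complex.I * ∑ j ∈ Finset.range n, A j * (v ^ j / (j.factorial : ℂ)))) := by
    refine tendsto_const_nhds.congr' ?_
    filter_upwards [eventually_gt_atTop (0 : ℝ)] with T hT
    exact (rectIntegral_principalPart ha hb hT v hd hpp).symm
  have key := tendsto_nhds_unique hrect hrect2
  simp only [lineIntegral, MeasureTheory.integral_mul_const]
  simp only [smul_eq_mul] at key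
  have hpi : (2 * Real.pi * Complex.I : ℂ) ≠ 0 := by
    simp [Real.pi_ne_zero, Complex.I_ne_zero]
  rw [← mul_sub, one_div, inv_mul_eq_iff_eq_mul₀ hpi, mul_neg, ← key]
  ring

theorem lineIntegral_add_left (f : ℂ → ℂ) (x p : ℝ) :
    lineIntegral (x + p) f = lineIntegral x (fun s => f (s + p)) := by
  simp only [lineIntegral]
  congr 2
  ext y
  push_cast
  ring_nf

theorem lineIntegral_const_mul (k : ℂ) (f : ℂ → ℂ) (x : ℝ) :
    lineIntegral x (fun s => k * f s) = k * lineIntegral x f := by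
  simp only [lineIntegral, mul_assoc, MeasureTheory.integral_const_mul]
  ring

theorem lineIntegral_congr {f g : ℂ → ℂ} {x : ℝ} (h : ∀ s ∈ vline x, f s = g s) :
    lineIntegral x f = lineIntegral x g := by
  simp only [lineIntegral]
  congr 2
  ext y
  rw [h _ (by simp [vline])]

/-- Moving the line of integration from `Re s = a` to `Re s = b` across a pole at `p`. -/
theorem lineIntegral_sub_lineIntegral {G : ℂ → ℂ} {a b p c : ℝ} {n : ℕ} {A : ℕ → ℂ} {v : ℂ}
    (ha : a < p) (hb : p < b)
    (hd : ∀ s : ℂ, a ≤ s.re → s.re ≤ b → s ≠ p → DifferentiableAt ℂ G s)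
    (hpp : (fun s : ℂ => G s - ∑ j ∈ Finset.range n, A j / (s - p) ^ (j + 1))
      =O[𝓝[≠] (p : ℂ)] fun _ => (1 : ℂ))
    (hdec : DecaysOn (tails a b) c G) (hv : |v.im| < c) :
    lineIntegral a (fun s => G s * Complex.exp (s * v)) -
      lineIntegral b (fun s => G s * Complex.exp (s * v)) =
      -(Complex.exp (p * v) * ∑ j ∈ Finset.range n, A j * (v ^ j / (j.factorial : ℂ))) := by
  have hshift : Tendsto (fun s : ℂ => s + p) (𝓝[≠] 0) (𝓝[≠] (p : ℂ)) := by
    refine tendsto_nhdsWithin_of_tendsto_nhds_of_eventually_within _ ?_ ?_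
    · have : Tendsto (fun s : ℂ => s + p) (𝓝 0) (𝓝 (0 + p)) :=
        (continuous_add_const (p : ℂ)).tendsto 0
      rw [zero_add] at this
      exact this.mono_left nhdsWithin_le_nhds
    · filter_upwards [self_mem_nhdsWithin] with s hs
      simpa using hs
  have key := lineIntegral_sub_lineIntegral_zero (G := fun s => G (s + p)) (a := a - p)
    (b := b - p) (c := c) (n := n) (A := A) (v := v) (by linarith) (by linarith) ?_ ?_ ?_ hv
  · have h : ∀ x : ℝ, lineIntegral x (fun s => G s * Complex.exp (s * v)) =
        Complex.exp (p * v) *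
          lineIntegral (x - p) (fun s => G (s + p) * Complex.exp (s * v)) := by
      intro x
      rw [← lineIntegral_const_mul]
      conv_lhs => rw [← sub_add_cancel x p, lineIntegral_add_left]
      refine lineIntegral_congr fun s _ => ?_
      rw [add_mul, Complex.exp_add]
      ring
    rw [h a, h b, ← mul_sub, key]
    ring
  · intro s h1 h2 h3
    have h4 : DifferentiableAt ℂ G (s + p) :=
      hd _ (by simp; linarith) (by simp; linarith) (by simpa using h3)
    exact h4.comp s (differentiableAt_id.add_const _)
  · have := hpp.comp_tendsto hshift
    simpa [Function.comp_def] using this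
  · obtain ⟨C, hC⟩ := hdec
    refine ⟨C, fun s hs => ?_⟩
    have := hC (s + p) ⟨by simp; linarith [hs.1], by simp; linarith [hs.2.1], by simpa using hs.2.2⟩
    simpa using this

/-! ### Bounds for quotients of Gamma functions -/

theorem norm_betaIntegral_le (u v : ℂ) :
    ‖Complex.betaIntegral u v‖ ≤ (Complex.betaIntegral u.re v.re).re := by
  have hr : Complex.betaIntegral u.re v.re =
      ((∫ x : ℝ in (0 : ℝ)..1, x ^ (u.re - 1) * (1 - x) ^ (v.re - 1) : ℝ) : ℂ) := by
    rw [Complex.betaIntegral, ← intervalIntegral.integral_ofReal]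
    refine intervalIntegral.integral_congr fun x hx => ?_
    rw [Set.uIcc_of_le zero_le_one] at hx
    push_cast
    rw [Complex.ofReal_cpow hx.1, Complex.ofReal_cpow (by linarith [hx.2])]
    push_cast
    ring
  rw [hr, Complex.ofReal_re, Complex.betaIntegral]
  refine (intervalIntegral.norm_integral_le_integral_norm zero_le_one).trans (le_of_eq ?_)
  rw [intervalIntegral.integral_of_le zero_le_one, intervalIntegral.integral_of_le zero_le_one,
    MeasureTheory.integral_Ioc_eq_integral_Ioo, MeasureTheory.integral_Ioc_eq_integral_Ioo]
  refine MeasureTheory.setIntegral_congr_fun measurableSet_Ioo fun x hx => ?_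
  have h1 : (0 : ℝ) < 1 - x := by linarith [hx.2]
  simp only [norm_mul]
  rw [Complex.norm_cpow_eq_rpow_re_of_pos hx.1,
    show (1 - (x : ℂ)) = ((1 - x : ℝ) : ℂ) by push_cast; ring,
    Complex.norm_cpow_eq_rpow_re_of_pos h1]
  simp

theorem norm_Gamma_mul_div_le {u v : ℂ} (hu : 0 < u.re) (hv : 0 < v.re) :
    ‖Complex.Gamma u * Complex.Gamma v / Complex.Gamma (u + v)‖ ≤
      Real.Gamma u.re * Real.Gamma v.re / Real.Gamma (u.re + v.re) := by
  rw [← Complex.betaIntegral_eq_Gamma_mul_div u v hu hv]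
  refine (norm_betaIntegral_le u v).trans (le_of_eq ?_)
  rw [Complex.betaIntegral_eq_Gamma_mul_div _ _ (by simpa) (by simpa), ← Complex.ofReal_add,
    Complex.Gamma_ofReal, Complex.Gamma_ofReal, Complex.Gamma_ofReal, ← Complex.ofReal_mul,
    ← Complex.ofReal_div, Complex.ofReal_re]

/-- `Γ(x) ^ 5 / Γ(5 x)`. -/
noncomputable def gammaQuot (x : ℝ) : ℝ := Real.Gamma x ^ 5 / Real.Gamma (5 * x)

theorem gammaQuot_pos {x : ℝ} (hx : 0 < x) : 0 < gammaQuot x :=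
  div_pos (pow_pos (Real.Gamma_pos_of_pos hx) 5) (Real.Gamma_pos_of_pos (by linarith))

/-- Γ(w)^5 / Γ(5w) = B(w,w) B(2w,w) B(3w,w) B(4w,w), and each beta integral is dominated by the one
at the real parts of its arguments. -/
theorem norm_gammaQuot_le {w : ℂ} (hw : 0 < w.re) :
    ‖Complex.Gamma w ^ 5 / Complex.Gamma (5 * w)‖ ≤ gammaQuot w.re := by
  have h1 := norm_Gamma_mul_div_le hw hw
  have h2 := norm_Gamma_mul_div_le (u := 2 * w) (by simpa using hw) hw
  have h3 := norm_Gamma_mul_div_le (u := 3 * w) (by simpa using hw) hw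
  have h4 := norm_Gamma_mul_div_le (u := 4 * w) (by simpa using hw) hw
  have e2 : (2 * w).re = 2 * w.re := by simp
  have e3 : (3 * w).re = 3 * w.re := by simp
  have e4 : (4 * w).re = 4 * w.re := by simp
  rw [e2] at h2
  rw [e3] at h3
  rw [e4] at h4
  rw [show w + w = 2 * w by ring, show w.re + w.re = 2 * w.re by ring] at h1
  rw [show 2 * w + w = 3 * w by ring, show 2 * w.re + w.re = 3 * w.re by ring] at h2
  rw [show 3 * w + w = 4 * w by ring, show 3 * w.re + w.re = 4 * w.re by ring] at h3
  rw [show 4 * w + w = 5 * w by ring, show 4 * w.re + w.re = 5 * w.re by ring] at h4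
  have g2 : Complex.Gamma (2 * w) ≠ 0 := Complex.Gamma_ne_zero_of_re_pos (by rw [e2]; linarith)
  have g3 : Complex.Gamma (3 * w) ≠ 0 := Complex.Gamma_ne_zero_of_re_pos (by rw [e3]; linarith)
  have g4 : Complex.Gamma (4 * w) ≠ 0 := Complex.Gamma_ne_zero_of_re_pos (by rw [e4]; linarith)
  have r0 := Real.Gamma_pos_of_pos hw
  have r2 : 0 < Real.Gamma (2 * w.re) := Real.Gamma_pos_of_pos (by linarith)
  have r3 : 0 < Real.Gamma (3 * w.re) := Real.Gamma_pos_of_pos (by linarith)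
  have r4 : 0 < Real.Gamma (4 * w.re) := Real.Gamma_pos_of_pos (by linarith)
  have r5 : 0 < Real.Gamma (5 * w.re) := Real.Gamma_pos_of_pos (by linarith)
  have aux : ∀ A B C D E : ℂ, B ≠ 0 → C ≠ 0 → D ≠ 0 →
      A ^ 5 / E = (A * A / B) * (B * A / C) * (C * A / D) * (D * A / E) := by
    intro A B C D E hB hC hD
    field_simp
  have hprod : Complex.Gamma w ^ 5 / Complex.Gamma (5 * w) =
      (Complex.Gamma w * Complex.Gamma w / Complex.Gamma (2 * w)) *
      (Complex.Gamma (2 * w) * Complex.Gamma w / Complex.Gamma (3 * w)) *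
      (Complex.Gamma (3 * w) * Complex.Gamma w / Complex.Gamma (4 * w)) *
      (Complex.Gamma (4 * w) * Complex.Gamma w / Complex.Gamma (5 * w)) :=
    aux _ _ _ _ _ g2 g3 g4
  have hprodr : gammaQuot w.re =
      (Real.Gamma w.re * Real.Gamma w.re / Real.Gamma (2 * w.re)) *
      (Real.Gamma (2 * w.re) * Real.Gamma w.re / Real.Gamma (3 * w.re)) *
      (Real.Gamma (3 * w.re) * Real.Gamma w.re / Real.Gamma (4 * w.re)) *
      (Real.Gamma (4 * w.re) * Real.Gamma w.re / Real.Gamma (5 * w.re)) := by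
    rw [gammaQuot]
    field_simp
  rw [hprod, hprodr, norm_mul, norm_mul, norm_mul]
  gcongr

theorem gammaQuot_add_one {x : ℝ} (hx : 0 < x) :
    gammaQuot (x + 1) = gammaQuot x *
      (x ^ 4 / (5 * ((5 * x + 1) * (5 * x + 2) * (5 * x + 3) * (5 * x + 4)))) := by
  have h5 : Real.Gamma (5 * (x + 1)) =
      (5 * x + 4) * ((5 * x + 3) * ((5 * x + 2) * ((5 * x + 1) * (5 * x * Real.Gamma (5 * x))))) := by
    rw [← Real.Gamma_add_one (s := 5 * x) (by positivity),
      ← Real.Gamma_add_one (s := 5 * x + 1) (by positivity),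
      show 5 * x + 1 + 1 = 5 * x + 2 by ring,
      ← Real.Gamma_add_one (s := 5 * x + 2) (by positivity),
      show 5 * x + 2 + 1 = 5 * x + 3 by ring,
      ← Real.Gamma_add_one (s := 5 * x + 3) (by positivity),
      show 5 * x + 3 + 1 = 5 * x + 4 by ring,
      ← Real.Gamma_add_one (s := 5 * x + 4) (by positivity)]
    ring_nf
  have h0 := (Real.Gamma_pos_of_pos hx).ne'
  have h1 := (Real.Gamma_pos_of_pos (show 0 < 5 * x by linarith)).ne'
  rw [gammaQuot, gammaQuot, h5, Real.Gamma_add_one hx.ne']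
  field_simp

/-- The source of the radius 5^(-5): each unit step of the line to the left gains this factor. -/
theorem gammaQuot_add_one_le {x : ℝ} (hx : 0 < x) :
    gammaQuot (x + 1) ≤ gammaQuot x * (1 / 5 ^ 5) := by
  rw [gammaQuot_add_one hx]
  refine mul_le_mul_of_nonneg_left ?_ (gammaQuot_pos hx).le
  rw [div_le_div_iff₀ (by positivity) (by positivity)]
  have h : (5 * x + 1) * (5 * x + 2) * (5 * x + 3) * (5 * x + 4) ≥
      (5 * x) * (5 * x) * (5 * x) * (5 * x) := by gcongr <;> linarith
  nlinarith

theorem gammaQuot_add_nat_le {x : ℝ} (hx : 0 < x) (n : ℕ) :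
    gammaQuot (x + n) ≤ gammaQuot x * (1 / 5 ^ 5) ^ n := by
  induction n with
  | zero => simp
  | succ n ih =>
    have h1 := gammaQuot_add_one_le (show 0 < x + n by positivity)
    rw [pow_succ, ← mul_assoc]
    push_cast
    rw [← add_assoc]
    exact h1.trans (by gcongr)

theorem continuousOn_gammaQuot : ContinuousOn gammaQuot (Set.Ioi 0) := by
  intro x hx
  have hx : 0 < x := hx
  have h1 : ∀ y : ℝ, 0 < y → ContinuousAt Real.Gamma y := fun y hy =>
    (Real.differentiableAt_Gamma fun m h => by
      have : (0 : ℝ) ≤ m := m.cast_nonneg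
      linarith).continuousAt
  have h2 : ContinuousAt (fun x : ℝ => Real.Gamma (5 * x)) x :=
    ContinuousAt.comp (f := fun x : ℝ => 5 * x) (h1 _ (by linarith)) (by fun_prop)
  exact (((h1 x hx).pow 5).div h2
    (Real.Gamma_pos_of_pos (by linarith)).ne').continuousWithinAt

/-! ### Bounds for the sine -/

theorem norm_sin_le (z : ℂ) : ‖Complex.sin z‖ ≤ Real.exp |z.im| := by
  have h1 : ‖Complex.exp (-z * Complex.I)‖ ≤ Real.exp |z.im| := by
    rw [Complex.norm_exp]
    gcongr
    simpa using le_abs_self z.im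
  have h2 : ‖Complex.exp (z * Complex.I)‖ ≤ Real.exp |z.im| := by
    rw [Complex.norm_exp]
    gcongr
    simpa using neg_le_abs z.im
  rw [Complex.sin, norm_div, norm_mul, Complex.norm_I, mul_one, Complex.norm_ofNat]
  have h3 := norm_sub_le (Complex.exp (-z * Complex.I)) (Complex.exp (z * Complex.I))
  linarith

/-- The real part of sin(x + iy) is sin x cosh y. This form serves on a whole vertical line avoiding
the zeros of the sine. -/
theorem le_norm_sin (z : ℂ) : |Real.sin z.re| * (Real.exp |z.im| / 2) ≤ ‖Complex.sin z‖ := by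
  have h1 : (Complex.sin z).re = Real.sin z.re * Real.cosh z.im := by
    rw [Complex.sin_eq z, ← Complex.ofReal_sin, ← Complex.ofReal_cosh, ← Complex.ofReal_cos,
      ← Complex.ofReal_sinh]
    simp
    exact Or.inl (Complex.sin_ofReal_re _)
  have h2 : Real.exp |z.im| / 2 ≤ Real.cosh z.im := by
    rw [← Real.cosh_abs, Real.cosh_eq]
    have := Real.exp_pos (-|z.im|)
    linarith
  calc |Real.sin z.re| * (Real.exp |z.im| / 2) ≤ |Real.sin z.re| * Real.cosh z.im := by gcongr
    _ = |(Complex.sin z).re| := by rw [h1, abs_mul, abs_of_pos (Real.cosh_pos _)]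
    _ ≤ _ := Complex.abs_re_le_norm _

/-- Away from the real axis one of the two exponentials dominates, so nothing is required of the
real part. -/
theorem le_norm_sin_of_one_le {z : ℂ} (hz : 1 ≤ |z.im|) :
    Real.exp |z.im| / 4 ≤ ‖Complex.sin z‖ := by
  have h1 : ‖Complex.exp (-z * Complex.I)‖ = Real.exp z.im := by
    rw [Complex.norm_exp]
    simp
  have h2 : ‖Complex.exp (z * Complex.I)‖ = Real.exp (-z.im) := by
    rw [Complex.norm_exp]
    simp
  have h3 : |Real.exp z.im - Real.exp (-z.im)| ≤
      ‖Complex.exp (-z * Complex.I) - Complex.exp (z * Complex.I)‖ := by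
    rw [← h1, ← h2]
    exact abs_norm_sub_norm_le _ _
  have h4 : Real.exp |z.im| / 2 ≤ |Real.exp z.im - Real.exp (-z.im)| := by
    have h5 : |Real.exp z.im - Real.exp (-z.im)| = Real.exp |z.im| - Real.exp (-|z.im|) := by
      rcases le_total 0 z.im with h | h
      · rw [abs_of_nonneg h, abs_of_nonneg]
        simpa using h
      · rw [abs_of_nonpos h, neg_neg, abs_of_nonpos]
        · ring
        · simp only [sub_nonpos, Real.exp_le_exp]
          linarith
    have h6 : Real.exp (-|z.im|) ≤ 1 := Real.exp_le_one_iff.2 (by linarith)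
    have h7 : 2 ≤ Real.exp |z.im| := by
      have := Real.add_one_le_exp |z.im|
      linarith
    rw [h5]
    linarith
  rw [Complex.sin, norm_div, norm_mul, Complex.norm_I, mul_one, Complex.norm_ofNat]
  linarith

/-! ### The Gamma factors of the Barnes integrands -/

/-- The Gamma factors `Γ(5 s + 1) Γ(-s) ^ (k + 1) / Γ(s + 1) ^ (4 - k)`. -/
noncomputable def kernel (k : ℕ) (s : ℂ) : ℂ :=
  Complex.Gamma (5 * s + 1) * Complex.Gamma (-s) ^ (k + 1) * ((Complex.Gamma (s + 1))⁻¹) ^ (4 - k)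

theorem differentiableAt_kernel {k : ℕ} {s : ℂ} (h1 : ∀ n : ℕ, 5 * s + 1 ≠ -n)
    (h2 : ∀ n : ℕ, s ≠ n) : DifferentiableAt ℂ (kernel k) s := by
  have a1 : DifferentiableAt ℂ (fun s : ℂ => Complex.Gamma (5 * s + 1)) s :=
    (Complex.differentiableAt_Gamma _ h1).comp s
      (f := fun s : ℂ => 5 * s + 1) (by fun_prop)
  have a2 : DifferentiableAt ℂ (fun s : ℂ => Complex.Gamma (-s)) s :=
    (Complex.differentiableAt_Gamma _ fun n h => h2 n (neg_injective h)).comp s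
      (f := fun s : ℂ => -s) (by fun_prop)
  have a3 : DifferentiableAt ℂ (fun s : ℂ => (Complex.Gamma (s + 1))⁻¹) s :=
    (Complex.differentiable_one_div_Gamma (s + 1)).comp s
      (f := fun s : ℂ => s + 1) (by fun_prop)
  exact (a1.mul (a2.pow _)).mul (a3.pow _)

/-- The functional equation of Γ, used five times at 5s+1 and once at each of the other arguments.
Under the integral it becomes the Picard–Fuchs recursion. -/
theorem kernel_add_one {k : ℕ} (hk : k ≤ 3) {s : ℂ} (h : ∀ n : ℕ, 5 * s + 1 ≠ -n) :
    kernel k (s + 1) = (-1) ^ (k + 1) * (5 ^ 5 * ((s + 1 / 5) * (s + 2 / 5) * (s + 3 / 5) *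
      (s + 4 / 5)) / (s + 1) ^ 4) * kernel k s := by
  have e1 : 5 * s + 1 ≠ 0 := by simpa using h 0
  have e2 : 5 * s + 2 ≠ 0 := fun h' => h 1 (by push_cast; linear_combination h')
  have e3 : 5 * s + 3 ≠ 0 := fun h' => h 2 (by push_cast; linear_combination h')
  have e4 : 5 * s + 4 ≠ 0 := fun h' => h 3 (by push_cast; linear_combination h')
  have e5 : 5 * s + 5 ≠ 0 := fun h' => h 4 (by push_cast; linear_combination h')
  have e0 : s + 1 ≠ 0 := fun h' => e5 (by linear_combination 5 * h')
  have g1 : Complex.Gamma (5 * (s + 1) + 1) = (5 * s + 5) * ((5 * s + 4) * ((5 * s + 3) *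
      ((5 * s + 2) * ((5 * s + 1) * Complex.Gamma (5 * s + 1))))) := by
    rw [← Complex.Gamma_add_one (5 * s + 1) e1, show 5 * s + 1 + 1 = 5 * s + 2 by ring,
      ← Complex.Gamma_add_one (5 * s + 2) e2, show 5 * s + 2 + 1 = 5 * s + 3 by ring,
      ← Complex.Gamma_add_one (5 * s + 3) e3, show 5 * s + 3 + 1 = 5 * s + 4 by ring,
      ← Complex.Gamma_add_one (5 * s + 4) e4, show 5 * s + 4 + 1 = 5 * s + 5 by ring,
      ← Complex.Gamma_add_one (5 * s + 5) e5]
    ring_nf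
  have g2 : Complex.Gamma (-s) = -(s + 1) * Complex.Gamma (-(s + 1)) := by
    rw [← Complex.Gamma_add_one (-(s + 1)) (neg_ne_zero.2 e0)]
    ring_nf
  have g3 : Complex.Gamma (s + 1 + 1) = (s + 1) * Complex.Gamma (s + 1) :=
    Complex.Gamma_add_one _ e0
  have g4 : (s + 1) ^ 5 = (s + 1) ^ (4 - k) * (s + 1) ^ (k + 1) := by
    rw [← pow_add]
    congr 1
    omega
  simp only [kernel]
  rw [g1, g2, g3, mul_inv, mul_pow, mul_pow, inv_pow]
  have h6 : (-(s + 1)) ^ (k + 1) = (-1) ^ (k + 1) * (s + 1) ^ (k + 1) := by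
    rw [← mul_pow]
    ring
  have h7 : ((-1 : ℂ) ^ (k + 1)) * (-1) ^ (k + 1) = 1 := by
    rw [← mul_pow]
    simp
  have h8 : ((s + 1) ^ (4 - k))⁻¹ = (s + 1) ^ (k + 1) / (s + 1) ^ 5 := by
    have := pow_ne_zero (4 - k) e0
    have := pow_ne_zero (k + 1) e0
    rw [g4]
    field_simp
  rw [h6, h8]
  generalize Complex.Gamma (-(s + 1)) ^ (k + 1) = X
  generalize ((Complex.Gamma (s + 1))⁻¹) ^ (4 - k) = Z
  generalize (s + 1) ^ (k + 1) = Y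
  generalize Complex.Gamma (5 * s + 1) = W
  generalize (-1 : ℂ) ^ (k + 1) = E at h7 ⊢
  calc _ = (E * E) * ((5 * s + 5) * ((5 * s + 4) * ((5 * s + 3) * ((5 * s + 2) *
        ((5 * s + 1) * W)))) * X * (Y / (s + 1) ^ 5 * Z)) := by rw [h7, one_mul]
    _ = _ := by
      field_simp

/-- Reflection in Γ(5s+1) and Γ(s+1) moves all Gamma factors to the right half-plane, where they
form the quotient Γ(-s)^5 / Γ(-5s). -/
theorem norm_kernel_le {k : ℕ} (hk : k ≤ 3) {s : ℂ} (hs : s.re < 0)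
    (hsin : Complex.sin (5 * (Real.pi * s)) ≠ 0) :
    ‖kernel k s‖ ≤ Real.pi * gammaQuot (-s.re) * Real.exp (Real.pi * |s.im|) ^ (4 - k) /
      ‖Complex.sin (5 * (Real.pi * s))‖ := by
  have hsin1 : Complex.sin (Real.pi * s) ≠ 0 := by
    intro h
    rw [Complex.sin_eq_zero_iff] at h
    obtain ⟨n, hn⟩ := h
    refine hsin (Complex.sin_eq_zero_iff.2 ⟨5 * n, ?_⟩)
    rw [hn]
    push_cast
    ring
  have hre : 0 < (-s).re := by simpa using hs
  have hre5 : 0 < (5 * -s).re := by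
    simp
    linarith
  have g1 := Complex.Gamma_mul_Gamma_one_sub (5 * -s)
  have g2 := Complex.Gamma_mul_Gamma_one_sub (-s)
  have n1 := Complex.Gamma_ne_zero_of_re_pos hre
  have n5 := Complex.Gamma_ne_zero_of_re_pos hre5
  rw [show 1 - 5 * -s = 5 * s + 1 by ring, show (Real.pi : ℂ) * (5 * -s) = -(5 * (Real.pi * s)) by
    ring, Complex.sin_neg] at g1
  rw [show 1 - -s = s + 1 by ring, show (Real.pi : ℂ) * -s = -(Real.pi * s) by ring,
    Complex.sin_neg] at g2
  have hpi : (Real.pi : ℂ) ≠ 0 := by exact_mod_cast Real.pi_ne_zero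
  have n2 : Complex.Gamma (s + 1) ≠ 0 := by
    intro h
    rw [h, mul_zero] at g2
    exact (div_ne_zero hpi (neg_ne_zero.2 hsin1)) g2.symm
  have g1' : Complex.Gamma (5 * s + 1) =
      -(Real.pi / (Complex.sin (5 * (Real.pi * s)) * Complex.Gamma (5 * -s))) := by
    have h : Complex.Gamma (5 * s + 1) =
        Real.pi / -Complex.sin (5 * (Real.pi * s)) / Complex.Gamma (5 * -s) := by
      rw [← g1, mul_div_cancel_left₀ _ n5]
    rw [h, div_neg, neg_div, div_div]
  have g2' : (Complex.Gamma (s + 1))⁻¹ =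
      Complex.Gamma (-s) * (-(Complex.sin (Real.pi * s) / Real.pi)) := by
    have h : Complex.Gamma (s + 1) =
        Real.pi / -Complex.sin (Real.pi * s) / Complex.Gamma (-s) := by
      rw [← g2, mul_div_cancel_left₀ _ n1]
    rw [h, inv_div, div_div_eq_mul_div, mul_div_assoc, neg_div]
  have hpow : Complex.Gamma (-s) ^ (k + 1) * Complex.Gamma (-s) ^ (4 - k) =
      Complex.Gamma (-s) ^ 5 := by
    rw [← pow_add]
    congr 1
    omega
  have hker : kernel k s = -(Real.pi / Complex.sin (5 * (Real.pi * s))) *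
      (Complex.Gamma (-s) ^ 5 / Complex.Gamma (5 * -s)) *
      (-(Complex.sin (Real.pi * s) / Real.pi)) ^ (4 - k) := by
    rw [kernel, g1', g2', mul_pow, ← hpow]
    field_simp
  have hnorm : ‖kernel k s‖ = Real.pi / ‖Complex.sin (5 * (Real.pi * s))‖ *
      ‖Complex.Gamma (-s) ^ 5 / Complex.Gamma (5 * -s)‖ *
      (‖Complex.sin (Real.pi * s)‖ / Real.pi) ^ (4 - k) := by
    rw [hker]
    simp [abs_of_pos Real.pi_pos]
  have hg := (gammaQuot_pos (show 0 < -s.re by linarith)).le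
  have hpi0 := Real.pi_pos
  rw [hnorm]
  have b1 := norm_gammaQuot_le hre
  have b2 : ‖Complex.sin (Real.pi * s)‖ / Real.pi ≤ Real.exp (Real.pi * |s.im|) := by
    have h := norm_sin_le (Real.pi * s)
    have him : |((Real.pi : ℂ) * s).im| = Real.pi * |s.im| := by
      simp [abs_mul, abs_of_pos Real.pi_pos]
    rw [him] at h
    refine (div_le_self (norm_nonneg _) (by linarith [Real.pi_gt_three])).trans h
  rw [Complex.neg_re] at b1
  calc _ ≤ Real.pi / ‖Complex.sin (5 * (Real.pi * s))‖ * gammaQuot (-s.re) *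
        Real.exp (Real.pi * |s.im|) ^ (4 - k) := by gcongr
    _ = _ := by ring

/-- Growth rate (4-k)π of the sines in the numerator against 5π in the denominator leaves (k+1)π.
The constant is kept explicit because the line will be moved to -∞. -/
theorem norm_kernel_line_le {k : ℕ} (hk : k ≤ 3) {s : ℂ} (hs : s.re < 0)
    (hsin : Real.sin (5 * (Real.pi * s.re)) ≠ 0) :
    ‖kernel k s‖ ≤ 2 * Real.pi / |Real.sin (5 * (Real.pi * s.re))| * gammaQuot (-s.re) *
      Real.exp (-((k + 1) * Real.pi) * |s.im|) := by
  have h1 := le_norm_sin (5 * (Real.pi * s))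
  have hre : (5 * ((Real.pi : ℂ) * s)).re = 5 * (Real.pi * s.re) := by simp
  have him : |(5 * ((Real.pi : ℂ) * s)).im| = 5 * Real.pi * |s.im| := by
    simp [abs_mul, abs_of_pos Real.pi_pos]
    ring
  rw [hre, him] at h1
  have h0 : 0 < |Real.sin (5 * (Real.pi * s.re))| := abs_pos.2 hsin
  have h2 : 0 < |Real.sin (5 * (Real.pi * s.re))| * (Real.exp (5 * Real.pi * |s.im|) / 2) := by
    positivity
  have hne : Complex.sin (5 * (Real.pi * s)) ≠ 0 := norm_pos_iff.1 (h2.trans_le h1)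
  refine (norm_kernel_le hk hs hne).trans ?_
  have := (gammaQuot_pos (show 0 < -s.re by linarith)).le
  have hpi := Real.pi_pos
  calc _ ≤ Real.pi * gammaQuot (-s.re) * Real.exp (Real.pi * |s.im|) ^ (4 - k) /
        (|Real.sin (5 * (Real.pi * s.re))| * (Real.exp (5 * Real.pi * |s.im|) / 2)) := by gcongr
    _ = 2 * Real.pi / |Real.sin (5 * (Real.pi * s.re))| * gammaQuot (-s.re) *
      (Real.exp (Real.pi * |s.im|) ^ (4 - k) / Real.exp (5 * Real.pi * |s.im|)) := by
        field_simp
    _ = _ := by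
      rw [← Real.exp_nat_mul, ← Real.exp_sub, Nat.cast_sub (by omega)]
      congr 2
      push_cast
      ring

theorem decaysOn_kernel_of_neg {k : ℕ} (hk : k ≤ 3) (a : ℝ) {b : ℝ} (hb : b < 0) :
    DecaysOn (tails a b) ((k + 1) * Real.pi) (kernel k) := by
  have hsub : Set.Icc (-b) (-a) ⊆ Set.Ioi 0 := fun x hx => by
    have := hx.1
    simp only [Set.mem_Ioi]
    linarith
  obtain ⟨M, hM⟩ := isCompact_Icc.bddAbove_image (continuousOn_gammaQuot.mono hsub)
  refine ⟨4 * Real.pi * M, fun s hs => ?_⟩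
  have hsre : s.re < 0 := hs.2.1.trans_lt hb
  have hpi := Real.pi_pos
  have him : |(5 * ((Real.pi : ℂ) * s)).im| = 5 * Real.pi * |s.im| := by
    simp [abs_mul, abs_of_pos Real.pi_pos]
    ring
  have h1 := le_norm_sin_of_one_le (z := 5 * (Real.pi * s)) (by
    rw [him]
    nlinarith [hs.2.2, Real.pi_gt_three])
  rw [him] at h1
  have hne : Complex.sin (5 * (Real.pi * s)) ≠ 0 :=
    norm_pos_iff.1 ((by positivity : (0 : ℝ) < Real.exp (5 * Real.pi * |s.im|) / 4).trans_le h1)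
  refine (norm_kernel_le hk hsre hne).trans ?_
  have h2 : gammaQuot (-s.re) ≤ M :=
    hM (Set.mem_image_of_mem _ ⟨by linarith [hs.2.1], by linarith [hs.1]⟩)
  have h3 := (gammaQuot_pos (show 0 < -s.re by linarith)).le
  have hM0 := h3.trans h2
  calc _ ≤ Real.pi * M * Real.exp (Real.pi * |s.im|) ^ (4 - k) /
        (Real.exp (5 * Real.pi * |s.im|) / 4) := by gcongr
    _ = 4 * Real.pi * M *
      (Real.exp (Real.pi * |s.im|) ^ (4 - k) / Real.exp (5 * Real.pi * |s.im|)) := by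
        field_simp
    _ = _ := by
      rw [← Real.exp_nat_mul, ← Real.exp_sub, Nat.cast_sub (by omega)]
      congr 2
      push_cast
      ring

/-- The reflection bound covers Re s < 0; the recursion carries it to the right one unit at a time,
since its rational factor is bounded for |Im s| ≥ 1. -/
theorem decaysOn_kernel {k : ℕ} (hk : k ≤ 3) (a b : ℝ) :
    DecaysOn (tails a b) ((k + 1) * Real.pi) (kernel k) := by
  have key : ∀ n : ℕ, ∀ a : ℝ,
      DecaysOn (tails a (n - 1 / 2)) ((k + 1) * Real.pi) (kernel k) := by
    intro n
    induction n with
    | zero => exact fun a => decaysOn_kernel_of_neg hk a (by norm_num)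
    | succ n ih =>
      intro a
      obtain ⟨C, hC0, hC⟩ := (ih (a - 1)).exists_nonneg
      -- After replacing s by s - 1, each of the four linear factors is at most 2|s|, and the
      -- denominator is |s|^4.
      refine ⟨5 ^ 5 * 2 ^ 4 * C, fun s hs => ?_⟩
      have h1 := hC (s - 1) ⟨by simp; linarith [hs.1], by
        have := hs.2.1
        push_cast at this
        simp only [Complex.sub_re, Complex.one_re]
        linarith, by simpa using hs.2.2⟩
      have him : (s - 1).im = s.im := by simp
      rw [him] at h1
      have hs0 : s.im ≠ 0 := by
        intro h
        have := hs.2.2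
        rw [h, abs_zero] at this
        linarith
      have hrec := kernel_add_one hk (s := s - 1) fun m h => by
        have := congrArg Complex.im h
        simp at this
        exact hs0 this
      rw [sub_add_cancel] at hrec
      have hsn : 1 ≤ ‖s‖ := hs.2.2.trans (Complex.abs_im_le_norm s)
      have hfac : ∀ q : ℝ, 0 ≤ q → q ≤ 1 → ‖s - 1 + q‖ ≤ 2 * ‖s‖ := by
        intro q hq0 hq1
        calc ‖s - 1 + q‖ = ‖s + ((q - 1 : ℝ) : ℂ)‖ := by push_cast; ring_nf
          _ ≤ ‖s‖ + ‖((q - 1 : ℝ) : ℂ)‖ := norm_add_le _ _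
          _ ≤ ‖s‖ + 1 := by
            rw [Complex.norm_real, Real.norm_eq_abs]
            gcongr
            rw [abs_le]
            constructor <;> linarith
          _ ≤ 2 * ‖s‖ := by linarith
      have f1 := hfac (1 / 5) (by norm_num) (by norm_num)
      have f2 := hfac (2 / 5) (by norm_num) (by norm_num)
      have f3 := hfac (3 / 5) (by norm_num) (by norm_num)
      have f4 := hfac (4 / 5) (by norm_num) (by norm_num)
      push_cast at f1 f2 f3 f4
      rw [hrec, norm_mul, norm_mul, norm_pow, norm_neg, norm_one, one_pow, one_mul, norm_div,
        norm_mul, norm_mul, norm_mul, norm_mul, norm_pow, norm_pow, Complex.norm_ofNat]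
      calc _ ≤ 5 ^ 5 * (2 * ‖s‖ * (2 * ‖s‖) * (2 * ‖s‖) * (2 * ‖s‖)) / ‖s‖ ^ 4 *
            (C * Real.exp (-((k + 1) * Real.pi) * |s.im|)) := by gcongr
        _ = _ := by
          field_simp
  obtain ⟨n, hn⟩ := exists_nat_ge (b + 1 / 2)
  exact (key n a).mono fun s hs => ⟨hs.1, hs.2.1.trans (by linarith), hs.2.2⟩

/-! ### The Barnes integrals as integrals of `kernel k s * exp (s v)` -/

/-- The variable `v` for which the `k`-th Barnes integrand is `kernel k s * exp (s v)`. -/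
noncomputable def barnesArg (k : Fin 4) (u : ℂ) : ℂ :=
  u + if (k : ℕ) % 2 = 0 then Real.pi * Complex.I else 0

theorem barnesIntegrand_eq (k : Fin 4) (u s : ℂ) :
    barnesIntegrand k u s = kernel k s * Complex.exp (s * barnesArg k u) := by
  fin_cases k <;> simp [barnesIntegrand, kernel, barnesArg, div_eq_mul_inv]

theorem Phi_eq (ε : ℝ) (k : Fin 4) (u : ℂ) : Phi ε k u =
    barnesPrefactor k * lineIntegral ε (fun s => kernel k s * Complex.exp (s * barnesArg k u)) := by
  rw [Phi]
  congr 2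
  ext s
  exact barnesIntegrand_eq k u s

/-- For k = 0 the range |Im v| < π is exactly the strip; for k = 1 the strip touches the edge Im u =
-2π; for k = 2, 3 there is room on both sides. -/
theorem abs_im_barnesArg_lt (k : Fin 4) {u : ℂ} (hu : u ∈ strip) :
    |(barnesArg k u).im| < ((k : ℕ) + 1) * Real.pi := by
  have h1 := hu.1
  have h2 := hu.2
  have hpi := Real.pi_pos
  rw [abs_lt]
  fin_cases k <;> simp [barnesArg] <;> constructor <;> linarith

theorem kernel_index_le (k : Fin 4) : (k : ℕ) ≤ 3 := by omega

theorem differentiableAt_kernel_of_re {k : ℕ} {s : ℂ} (h : ∀ n : ℤ, 5 * s.re ≠ n) :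
    DifferentiableAt ℂ (kernel k) s := by
  refine differentiableAt_kernel (fun n hn => ?_) fun n hn => ?_
  · have h1 := congrArg Complex.re hn
    simp at h1
    refine h (-(n + 1)) ?_
    push_cast
    linarith
  · have h1 := congrArg Complex.re hn
    simp at h1
    refine h (5 * n) ?_
    push_cast
    linarith

theorem continuousOn_kernel {k : ℕ} {x : ℝ} (h : ∀ n : ℤ, 5 * x ≠ n) :
    ContinuousOn (kernel k) (vline x) := fun s hs =>
  (differentiableAt_kernel_of_re (by rw [show s.re = x from hs]; exact h)).continuousAt
    |>.continuousWithinAt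

theorem decaysOn_kernel_vline {k : ℕ} (hk : k ≤ 3) {x : ℝ} (h : ∀ n : ℤ, 5 * x ≠ n) :
    DecaysOn (vline x) ((k + 1) * Real.pi) (kernel k) :=
  (decaysOn_kernel hk x x).of_tails (continuousOn_kernel h)

theorem five_mul_ne_int {ε : ℝ} (h1 : -(1 / 5) < ε) (h2 : ε < 0) (n : ℤ) : 5 * ε ≠ n := by
  intro h
  have h3 : (-1 : ℝ) < n := by linarith
  have h4 : (n : ℝ) < 0 := by linarith
  have h5 : -1 < n := by exact_mod_cast h3
  have h6 : n < 0 := by exact_mod_cast h4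
  omega

theorem integrable_barnesIntegrand {ε : ℝ} (h1 : -(1 / 5) < ε) (h2 : ε < 0) (k : Fin 4) {u : ℂ}
    (hu : u ∈ strip) :
    MeasureTheory.Integrable (fun y : ℝ => barnesIntegrand k u (ε + y * Complex.I)) := by
  simp only [barnesIntegrand_eq]
  exact integrable_line (continuousOn_kernel (five_mul_ne_int h1 h2))
    (decaysOn_kernel_vline (kernel_index_le k) (five_mul_ne_int h1 h2)) (abs_im_barnesArg_lt k hu)

/-! ### Simple poles -/

theorem isBigO_sub_div_of_differentiableAt {f g : ℂ → ℂ} {p : ℂ} (hg : DifferentiableAt ℂ g p)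
    (hf : ∀ᶠ s in 𝓝[≠] p, f s = g s / (s - p)) :
    (fun s => f s - g p / (s - p)) =O[𝓝[≠] p] fun _ => (1 : ℂ) := by
  have h1 : (fun s => g s - g p) =O[𝓝[≠] p] fun s => s - p :=
    hg.isBigO_sub.mono nhdsWithin_le_nhds
  obtain ⟨C, hC⟩ := h1.bound
  refine IsBigO.of_bound C ?_
  filter_upwards [hC, hf, self_mem_nhdsWithin] with s h2 h3 h4
  have h5 : s - p ≠ 0 := sub_ne_zero.2 h4
  rw [h3, ← sub_div, norm_div, norm_one, mul_one, div_le_iff₀ (norm_pos_iff.2 h5)]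
  exact h2

theorem Gamma_mul_prod (w : ℂ) (n : ℕ) (h : ∀ j < n, w + j ≠ 0) :
    Complex.Gamma (w + n) = (∏ j ∈ Finset.range n, (w + j)) * Complex.Gamma w := by
  induction n with
  | zero => simp
  | succ n ih =>
    rw [Finset.prod_range_succ, mul_assoc, mul_comm (w + n), ← mul_assoc,
      ← ih fun j hj => h j (by omega), mul_comm, ← Complex.Gamma_add_one _ (h n (by omega))]
    push_cast
    ring_nf

/-- The function `(w + n) Γ(w)`, extended analytically to `w = -n`. -/
noncomputable def gammaPole (n : ℕ) (w : ℂ) : ℂ :=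
  Complex.Gamma (w + n + 1) / ∏ j ∈ Finset.range n, (w + j)

theorem Gamma_eq_gammaPole_div {n : ℕ} {w : ℂ} (h : ∀ j : ℕ, j ≤ n → w + j ≠ 0) :
    Complex.Gamma w = gammaPole n w / (w + n) := by
  have h1 := Gamma_mul_prod w (n + 1) fun j hj => h j (by omega)
  have h2 : ∏ j ∈ Finset.range n, (w + j) ≠ 0 :=
    Finset.prod_ne_zero_iff.2 fun j hj => h j (Finset.mem_range.1 hj).le
  have h3 := h n le_rfl
  rw [gammaPole, show w + n + 1 = w + ((n + 1 : ℕ) : ℂ) by push_cast; ring, h1,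
    Finset.prod_range_succ]
  field_simp

theorem prod_neg_add (n : ℕ) :
    ∏ j ∈ Finset.range n, (-(n : ℂ) + j) = (-1) ^ n * (n.factorial : ℂ) := by
  rw [← Finset.prod_range_reflect, ← Finset.prod_range_add_one_eq_factorial, Nat.cast_prod,
    ← Finset.card_range n, ← Finset.prod_const, Finset.card_range, ← Finset.prod_mul_distrib]
  refine Finset.prod_congr rfl fun j hj => ?_
  have := Finset.mem_range.1 hj
  rw [Nat.cast_sub (by omega), Nat.cast_sub (by omega)]
  push_cast
  ring

theorem gammaPole_neg (n : ℕ) : gammaPole n (-n) = (-1) ^ n / (n.factorial : ℂ) := by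
  rw [gammaPole, prod_neg_add, neg_add_cancel, zero_add, Complex.Gamma_one]
  have h : ((-1 : ℂ) ^ n) * (-1) ^ n = 1 := by rw [← mul_pow]; simp
  have h0 : (n.factorial : ℂ) ≠ 0 := by exact_mod_cast n.factorial_ne_zero
  have h1 : (-1 : ℂ) ^ n ≠ 0 := pow_ne_zero _ (by norm_num)
  field_simp
  linear_combination -h

theorem differentiableAt_gammaPole (n : ℕ) : DifferentiableAt ℂ (gammaPole n) (-n) := by
  refine DifferentiableAt.div ?_ (by fun_prop) ?_
  · refine DifferentiableAt.comp (-n : ℂ) (f := fun w : ℂ => w + n + 1) ?_ (by fun_prop)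
    simpa using Complex.differentiableAt_Gamma_one
  · rw [prod_neg_add]
    have h0 : (n.factorial : ℂ) ≠ 0 := by exact_mod_cast n.factorial_ne_zero
    exact mul_ne_zero (pow_ne_zero _ (by norm_num)) h0

theorem eventually_add_nat_ne_zero (n : ℕ) :
    ∀ᶠ w : ℂ in 𝓝[≠] (-n : ℂ), ∀ j : ℕ, j ≤ n → w + j ≠ 0 := by
  have h : ∀ j ∈ Finset.range (n + 1), ∀ᶠ w : ℂ in 𝓝[≠] (-n : ℂ), w + j ≠ 0 := by
    intro j _
    by_cases hj : j = n
    · subst hj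
      filter_upwards [self_mem_nhdsWithin] with w hw h0
      exact hw (eq_neg_of_add_eq_zero_left h0)
    · refine nhdsWithin_le_nhds (ContinuousAt.eventually_ne (by fun_prop) ?_)
      intro h0
      apply hj
      have : (j : ℂ) = n := by linear_combination h0
      exact_mod_cast this
  filter_upwards [(eventually_all_finset _).2 h] with w hw j hj
  exact hw j (Finset.mem_range.2 (by omega))

/-! ### Residues on the left -/

/-- The residue of `kernel k` at `s = -(n + 1) / 5`. -/
noncomputable def leftResidue (k n : ℕ) : ℂ :=
  1 / 5 * ((-1) ^ n / (n.factorial : ℂ)) * Complex.Gamma ((n + 1) / 5) ^ (k + 1) *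
    ((Complex.Gamma (1 - (n + 1) / 5))⁻¹) ^ (4 - k)

/-- Only Γ(5s+1) is singular here. As 1/Γ(s+1) is entire, the negative integers need no separate
treatment: the residue there comes out as 0. -/
theorem kernel_left_pole (k n : ℕ) :
    (fun s : ℂ => kernel k s - leftResidue k n / (s - ((-(n + 1) / 5 : ℝ) : ℂ)))
      =O[𝓝[≠] ((-(n + 1) / 5 : ℝ) : ℂ)] fun _ => (1 : ℂ) := by
  set p : ℂ := ((-(n + 1) / 5 : ℝ) : ℂ) with hp
  have hp' : p = -(n + 1) / 5 := by rw [hp]; push_cast; ring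
  set g : ℂ → ℂ := fun s => 1 / 5 * gammaPole n (5 * s + 1) * Complex.Gamma (-s) ^ (k + 1) *
    ((Complex.Gamma (s + 1))⁻¹) ^ (4 - k) with hg
  have h5p : 5 * p + 1 = -n := by rw [hp']; ring
  have hgp : g p = leftResidue k n := by
    simp only [hg, leftResidue]
    rw [h5p, gammaPole_neg, hp']
    ring_nf
  have hgd : DifferentiableAt ℂ g p := by
    have a1 : DifferentiableAt ℂ (fun s : ℂ => gammaPole n (5 * s + 1)) p := by
      have h0 : DifferentiableAt ℂ (gammaPole n) (5 * p + 1) := by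
        rw [h5p]
        exact differentiableAt_gammaPole n
      exact h0.comp p (f := fun s : ℂ => 5 * s + 1) (by fun_prop)
    have a2 : DifferentiableAt ℂ (fun s : ℂ => Complex.Gamma (-s)) p := by
      refine DifferentiableAt.comp (𝕜 := ℂ) p (f := fun s : ℂ => -s) ?_ (by fun_prop)
      refine Complex.differentiableAt_Gamma _ fun m hm => ?_
      have h1 := congrArg Complex.re hm
      rw [hp, ← Complex.ofReal_neg, Complex.ofReal_re] at h1
      simp at h1
      have h2 : (0 : ℝ) ≤ m := m.cast_nonneg
      have h3 : (0 : ℝ) ≤ n := n.cast_nonneg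
      linarith
    have a3 : DifferentiableAt ℂ (fun s : ℂ => (Complex.Gamma (s + 1))⁻¹) p :=
      (Complex.differentiable_one_div_Gamma (p + 1)).comp p
        (f := fun s : ℂ => s + 1) (by fun_prop)
    exact ((a1.const_mul _).mul (a2.pow _)).mul (a3.pow _)
  have hT : Tendsto (fun s : ℂ => 5 * s + 1) (𝓝[≠] p) (𝓝[≠] (-n : ℂ)) := by
    refine tendsto_nhdsWithin_of_tendsto_nhds_of_eventually_within _ ?_ ?_
    · rw [← h5p]
      exact (Continuous.tendsto (by fun_prop) p).mono_left nhdsWithin_le_nhds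
    · filter_upwards [self_mem_nhdsWithin] with s hs h0
      refine hs ?_
      have h0' : 5 * s + 1 = -n := h0
      show s = p
      linear_combination (h0' - h5p) / 5
  rw [← hgp]
  refine isBigO_sub_div_of_differentiableAt hgd ?_
  filter_upwards [hT.eventually (eventually_add_nat_ne_zero n), self_mem_nhdsWithin] with s hs hsp
  have h1 := Gamma_eq_gammaPole_div hs
  have h2 : 5 * s + 1 + n = 5 * (s - p) := by rw [hp']; ring
  have h3 : s - p ≠ 0 := sub_ne_zero.2 hsp
  rw [kernel, h1, h2]
  simp only [hg]
  field_simp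

theorem lineIntegral_left_step {ε : ℝ} (h1 : -(1 / 5) < ε) (h2 : ε < 0) {k : ℕ} (hk : k ≤ 3) {v : ℂ}
    (hv : |v.im| < (k + 1) * Real.pi) (n : ℕ) :
    lineIntegral (ε - n / 5) (fun s => kernel k s * Complex.exp (s * v)) =
      leftResidue k n * Complex.exp (-((n + 1 : ℕ) / 5) * v) +
        lineIntegral (ε - (n + 1 : ℕ) / 5) (fun s => kernel k s * Complex.exp (s * v)) := by
  have key := lineIntegral_sub_lineIntegral (G := kernel k) (a := ε - (n + 1 : ℕ) / 5)
    (b := ε - n / 5) (p := -(n + 1) / 5) (c := (k + 1) * Real.pi) (n := 1)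
    (A := fun _ => leftResidue k n) (v := v) (by push_cast; linarith) (by linarith) ?_ ?_
    (decaysOn_kernel hk _ _) hv
  · have h3 : ((-(n + 1) / 5 : ℝ) : ℂ) = -((n + 1 : ℕ) / 5) := by push_cast; ring
    rw [h3] at key
    simp only [Finset.sum_range_one, pow_zero, Nat.factorial_zero, Nat.cast_one, div_one,
      mul_one] at key
    linear_combination -key
  · intro s ha hb hs
    have hn : (0 : ℝ) ≤ n := n.cast_nonneg
    push_cast at ha
    refine differentiableAt_kernel (fun m hm => hs ?_) fun m hm => ?_
    · have h3 := congrArg Complex.re hm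
      simp at h3
      have h4 : (m : ℝ) < n + 1 := by linarith
      have h5 : (n : ℝ) < m + 1 := by linarith
      have h6 : m = n := by
        have h4' : m < n + 1 := by exact_mod_cast h4
        have h5' : n < m + 1 := by exact_mod_cast h5
        omega
      subst h6
      push_cast
      linear_combination hm / 5
    · have h3 := congrArg Complex.re hm
      simp at h3
      have hm0 : (0 : ℝ) ≤ m := m.cast_nonneg
      linarith
  · simpa using kernel_left_pole k n

theorem lineIntegral_left_sum {ε : ℝ} (h1 : -(1 / 5) < ε) (h2 : ε < 0) {k : ℕ} (hk : k ≤ 3) {v : ℂ}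
    (hv : |v.im| < (k + 1) * Real.pi) (N : ℕ) :
    lineIntegral ε (fun s => kernel k s * Complex.exp (s * v)) =
      ∑ n ∈ Finset.range N, leftResidue k n * Complex.exp (-((n + 1 : ℕ) / 5) * v) +
        lineIntegral (ε - N / 5) (fun s => kernel k s * Complex.exp (s * v)) := by
  induction N with
  | zero => simp
  | succ N ih =>
    rw [ih, Finset.sum_range_succ, lineIntegral_left_step h1 h2 hk hv N]
    ring

/-- For shifts by an integer M the value |sin(5π Re s)| does not change, so the bound is a constant
times (5^(-5) e^(-Re v))^M. -/
theorem tendsto_lineIntegral_left {ε : ℝ} (h1 : -(1 / 5) < ε) (h2 : ε < 0) {k : ℕ} (hk : k ≤ 3)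
    {v : ℂ} (hv : |v.im| < (k + 1) * Real.pi) (hre : logConifold < v.re) :
    Tendsto (fun M : ℕ => lineIntegral (ε - M) (fun s => kernel k s * Complex.exp (s * v))) atTop
      (𝓝 0) := by
  have hsin : Real.sin (5 * (Real.pi * ε)) ≠ 0 := by
    intro h
    obtain ⟨n, hn⟩ := Real.sin_eq_zero_iff.1 h
    refine five_mul_ne_int h1 h2 n ?_
    have := Real.pi_ne_zero
    field_simp at hn
    linarith
  set B := 2 * Real.pi / |Real.sin (5 * (Real.pi * ε))| with hB
  have hB0 : 0 ≤ B := by have := Real.pi_pos; positivity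
  have hsinM : ∀ M : ℕ, |Real.sin (5 * (Real.pi * (ε - M)))| = |Real.sin (5 * (Real.pi * ε))| := by
    intro M
    have : 5 * (Real.pi * (ε - M)) = 5 * (Real.pi * ε) - ((5 * M : ℕ) : ℝ) * Real.pi := by
      push_cast
      ring
    rw [this, Real.sin_sub_nat_mul_pi, abs_mul, abs_pow, abs_neg, abs_one, one_pow, one_mul]
  have hg0 := gammaQuot_pos (show 0 < -ε by linarith)
  set r := 1 / 5 ^ 5 * Real.exp (-v.re) with hr
  have hr1 : r < 1 := by
    have h3 : Real.exp (-v.re) < 5 ^ 5 := by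
      have h4 : Real.exp (-v.re) < Real.exp (-logConifold) := by
        gcongr
      rw [Real.exp_neg logConifold, exp_logConifold] at h4
      norm_num at h4 ⊢
      exact h4
    rw [hr]
    norm_num
    linarith
  have hr0 : 0 ≤ r := by positivity
  set J := ∫ y : ℝ, Real.exp (-((k + 1) * Real.pi - |v.im|) * |y|) with hJ
  have hbound : ∀ M : ℕ,
      ‖lineIntegral (ε - M) (fun s => kernel k s * Complex.exp (s * v))‖ ≤
        B * gammaQuot (-ε) * J * Real.exp (ε * v.re) * r ^ M := by
    intro M
    have hgM : gammaQuot (-ε + M) ≤ gammaQuot (-ε) * (1 / 5 ^ 5) ^ M :=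
      gammaQuot_add_nat_le (by linarith) M
    have hC : ∀ y : ℝ, ‖kernel k (((ε - M : ℝ) : ℂ) + y * Complex.I)‖ ≤
        (B * (gammaQuot (-ε) * (1 / 5 ^ 5) ^ M)) * Real.exp (-((k + 1) * Real.pi) * |y|) := by
      intro y
      have hre' : (((ε - M : ℝ) : ℂ) + y * Complex.I).re = ε - M := by simp
      have him' : (((ε - M : ℝ) : ℂ) + y * Complex.I).im = y := by simp
      have hneg : ε - M < 0 := by
        have : (0 : ℝ) ≤ M := M.cast_nonneg
        linarith
      have := norm_kernel_line_le hk (s := ((ε - M : ℝ) : ℂ) + y * Complex.I)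
        (by rw [hre']; exact hneg) (by
          rw [hre', ← abs_pos, hsinM, abs_pos]
          exact hsin)
      rw [hre', him', hsinM, show -(ε - M) = -ε + (M : ℝ) by ring] at this
      refine this.trans ?_
      gcongr
    refine (norm_lineIntegral_le (by positivity) hC hv le_rfl).trans (le_of_eq ?_)
    rw [hr, mul_pow, ← Real.exp_nat_mul, show (ε - M) * v.re = ε * v.re + M * -v.re by ring,
      Real.exp_add]
    ring
  refine squeeze_zero_norm hbound ?_
  simpa using (tendsto_pow_atTop_nhds_zero_of_lt_one hr0 hr1).const_mul
    (B * gammaQuot (-ε) * J * Real.exp (ε * v.re))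

/-- Five poles at a time, because the line moves by whole units. -/
theorem tendsto_sum_leftResidue {ε : ℝ} (h1 : -(1 / 5) < ε) (h2 : ε < 0) {k : ℕ} (hk : k ≤ 3)
    {v : ℂ} (hv : |v.im| < (k + 1) * Real.pi) (hre : logConifold < v.re) :
    Tendsto (fun M : ℕ => ∑ n ∈ Finset.range (5 * M),
      leftResidue k n * Complex.exp (-((n + 1 : ℕ) / 5) * v)) atTop
      (𝓝 (lineIntegral ε (fun s => kernel k s * Complex.exp (s * v)))) := by
  have h3 := (tendsto_lineIntegral_left h1 h2 hk hv hre).const_sub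
    (lineIntegral ε (fun s => kernel k s * Complex.exp (s * v)))
  rw [sub_zero] at h3
  refine h3.congr fun M => ?_
  rw [lineIntegral_left_sum h1 h2 hk hv (5 * M)]
  have : ε - ((5 * M : ℕ) : ℝ) / 5 = ε - M := by push_cast; ring
  rw [this]
  ring

/-! ### Residues on the right for `k = 0` -/

/-- For k = 0 the poles at the nonnegative integers are simple, so closing to the right gives a
power series without logarithms. -/
theorem kernel_zero_right_pole (n : ℕ) :
    (fun s : ℂ => kernel 0 s - -((-1) ^ n * (fundCoeff n : ℂ)) / (s - ((n : ℝ) : ℂ)))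
      =O[𝓝[≠] ((n : ℝ) : ℂ)] fun _ => (1 : ℂ) := by
  rw [Complex.ofReal_natCast]
  set g : ℂ → ℂ := fun s => -(Complex.Gamma (5 * s + 1) * gammaPole n (-s) *
    ((Complex.Gamma (s + 1))⁻¹) ^ 4) with hg
  have hgp : g n = -((-1) ^ n * (fundCoeff n : ℂ)) := by
    simp only [hg, fundCoeff]
    have h0 : (n.factorial : ℂ) ≠ 0 := by exact_mod_cast n.factorial_ne_zero
    rw [gammaPole_neg, show (5 * (n : ℂ) + 1) = ((5 * n : ℕ) : ℂ) + 1 by push_cast; ring,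
      Complex.Gamma_nat_eq_factorial, Complex.Gamma_nat_eq_factorial]
    push_cast
    field_simp
  have hgd : DifferentiableAt ℂ g n := by
    have a1 : DifferentiableAt ℂ (fun s : ℂ => Complex.Gamma (5 * s + 1)) n := by
      refine DifferentiableAt.comp (n : ℂ) (f := fun s : ℂ => 5 * s + 1) ?_ (by fun_prop)
      refine Complex.differentiableAt_Gamma _ fun m hm => ?_
      have h3 := congrArg Complex.re hm
      simp at h3
      have h4 : (0 : ℝ) ≤ m := m.cast_nonneg
      have h5 : (0 : ℝ) ≤ n := n.cast_nonneg
      linarith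
    have a2 : DifferentiableAt ℂ (fun s : ℂ => gammaPole n (-s)) n :=
      DifferentiableAt.comp (n : ℂ) (f := fun s : ℂ => -s) (differentiableAt_gammaPole n)
        (by fun_prop)
    have a3 : DifferentiableAt ℂ (fun s : ℂ => (Complex.Gamma (s + 1))⁻¹) n :=
      (Complex.differentiable_one_div_Gamma ((n : ℂ) + 1)).comp (n : ℂ)
        (f := fun s : ℂ => s + 1) (by fun_prop)
    exact ((a1.mul a2).mul (a3.pow _)).neg
  have hT : Tendsto (fun s : ℂ => -s) (𝓝[≠] (n : ℂ)) (𝓝[≠] (-n : ℂ)) := by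
    refine tendsto_nhdsWithin_of_tendsto_nhds_of_eventually_within _ ?_ ?_
    · exact (Continuous.tendsto (by fun_prop) (n : ℂ)).mono_left nhdsWithin_le_nhds
    · filter_upwards [self_mem_nhdsWithin] with s hs h0
      exact hs (neg_injective h0)
  rw [← hgp]
  refine isBigO_sub_div_of_differentiableAt hgd ?_
  filter_upwards [hT.eventually (eventually_add_nat_ne_zero n), self_mem_nhdsWithin] with s hs hsp
  have h1 := Gamma_eq_gammaPole_div hs
  have h2 : -s + n = -(s - n) := by ring
  have h3 : s - n ≠ 0 := sub_ne_zero.2 hsp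
  rw [kernel, h1, h2]
  simp only [hg]
  rw [div_neg]
  simp only [zero_add, pow_one]
  ring

theorem lineIntegral_right_step {ε : ℝ} (h1 : -(1 / 5) < ε) (h2 : ε < 0) {u : ℂ} (hu : u ∈ strip)
    (n : ℕ) :
    lineIntegral (ε + n) (fun s => kernel 0 s * Complex.exp (s * barnesArg 0 u)) =
      fundCoeff n * Complex.exp u ^ n +
        lineIntegral (ε + (n + 1 : ℕ)) (fun s => kernel 0 s * Complex.exp (s * barnesArg 0 u)) := by
  have key := lineIntegral_sub_lineIntegral (G := kernel 0) (a := ε + n)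
    (b := ε + (n + 1 : ℕ)) (p := n) (c := ((0 : ℕ) + 1) * Real.pi) (n := 1)
    (A := fun _ => -((-1) ^ n * (fundCoeff n : ℂ))) (v := barnesArg 0 u)
    (by linarith) (by push_cast; linarith) ?_ ?_
    (decaysOn_kernel (by norm_num) _ _) (by simpa using abs_im_barnesArg_lt 0 hu)
  · have h3 : Complex.exp ((n : ℝ) * barnesArg 0 u) = (-1) ^ n * Complex.exp u ^ n := by
      rw [Complex.ofReal_natCast, Complex.exp_nat_mul, ← mul_pow]
      simp [barnesArg, Complex.exp_add]
    have h4 : ((-1 : ℂ) ^ n) * (-1) ^ n = 1 := by rw [← mul_pow]; simp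
    rw [h3] at key
    simp only [Finset.sum_range_one, pow_zero, Nat.factorial_zero, Nat.cast_one, div_one,
      mul_one] at key
    linear_combination key + (Complex.exp u ^ n * fundCoeff n) * h4
  · intro s ha hb hs
    have hn : (0 : ℝ) ≤ n := n.cast_nonneg
    push_cast at hb
    refine differentiableAt_kernel (fun m hm => ?_) fun m hm => hs ?_
    · have h3 := congrArg Complex.re hm
      simp at h3
      have hm0 : (0 : ℝ) ≤ m := m.cast_nonneg
      linarith
    · have h3 := congrArg Complex.re hm
      simp at h3
      have h4 : (m : ℝ) < n + 1 := by linarith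
      have h5 : (n : ℝ) < m + 1 := by linarith
      have h6 : m = n := by
        have h4' : m < n + 1 := by exact_mod_cast h4
        have h5' : n < m + 1 := by exact_mod_cast h5
        omega
      rw [hm, h6]
      simp
  · simpa using kernel_zero_right_pole n

theorem lineIntegral_right_sum {ε : ℝ} (h1 : -(1 / 5) < ε) (h2 : ε < 0) {u : ℂ} (hu : u ∈ strip)
    (N : ℕ) :
    lineIntegral ε (fun s => kernel 0 s * Complex.exp (s * barnesArg 0 u)) =
      ∑ n ∈ Finset.range N, fundCoeff n * Complex.exp u ^ n +
        lineIntegral (ε + N) (fun s => kernel 0 s * Complex.exp (s * barnesArg 0 u)) := by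
  induction N with
  | zero => simp
  | succ N ih =>
    rw [ih, Finset.sum_range_succ, lineIntegral_right_step h1 h2 hu N]
    ring

/-- The squared norms differ by (1-q)(1+q+2 Re s), which is nonnegative for Re s > -1/5. Hence the
recursion factor has modulus at most 5^5 on and to the right of the line. -/
theorem norm_add_le_norm_add_one {s : ℂ} (hs : -(1 / 5) < s.re) {q : ℝ} (h0 : 0 ≤ q)
    (h1 : q ≤ 1) : ‖s + q‖ ≤ ‖s + 1‖ := by
  rw [← sq_le_sq₀ (norm_nonneg _) (norm_nonneg _), ← Complex.normSq_eq_norm_sq,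
    ← Complex.normSq_eq_norm_sq, Complex.normSq_apply, Complex.normSq_apply]
  simp
  by_cases hq : -(1 / 5) ≤ q <;> nlinarith

/-- The rational factor in the recursion of `kernel`. -/
noncomputable def kernelRatio (s : ℂ) : ℂ :=
  (s + 1 / 5) * (s + 2 / 5) * (s + 3 / 5) * (s + 4 / 5) / (s + 1) ^ 4

theorem norm_kernelRatio_le {s : ℂ} (hs : -(1 / 5) < s.re) : ‖kernelRatio s‖ ≤ 1 := by
  have f1 := norm_add_le_norm_add_one hs (q := 1 / 5) (by norm_num) (by norm_num)
  have f2 := norm_add_le_norm_add_one hs (q := 2 / 5) (by norm_num) (by norm_num)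
  have f3 := norm_add_le_norm_add_one hs (q := 3 / 5) (by norm_num) (by norm_num)
  have f4 := norm_add_le_norm_add_one hs (q := 4 / 5) (by norm_num) (by norm_num)
  push_cast at f1 f2 f3 f4
  rw [kernelRatio, norm_div, norm_mul, norm_mul, norm_mul, norm_pow]
  refine div_le_one_of_le₀ ?_ (by positivity)
  calc _ ≤ ‖s + 1‖ * ‖s + 1‖ * ‖s + 1‖ * ‖s + 1‖ := by gcongr
    _ = _ := by ring

theorem kernel_add_one' {k : ℕ} (hk : k ≤ 3) {s : ℂ} (hs : -(1 / 5) < s.re) :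
    kernel k (s + 1) = (-1) ^ (k + 1) * 5 ^ 5 * (kernelRatio s * kernel k s) := by
  rw [kernel_add_one hk, kernelRatio]
  · ring
  · intro n hn
    have h3 := congrArg Complex.re hn
    simp at h3
    have hm0 : (0 : ℝ) ≤ n := n.cast_nonneg
    linarith

theorem norm_kernel_add_nat_le {k : ℕ} (hk : k ≤ 3) {s : ℂ} (hs : -(1 / 5) < s.re) (N : ℕ) :
    ‖kernel k (s + N)‖ ≤ (5 ^ 5) ^ N * ‖kernel k s‖ := by
  induction N with
  | zero => simp
  | succ N ih =>
    have hN : (0 : ℝ) ≤ N := N.cast_nonneg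
    have hs' : -(1 / 5) < (s + N).re := by
      simp
      linarith
    have h1 : s + ((N + 1 : ℕ) : ℂ) = s + N + 1 := by push_cast; ring
    rw [h1, kernel_add_one' hk hs']
    simp only [norm_mul, norm_pow, norm_neg, norm_one, one_pow, one_mul, Complex.norm_ofNat]
    calc _ ≤ 5 ^ 5 * (1 * ((5 ^ 5) ^ N * ‖kernel k s‖)) := by
          gcongr
          exact norm_kernelRatio_le hs'
      _ = _ := by ring

/-- Each unit step multiplies the bound by 5^5 |z| < 1, the exact opposite of the situation on the
left. -/
theorem tendsto_lineIntegral_right {ε : ℝ} (h1 : -(1 / 5) < ε) (h2 : ε < 0) {u : ℂ}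
    (hu : u ∈ strip) (hre : u.re < logConifold) :
    Tendsto (fun N : ℕ => lineIntegral (ε + N)
      (fun s => kernel 0 s * Complex.exp (s * barnesArg 0 u))) atTop (𝓝 0) := by
  obtain ⟨C, hC0, hC⟩ :=
    (decaysOn_kernel_vline (k := 0) (by norm_num) (five_mul_ne_int h1 h2)).line_bound
  have hv : |(barnesArg 0 u).im| < ((0 : ℕ) + 1) * Real.pi := by
    simpa using abs_im_barnesArg_lt 0 hu
  have hvre : (barnesArg 0 u).re = u.re := by simp [barnesArg]
  set r := 5 ^ 5 * Real.exp u.re with hr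
  have hr1 : r < 1 := by
    have h4 : Real.exp u.re < Real.exp logConifold := by gcongr
    rw [exp_logConifold] at h4
    rw [hr]
    norm_num at h4 ⊢
    linarith
  have hr0 : 0 ≤ r := by positivity
  set J := ∫ y : ℝ, Real.exp (-(((0 : ℕ) + 1) * Real.pi - |(barnesArg 0 u).im|) * |y|) with hJ
  have hbound : ∀ N : ℕ, ‖lineIntegral (ε + N)
      (fun s => kernel 0 s * Complex.exp (s * barnesArg 0 u))‖ ≤
        C * J * Real.exp (ε * u.re) * r ^ N := by
    intro N
    have hCN : ∀ y : ℝ, ‖kernel 0 (((ε + N : ℝ) : ℂ) + y * Complex.I)‖ ≤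
        ((5 ^ 5) ^ N * C) * Real.exp (-(((0 : ℕ) + 1) * Real.pi) * |y|) := by
      intro y
      have h3 := norm_kernel_add_nat_le (k := 0) (by norm_num) (s := ε + y * Complex.I)
        (by simpa using h1) N
      have h4 : ((ε + N : ℝ) : ℂ) + y * Complex.I = ε + y * Complex.I + N := by push_cast; ring
      rw [h4, mul_assoc]
      exact h3.trans (by gcongr; exact hC y)
    refine (norm_lineIntegral_le (by positivity) hCN hv le_rfl).trans (le_of_eq ?_)
    rw [hr, mul_pow, ← Real.exp_nat_mul, hvre,
      show (ε + N) * u.re = ε * u.re + N * u.re by ring, Real.exp_add]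
    ring
  refine squeeze_zero_norm hbound ?_
  simpa using (tendsto_pow_atTop_nhds_zero_of_lt_one hr0 hr1).const_mul
    (C * J * Real.exp (ε * u.re))

theorem tendsto_sum_fundCoeff {ε : ℝ} (h1 : -(1 / 5) < ε) (h2 : ε < 0) {u : ℂ}
    (hu : u ∈ strip) (hre : u.re < logConifold) :
    Tendsto (fun N : ℕ => ∑ n ∈ Finset.range N, (fundCoeff n : ℂ) * Complex.exp u ^ n) atTop
      (𝓝 (Phi ε 0 u)) := by
  have h3 := (tendsto_lineIntegral_right h1 h2 hu hre).const_sub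
    (lineIntegral ε (fun s => kernel 0 s * Complex.exp (s * barnesArg 0 u)))
  rw [sub_zero] at h3
  rw [Phi_eq]
  simp only [barnesPrefactor, one_mul]
  refine h3.congr fun N => ?_
  rw [lineIntegral_right_sum h1 h2 hu N]
  ring

/-! ### Convergence of the series for `ϖ_j` -/

theorem inv_Gamma_one_sub {z : ℂ} (hz : 0 < z.re) :
    (Complex.Gamma (1 - z))⁻¹ = Complex.Gamma z * (Complex.sin (Real.pi * z) / Real.pi) := by
  have h := Complex.Gamma_mul_Gamma_one_sub z
  have h0 := Complex.Gamma_ne_zero_of_re_pos hz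
  have hG : Complex.Gamma (1 - z) = Real.pi / Complex.sin (Real.pi * z) / Complex.Gamma z := by
    rw [← h, mul_div_cancel_left₀ _ h0]
  rw [hG, inv_div, div_div_eq_mul_div, mul_div_assoc]

/-- The number `α = exp (2 π i / 5)`. -/
noncomputable def rootOfUnity : ℂ := Complex.exp (2 * Real.pi * Complex.I / 5)

theorem norm_rootOfUnity : ‖rootOfUnity‖ = 1 := by
  rw [rootOfUnity, show 2 * Real.pi * Complex.I / 5 = ((2 * Real.pi / 5 : ℝ) : ℂ) * Complex.I by
    push_cast; ring, Complex.norm_exp_ofReal_mul_I]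

/-- The coefficient `Γ(m/5) / (Γ(m) Γ(1 - m/5) ^ 4)` with `m = n + 1`. -/
noncomputable def varpiCoeff (n : ℕ) : ℂ :=
  Complex.Gamma ((n + 1 : ℕ) / 5) /
    (Complex.Gamma (n + 1 : ℕ) * Complex.Gamma (1 - (n + 1 : ℕ) / 5) ^ 4)

theorem varpiTerm_eq (j : Fin 5) (u : ℂ) (n : ℕ) : varpiTerm j u n =
    -(1 / 5) * ((rootOfUnity ^ (n + 1)) ^ (2 + (j : ℕ)) *
      (varpiCoeff n * Complex.exp (-((n + 1 : ℕ) / 5) * u))) := by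
  rw [varpiTerm, varpiCoeff, rootOfUnity, ← pow_mul, mul_comm (n + 1)]
  ring

/-- Reflection replaces the four factors 1/Γ(1 - m/5) by Γ(m/5) sin(πm/5)/π, and the sines over π
are at most 1. -/
theorem norm_varpiCoeff_le (n : ℕ) : ‖varpiCoeff n‖ ≤ gammaQuot ((n + 1) / 5) := by
  have hre : (((n + 1 : ℕ) : ℂ) / 5).re = (n + 1) / 5 := by
    rw [show (((n + 1 : ℕ) : ℂ) / 5) = (((n + 1) / 5 : ℝ) : ℂ) by push_cast; ring,
      Complex.ofReal_re]
  have hpos : 0 < (((n + 1 : ℕ) : ℂ) / 5).re := by rw [hre]; positivity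
  have h5 : ((n + 1 : ℕ) : ℂ) = 5 * (((n + 1 : ℕ) : ℂ) / 5) := by ring
  have h1 : varpiCoeff n = Complex.Gamma ((n + 1 : ℕ) / 5) ^ 5 /
      Complex.Gamma (5 * ((n + 1 : ℕ) / 5)) *
      (Complex.sin (Real.pi * ((n + 1 : ℕ) / 5)) / Real.pi) ^ 4 := by
    rw [varpiCoeff, div_mul_eq_div_div, div_eq_mul_inv _ (_ ^ 4), ← inv_pow,
      inv_Gamma_one_sub hpos, ← h5]
    ring
  have h2 : ‖Complex.sin (Real.pi * ((n + 1 : ℕ) / 5)) / Real.pi‖ ≤ 1 := by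
    rw [show ((Real.pi : ℂ) * (((n + 1 : ℕ) : ℂ) / 5)) = ((Real.pi * ((n + 1) / 5) : ℝ) : ℂ) by
      push_cast; ring, ← Complex.ofReal_sin, ← Complex.ofReal_div, Complex.norm_real,
      Real.norm_eq_abs, abs_div, abs_of_pos Real.pi_pos]
    refine div_le_one_of_le₀ ?_ Real.pi_pos.le
    exact (Real.abs_sin_le_one _).trans (by linarith [Real.pi_gt_three])
  have h3 := norm_gammaQuot_le hpos
  rw [hre] at h3
  have h4 := (gammaQuot_pos (show (0 : ℝ) < (n + 1) / 5 by positivity)).le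
  rw [h1, norm_mul, norm_pow]
  calc _ ≤ gammaQuot ((n + 1) / 5) * 1 ^ 4 := by gcongr
    _ = _ := by ring

/-- After multiplication by (n+1)^2 the sequence does not increase in steps of five, so its first
five terms bound it. The decay n^(-2) gives convergence on the circle |z| = 5^(-5) itself. -/
theorem exists_gammaQuot_bound : ∃ C : ℝ, ∀ n : ℕ,
    gammaQuot ((n + 1) / 5) * 5 ^ (n + 1) ≤ C / (n + 1) ^ 2 := by
  set t : ℕ → ℝ := fun n => gammaQuot ((n + 1) / 5) * 5 ^ (n + 1) * (n + 1) ^ 2 with ht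
  have ht0 : ∀ n, 0 ≤ t n := fun n => by
    have := (gammaQuot_pos (show (0 : ℝ) < (n + 1) / 5 by positivity)).le
    simp only [ht]
    positivity
  have hstep : ∀ n, t (n + 5) ≤ t n := by
    intro n
    set m : ℝ := n + 1 with hm
    have hm0 : 0 < m := by positivity
    have h0 := gammaQuot_pos (show 0 < m / 5 by positivity)
    have h1 : (((n + 5 : ℕ) : ℝ) + 1) / 5 = m / 5 + 1 := by rw [hm]; push_cast; ring
    have h2 : ((n + 5 : ℕ) : ℝ) + 1 = m + 5 := by rw [hm]; push_cast; ring
    simp only [ht]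
    rw [h1, h2, gammaQuot_add_one (by positivity), show n + 5 + 1 = (n + 1) + 5 by ring, pow_add]
    have h3 : (m / 5) ^ 4 / (5 * ((5 * (m / 5) + 1) * (5 * (m / 5) + 2) * (5 * (m / 5) + 3) *
        (5 * (m / 5) + 4))) * 5 ^ 5 * (m + 5) ^ 2 ≤ m ^ 2 := by
      have e : 5 * (m / 5) = m := by ring
      rw [e, div_mul_eq_mul_div, div_mul_eq_mul_div, div_le_iff₀ (by positivity)]
      -- Here (m+1)(m+4) = m(m+5)+4 and (m+2)(m+3) = m(m+5)+6.
      have h4 : (m * (m + 5)) ^ 2 ≤ (m * (m + 5) + 4) * (m * (m + 5) + 6) := by nlinarith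
      have h5 : 0 ≤ m ^ 2 := by positivity
      nlinarith
    calc _ = gammaQuot (m / 5) * 5 ^ (n + 1) * ((m / 5) ^ 4 / (5 * ((5 * (m / 5) + 1) *
          (5 * (m / 5) + 2) * (5 * (m / 5) + 3) * (5 * (m / 5) + 4))) * 5 ^ 5 * (m + 5) ^ 2) := by
          ring
      _ ≤ _ := by gcongr
  refine ⟨∑ i ∈ Finset.range 5, t i, fun n => ?_⟩
  rw [le_div_iff₀ (by positivity)]
  change t n ≤ _
  induction n using Nat.strong_induction_on with
  | _ n ih =>
    by_cases hn : n < 5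
    · exact Finset.single_le_sum (fun i _ => ht0 i) (Finset.mem_range.2 hn)
    · obtain ⟨k, rfl⟩ := Nat.exists_eq_add_of_le' (not_lt.1 hn)
      exact (hstep k).trans (ih k (by omega))

theorem exists_varpiTerm_bound : ∃ C : ℝ, ∀ (j : Fin 5) (u : ℂ) (n : ℕ), logConifold ≤ u.re →
    ‖varpiTerm j u n‖ ≤ C / ((n : ℝ) + 1) ^ 2 := by
  obtain ⟨C, hC⟩ := exists_gammaQuot_bound
  refine ⟨C, fun j u n hu => ?_⟩
  refine le_trans ?_ (hC n)
  have h1 : ‖Complex.exp (-((n + 1 : ℕ) / 5) * u)‖ ≤ 5 ^ (n + 1) := by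
    have h2 : (5 : ℝ) ^ (n + 1) = Real.exp (-((n + 1) / 5) * logConifold) := by
      rw [logConifold, show -((n + 1 : ℝ) / 5) * (-5 * Real.log 5) =
        ((n + 1 : ℕ) : ℝ) * Real.log 5 by push_cast; ring, Real.exp_nat_mul,
        Real.exp_log (by norm_num)]
    rw [h2, Complex.norm_exp, show (-(((n + 1 : ℕ) : ℂ) / 5) * u) =
      ((-((n + 1) / 5) : ℝ) : ℂ) * u by push_cast; ring, Complex.re_ofReal_mul]
    rw [Real.exp_le_exp]
    have : (0 : ℝ) ≤ (n + 1) / 5 := by positivity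
    nlinarith
  have h0 := (gammaQuot_pos (show (0 : ℝ) < (n + 1) / 5 by positivity)).le
  rw [varpiTerm_eq, norm_mul, norm_mul, norm_mul, norm_pow, norm_pow, norm_rootOfUnity, one_pow,
    one_pow, one_mul]
  calc _ ≤ 1 * (gammaQuot ((n + 1) / 5) * 5 ^ (n + 1)) := by
        gcongr
        · norm_num
        · exact norm_varpiCoeff_le n
    _ = _ := one_mul _

theorem summable_const_div_sq (C : ℝ) : Summable fun n : ℕ => C / ((n : ℝ) + 1) ^ 2 := by
  have h := (summable_nat_add_iff 1).2 (Real.summable_one_div_nat_pow.2 (one_lt_two))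
  simpa [div_eq_mul_inv] using h.mul_left C

theorem summable_varpiTerm (j : Fin 5) (u : ℂ) (hu : logConifold ≤ u.re) :
    Summable (varpiTerm j u) := by
  obtain ⟨C, hC⟩ := exists_varpiTerm_bound
  exact Summable.of_norm_bounded (summable_const_div_sq C) fun n => hC j u n hu

theorem continuousOn_varpiSeries (j : Fin 5) :
    ContinuousOn (varpiSeries j) {u | logConifold ≤ u.re} := by
  obtain ⟨C, hC⟩ := exists_varpiTerm_bound
  refine continuousOn_tsum (fun n => ?_) (summable_const_div_sq C) fun n u hu => hC j u n hu
  simp only [varpiTerm]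
  fun_prop

/-! ### Convergence of the fundamental series -/

theorem fundCoeff_succ (n : ℕ) : fundCoeff (n + 1) = fundCoeff n *
    ((5 * n + 1) * (5 * n + 2) * (5 * n + 3) * (5 * n + 4) * (5 * n + 5) / (n + 1) ^ 5) := by
  have h0 : ((n.factorial : ℕ) : ℝ) ≠ 0 := by exact_mod_cast n.factorial_ne_zero
  have h1 : (n : ℝ) + 1 ≠ 0 := by positivity
  rw [fundCoeff, fundCoeff, show 5 * (n + 1) = 5 * n + 1 + 1 + 1 + 1 + 1 by ring]
  simp only [Nat.factorial_succ]
  push_cast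
  field_simp
  ring

theorem fundCoeff_pos (n : ℕ) : 0 < fundCoeff n := by
  rw [fundCoeff]
  have := Nat.factorial_pos (5 * n)
  have := Nat.factorial_pos n
  positivity

/-- The product with (n + 1/4)^2 is nonincreasing and starts at 1/16; the claim follows from n + 1 ≤
4(n + 1/4). -/
theorem fundCoeff_bound (n : ℕ) :
    fundCoeff n * ((5 : ℝ) ^ (-5 : ℤ)) ^ n ≤ 1 / ((n : ℝ) + 1) ^ 2 := by
  have key : fundCoeff n * ((5 : ℝ) ^ (-5 : ℤ)) ^ n * (n + 1 / 4) ^ 2 ≤ 1 / 16 := by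
    induction n with
    | zero => norm_num [fundCoeff]
    | succ n ih =>
      refine le_trans ?_ ih
      have h0 := fundCoeff_pos n
      have hn : (0 : ℝ) ≤ n := n.cast_nonneg
      rw [fundCoeff_succ, pow_succ]
      have h3 : ((5 * n + 1) * (5 * n + 2) * (5 * n + 3) * (5 * n + 4) * (5 * n + 5) /
          ((n : ℝ) + 1) ^ 5) * (5 : ℝ) ^ (-5 : ℤ) * (((n + 1 : ℕ) : ℝ) + 1 / 4) ^ 2 ≤
          (n + 1 / 4) ^ 2 := by
        rw [div_mul_eq_mul_div, div_mul_eq_mul_div, div_le_iff₀ (by positivity)]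
        have e : (5 * (n : ℝ) + 1) * (5 * n + 2) * (5 * n + 3) * (5 * n + 4) * (5 * n + 5) *
            (5 : ℝ) ^ (-5 : ℤ) * (((n + 1 : ℕ) : ℝ) + 1 / 4) ^ 2 =
            ((n ^ 2 + n + 4 / 25) * (n + 5 / 4)) * ((n ^ 2 + n + 6 / 25) * (n + 5 / 4)) *
              (n + 1) := by
          push_cast
          norm_num
          ring
        have e1 : ((n : ℝ) ^ 2 + n + 4 / 25) * (n + 5 / 4) ≤ (n + 1) ^ 2 * (n + 1 / 4) := by
          nlinarith
        have e2 : ((n : ℝ) ^ 2 + n + 6 / 25) * (n + 5 / 4) ≤ (n + 1) ^ 2 * (n + 1 / 4) + 1 / 20 *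
            (n + 5 / 4) := by
          nlinarith
        -- The mean of 4/25 and 6/25 is 1/5. The shift 1/4 is chosen so that in the next inequality
        -- the two cubics differ only in the linear term.
        have e3 : ((n : ℝ) ^ 2 + n + 4 / 25) * (n ^ 2 + n + 6 / 25) ≤
            (n ^ 2 + n + 1 / 5) ^ 2 := by nlinarith
        have e4 : ((n : ℝ) ^ 2 + n + 1 / 5) * (n + 5 / 4) ≤ (n + 1) ^ 2 * (n + 1 / 4) := by
          nlinarith
        rw [e]
        calc _ = ((n : ℝ) ^ 2 + n + 4 / 25) * (n ^ 2 + n + 6 / 25) * (n + 5 / 4) ^ 2 *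
              (n + 1) := by ring
          _ ≤ (n ^ 2 + n + 1 / 5) ^ 2 * (n + 5 / 4) ^ 2 * (n + 1) := by gcongr
          _ = (((n : ℝ) ^ 2 + n + 1 / 5) * (n + 5 / 4)) ^ 2 * (n + 1) := by ring
          _ ≤ ((n + 1) ^ 2 * (n + 1 / 4)) ^ 2 * (n + 1) := by gcongr
          _ = _ := by ring
      calc _ = fundCoeff n * ((5 : ℝ) ^ (-5 : ℤ)) ^ n *
            (((5 * n + 1) * (5 * n + 2) * (5 * n + 3) * (5 * n + 4) * (5 * n + 5) /
          ((n : ℝ) + 1) ^ 5) * (5 : ℝ) ^ (-5 : ℤ) * (((n + 1 : ℕ) : ℝ) + 1 / 4) ^ 2) := by ring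
        _ ≤ _ := by gcongr
  rw [le_div_iff₀ (by positivity)]
  have h0 := (fundCoeff_pos n).le
  have h1 : (0 : ℝ) ≤ fundCoeff n * ((5 : ℝ) ^ (-5 : ℤ)) ^ n := by positivity
  have hn : (0 : ℝ) ≤ n := n.cast_nonneg
  calc _ ≤ fundCoeff n * ((5 : ℝ) ^ (-5 : ℤ)) ^ n * (16 * (n + 1 / 4) ^ 2) := by
        gcongr
        nlinarith
    _ ≤ 1 := by linarith

theorem summable_fundCoeff :
    Summable (fun n : ℕ => fundCoeff n * ((5 : ℝ) ^ (-5 : ℤ)) ^ n) := by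
  refine Summable.of_nonneg_of_le (fun n => ?_) fundCoeff_bound (summable_const_div_sq 1)
  have := (fundCoeff_pos n).le
  positivity

theorem norm_fundCoeff_mul_exp_le {u : ℂ} (hu : u.re ≤ logConifold) (n : ℕ) :
    ‖(fundCoeff n : ℂ) * Complex.exp u ^ n‖ ≤ fundCoeff n * ((5 : ℝ) ^ (-5 : ℤ)) ^ n := by
  have h0 := (fundCoeff_pos n).le
  rw [norm_mul, norm_pow, Complex.norm_real, Real.norm_eq_abs, abs_of_nonneg h0, Complex.norm_exp,
    ← exp_logConifold]
  gcongr

/-- The fundamental series `∑ (5 n)! / (n !) ^ 5 z ^ n` at `z = exp u`. -/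
noncomputable def fundSeries (u : ℂ) : ℂ := ∑' n : ℕ, (fundCoeff n : ℂ) * Complex.exp u ^ n

theorem hasSum_fundSeries {u : ℂ} (hu : u.re ≤ logConifold) :
    HasSum (fun n : ℕ => (fundCoeff n : ℂ) * Complex.exp u ^ n) (fundSeries u) :=
  (Summable.of_norm_bounded summable_fundCoeff (norm_fundCoeff_mul_exp_le hu)).hasSum

theorem continuousOn_fundSeries : ContinuousOn fundSeries {u | u.re ≤ logConifold} :=
  continuousOn_tsum (fun n => by fun_prop) summable_fundCoeff
    fun n _ hu => norm_fundCoeff_mul_exp_le hu n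

theorem fundSeries_logConifold : fundSeries logConifold =
    ((∑' n : ℕ, fundCoeff n * ((5 : ℝ) ^ (-5 : ℤ)) ^ n : ℝ) : ℂ) := by
  rw [fundSeries, Complex.ofReal_tsum]
  refine tsum_congr fun n => ?_
  rw [← Complex.ofReal_exp, exp_logConifold]
  push_cast
  ring

theorem Phi_zero_eq_fundSeries_of_lt {ε : ℝ} (h1 : -(1 / 5) < ε) (h2 : ε < 0) {u : ℂ}
    (hu : u ∈ strip) (hre : u.re < logConifold) : Phi ε 0 u = fundSeries u :=
  tendsto_nhds_unique (tendsto_sum_fundCoeff h1 h2 hu hre)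
    (hasSum_fundSeries hre.le).tendsto_sum_nat

/-! ### The Barnes integrals as combinations of the series `ϖ_j` -/

theorem rootOfUnity_pow_five : rootOfUnity ^ 5 = 1 := by
  rw [rootOfUnity, ← Complex.exp_nat_mul, Complex.exp_eq_one_iff]
  exact ⟨1, by push_cast; ring⟩

theorem isPrimitiveRoot_rootOfUnity : IsPrimitiveRoot rootOfUnity 5 := by
  have := Complex.isPrimitiveRoot_exp 5 (by norm_num)
  exact this

/-- The argument is a nonpositive integer, a pole of Γ, where `Complex.Gamma` has the value 0. The
quotient by it is then 0, which is also the true value of the coefficient. -/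
theorem varpiCoeff_eq_zero {n : ℕ} (h : 5 ∣ n + 1) : Complex.Gamma (1 - (n + 1 : ℕ) / 5) = 0 := by
  obtain ⟨q, hq⟩ := h
  rw [Complex.Gamma_eq_zero_iff]
  refine ⟨q - 1, ?_⟩
  rw [hq, Nat.cast_sub (by omega)]
  push_cast
  ring

theorem sum_pow_rootOfUnity {n : ℕ} (h : ¬ 5 ∣ n + 1) :
    1 + rootOfUnity ^ (n + 1) + (rootOfUnity ^ (n + 1)) ^ 2 + (rootOfUnity ^ (n + 1)) ^ 3 +
      (rootOfUnity ^ (n + 1)) ^ 4 = 0 := by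
  have h1 : rootOfUnity ^ (n + 1) ≠ 1 := fun h0 =>
    h (isPrimitiveRoot_rootOfUnity.dvd_of_pow_eq_one _ h0)
  have h5 : (rootOfUnity ^ (n + 1)) ^ 5 = 1 := by
    rw [← pow_mul, mul_comm, pow_mul, rootOfUnity_pow_five, one_pow]
  have h2 := sub_ne_zero.2 h1
  apply mul_left_cancel₀ h2
  linear_combination h5

theorem sum_varpiTerm (u : ℂ) (n : ℕ) : ∑ j, varpiTerm j u n = 0 := by
  simp only [varpiTerm_eq, Fin.sum_univ_five]
  by_cases h : 5 ∣ n + 1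
  · rw [varpiCoeff, varpiCoeff_eq_zero h]
    simp
  · have := sum_pow_rootOfUnity h
    generalize varpiCoeff n * Complex.exp (-((n + 1 : ℕ) / 5) * u) = E
    simp only [Fin.coe_ofNat_eq_mod]
    norm_num
    linear_combination (-(1 / 5) * (rootOfUnity ^ (n + 1)) ^ 2 * E) * this

theorem sum_varpiSeries {u : ℂ} (hu : logConifold ≤ u.re) : ∑ j, varpiSeries j u = 0 := by
  simp only [varpiSeries]
  rw [← Summable.tsum_finsetSum fun j _ => summable_varpiTerm j u hu]
  simp [sum_varpiTerm]

/-- Each increase of k trades a factor 1/Γ(1 - m/5) for Γ(m/5), that is, multiplies the residue by π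
/ sin(πm/5). -/
theorem leftResidue_eq {k : ℕ} (hk : k ≤ 3) {n : ℕ} (h : ¬ 5 ∣ n + 1) :
    leftResidue k n = 1 / 5 * (-1) ^ n * varpiCoeff n *
      (Real.pi / Complex.sin (Real.pi * ((n + 1 : ℕ) / 5))) ^ k := by
  have hz : 0 < (((n + 1 : ℕ) : ℂ) / 5).re := by
    rw [show (((n + 1 : ℕ) : ℂ) / 5) = (((n + 1) / 5 : ℝ) : ℂ) by push_cast; ring,
      Complex.ofReal_re]
    positivity
  have hG := Complex.Gamma_mul_Gamma_one_sub (((n + 1 : ℕ) : ℂ) / 5)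
  have h1 : Complex.Gamma (1 - (n + 1 : ℕ) / 5) ≠ 0 := by
    intro h0
    obtain ⟨q, hq⟩ := (Complex.Gamma_eq_zero_iff _).1 h0
    apply h
    refine ⟨q + 1, ?_⟩
    have : ((n + 1 : ℕ) : ℂ) = ((5 * (q + 1) : ℕ) : ℂ) := by
      push_cast at hq ⊢
      linear_combination (-5) * hq
    exact_mod_cast this
  have hpow : Complex.Gamma (1 - (n + 1 : ℕ) / 5) ^ 4 =
      Complex.Gamma (1 - (n + 1 : ℕ) / 5) ^ k * Complex.Gamma (1 - (n + 1 : ℕ) / 5) ^ (4 - k) := by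
    rw [← pow_add]
    congr 1
    omega
  have hfac : Complex.Gamma (n + 1 : ℕ) = (n.factorial : ℂ) := by
    push_cast
    exact Complex.Gamma_nat_eq_factorial n
  rw [← hG, leftResidue, varpiCoeff, hfac, hpow]
  have hf : (n.factorial : ℂ) ≠ 0 := by exact_mod_cast n.factorial_ne_zero
  push_cast at h1 ⊢
  rw [mul_pow, inv_pow]
  generalize Complex.Gamma (1 - ((n : ℂ) + 1) / 5) = A at h1 ⊢
  have := pow_ne_zero k h1
  have := pow_ne_zero (4 - k) h1
  field_simp
  ring

theorem leftResidue_eq_zero {k : ℕ} (hk : k ≤ 3) {n : ℕ} (h : 5 ∣ n + 1) :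
    leftResidue k n = 0 := by
  have := varpiCoeff_eq_zero h
  push_cast at this
  rw [leftResidue, this, inv_zero, zero_pow (by omega), mul_zero]

/-- The combinations of `ϖ_0, …, ϖ_3` which give `Φ_0, …, Φ_3`. -/
noncomputable def phiComb : Fin 4 → (Fin 5 → ℂ) → ℂ
  | 0, x => x 0
  | 1, x => -(1 / 5) * (x 0 - 3 * x 1 - 2 * x 2 - x 3)
  | 2, x => 2 / 5 * (-2 * x 0 + x 2 + x 3)
  | 3, x => -(6 / 5) * (2 * x 1 + 2 * x 2 + x 3)

theorem continuous_phiComb (k : Fin 4) : Continuous (phiComb k) := by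
  change Continuous fun x => phiComb k x
  fin_cases k <;> simp only [phiComb] <;> fun_prop

theorem sum_phiComb (k : Fin 4) (s : Finset ℕ) (x : Fin 5 → ℕ → ℂ) :
    ∑ n ∈ s, phiComb k (fun j => x j n) = phiComb k (fun j => ∑ n ∈ s, x j n) := by
  fin_cases k <;>
    simp only [phiComb, ← Finset.mul_sum, Finset.sum_add_distrib, Finset.sum_sub_distrib]

/-- With w = e^(πim/5) and β = w² = α^m one has π / sin(πm/5) = 2πi w / (β - 1), while the shift by
πi for even k contributes w^(-1). Only whole powers of β remain, and 1/(β - 1)^k becomes a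
polynomial in β by the cyclotomic relation. -/
theorem leftResidue_term_eq (k : Fin 4) (u : ℂ) (n : ℕ) :
    barnesPrefactor k * (leftResidue k n * Complex.exp (-((n + 1 : ℕ) / 5) * barnesArg k u)) =
      phiComb k (fun j => varpiTerm j u n) := by
  by_cases h : 5 ∣ n + 1
  · have h0 : varpiCoeff n = 0 := by
      rw [varpiCoeff, varpiCoeff_eq_zero h]
      simp
    rw [leftResidue_eq_zero (kernel_index_le k) h]
    fin_cases k <;> simp [varpiTerm_eq, h0, phiComb]
  have hpi : (Real.pi : ℂ) ≠ 0 := by exact_mod_cast Real.pi_ne_zero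
  set w : ℂ := Complex.exp (Real.pi * ((n + 1 : ℕ) / 5) * Complex.I) with hw
  have hw0 : w ≠ 0 := Complex.exp_ne_zero _
  set β : ℂ := rootOfUnity ^ (n + 1) with hβ
  have hwβ : w ^ 2 = β := by
    rw [hw, hβ, rootOfUnity, ← Complex.exp_nat_mul, ← Complex.exp_nat_mul]
    congr 1
    push_cast
    ring
  have hw5 : (-1 : ℂ) ^ n = -w ^ 5 := by
    have h1 : w ^ 5 = (-1) ^ (n + 1) := by
      rw [hw, ← Complex.exp_nat_mul, ← Complex.exp_pi_mul_I, ← Complex.exp_nat_mul]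
      congr 1
      push_cast
      ring
    rw [h1, pow_succ]
    ring
  have hcyc := sum_pow_rootOfUnity h
  rw [← hβ] at hcyc
  have hβ1 : β - 1 ≠ 0 := by
    intro h0
    rw [sub_eq_zero.1 h0] at hcyc
    norm_num at hcyc
  have hsin : Real.pi / Complex.sin (Real.pi * ((n + 1 : ℕ) / 5)) =
      2 * Real.pi * Complex.I * w / (β - 1) := by
    have h1 : Complex.sin (Real.pi * ((n + 1 : ℕ) / 5)) = (w⁻¹ - w) * Complex.I / 2 := by
      rw [Complex.sin, hw, ← Complex.exp_neg]
      congr 4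
      ring
    have h2 : w⁻¹ - w ≠ 0 := by
      intro h0
      apply hβ1
      rw [← hwβ]
      field_simp at h0
      linear_combination -h0
    have h3 : (w⁻¹ - w) = -(β - 1) / w := by
      rw [← hwβ]
      field_simp
      ring
    rw [h1, h3]
    field_simp
    rw [Complex.I_sq]
  have he : Complex.exp (-((n + 1 : ℕ) / 5) * (u + Real.pi * Complex.I)) =
      Complex.exp (-((n + 1 : ℕ) / 5) * u) * w⁻¹ := by
    rw [hw, ← Complex.exp_neg, ← Complex.exp_add]
    congr 1
    ring
  rw [leftResidue_eq (kernel_index_le k) h, hsin, hw5]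
  simp only [varpiTerm_eq, ← hβ]
  have hI : Complex.I ≠ 0 := Complex.I_ne_zero
  have hI2 := Complex.I_sq
  have hb0 : barnesArg 0 u = u + Real.pi * Complex.I := by simp [barnesArg]
  have hb1 : barnesArg 1 u = u := by simp [barnesArg]
  have hb2 : barnesArg 2 u = u + Real.pi * Complex.I := by simp [barnesArg]
  have hb3 : barnesArg 3 u = u := by simp [barnesArg]
  -- Inverses of β - 1, (β - 1)^2 and (β - 1)^3 modulo 1 + β + β² + β³ + β⁴; the powers β², …, β⁵ on
  -- the right belong to ϖ_0, …, ϖ_3.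
  have key1 : 5 * β ^ 3 / (β - 1) = β ^ 2 - 3 * β ^ 3 - 2 * β ^ 4 - β ^ 5 := by
    rw [div_eq_iff hβ1]
    linear_combination (-1 + 2 * β + (β - 1) ^ 2) * hcyc
  have key2 : 5 * β ^ 3 / (β - 1) ^ 2 = -2 * β ^ 2 + β ^ 4 + β ^ 5 := by
    rw [div_eq_iff (pow_ne_zero 2 hβ1)]
    linear_combination (-1 + 3 * β - β ^ 2 - (β - 1) ^ 3) * hcyc
  have key3 : 5 * β ^ 4 / (β - 1) ^ 3 = 2 * β ^ 3 + 2 * β ^ 4 + β ^ 5 := by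
    rw [div_eq_iff (pow_ne_zero 3 hβ1)]
    linear_combination (1 - 4 * β + 6 * β ^ 2 - 2 * β ^ 3 - (β - 1) ^ 4) * hcyc
  generalize hE : Complex.exp (-((n + 1 : ℕ) / 5) * u) = E at he ⊢
  generalize varpiCoeff n = V
  match k with
  | 0 =>
    rw [hb0, he]
    simp only [barnesPrefactor, phiComb, Fin.coe_ofNat_eq_mod]
    norm_num
    rw [← hwβ]
    field_simp
  | 1 =>
    rw [hb1, hE]
    simp only [barnesPrefactor, phiComb, Fin.coe_ofNat_eq_mod]
    norm_num
    have e1 : Complex.I * ((Real.pi : ℂ)⁻¹ * (1 / 2)) * (1 / 5 * w ^ 5 * V *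
        (2 * Real.pi * Complex.I * w / (β - 1)) * E) =
        Complex.I ^ 2 * (1 / 5) * (w ^ 2) ^ 3 / (β - 1) * V * E := by
      field_simp
    rw [e1, hwβ, hI2]
    linear_combination (-(1 / 25) * V * E) * key1
  | 2 =>
    rw [hb2, he]
    simp only [barnesPrefactor, phiComb, Fin.coe_ofNat_eq_mod]
    norm_num
    have e1 : ((Real.pi : ℂ) ^ 2)⁻¹ * (1 / 2) * (1 / 5 * w ^ 5 * V *
        (2 * Real.pi * Complex.I * w / (β - 1)) ^ 2 * (E * w⁻¹)) =
        Complex.I ^ 2 * (2 / 5) * (w ^ 2) ^ 3 / (β - 1) ^ 2 * V * E := by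
      field_simp
    rw [e1, hwβ, hI2]
    linear_combination (-(2 / 25) * V * E) * key2
  | 3 =>
    rw [hb3, hE]
    simp only [barnesPrefactor, phiComb, Fin.coe_ofNat_eq_mod]
    norm_num
    have e1 : ((2 * (Real.pi : ℂ) * Complex.I) ^ 3)⁻¹ * 6 * (1 / 5 * w ^ 5 * V *
        (2 * Real.pi * Complex.I * w / (β - 1)) ^ 3 * E) =
        (6 / 5) * (w ^ 2) ^ 4 / (β - 1) ^ 3 * V * E := by
      field_simp
    rw [e1, hwβ]
    linear_combination (6 / 25 * V * E) * key3

theorem Phi_eq_phiComb_varpiSeries {ε : ℝ} (h1 : -(1 / 5) < ε) (h2 : ε < 0) (k : Fin 4) {u : ℂ}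
    (hu : u ∈ strip) (hre : logConifold < u.re) :
    Phi ε k u = phiComb k (fun j => varpiSeries j u) := by
  have hre' : logConifold < (barnesArg k u).re := by
    have : (barnesArg k u).re = u.re := by
      rw [barnesArg]
      split_ifs <;> simp
    rwa [this]
  have hl := (tendsto_sum_leftResidue h1 h2 (kernel_index_le k) (abs_im_barnesArg_lt k hu)
    hre').const_mul (barnesPrefactor k)
  rw [← Phi_eq] at hl
  have h5 : Tendsto (fun M : ℕ => 5 * M) atTop atTop :=
    tendsto_id.const_mul_atTop' (by norm_num)
  have hr : Tendsto (fun M : ℕ => phiComb k (fun j => ∑ n ∈ Finset.range (5 * M),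
      varpiTerm j u n)) atTop (𝓝 (phiComb k (fun j => varpiSeries j u))) := by
    refine (continuous_phiComb k).continuousAt.tendsto.comp (tendsto_pi_nhds.2 fun j => ?_)
    exact (summable_varpiTerm j u hre.le).hasSum.tendsto_sum_nat.comp h5
  refine tendsto_nhds_unique hl (hr.congr fun M => ?_)
  rw [← sum_phiComb, Finset.mul_sum]
  exact Finset.sum_congr rfl fun n _ => (leftResidue_term_eq k u n).symm

/-- The coefficients are real and conjugation sends α^(2m) to α^(-2m) = α^(3m). -/
theorem varpiSeries_one_eq_conj (x : ℝ) :
    varpiSeries 1 x = (starRingEnd ℂ) (varpiSeries 0 x) := by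
  have hα : (starRingEnd ℂ) rootOfUnity = rootOfUnity ^ 4 := by
    have h0 : rootOfUnity * (starRingEnd ℂ) rootOfUnity = 1 := by
      rw [Complex.mul_conj, Complex.normSq_eq_norm_sq, norm_rootOfUnity]
      simp
    have h1 : rootOfUnity ≠ 0 := by
      intro h
      rw [h, zero_mul] at h0
      exact zero_ne_one h0
    apply mul_left_cancel₀ h1
    rw [h0]
    linear_combination -rootOfUnity_pow_five
  have hV : ∀ n : ℕ, (starRingEnd ℂ) (varpiCoeff n) = varpiCoeff n := by
    intro n
    simp only [varpiCoeff, map_div₀, map_mul, map_pow, ← Complex.Gamma_conj, map_sub, map_one,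
      map_natCast, map_ofNat]
  rw [varpiSeries, varpiSeries, Complex.conj_tsum]
  refine tsum_congr fun n => ?_
  rw [varpiTerm_eq, varpiTerm_eq]
  have h5 : (rootOfUnity ^ (n + 1)) ^ 5 = 1 := by
    rw [← pow_mul, mul_comm, pow_mul, rootOfUnity_pow_five, one_pow]
  simp only [map_mul, map_neg, map_div₀, map_one, map_ofNat, map_pow, hα, hV, ← Complex.exp_conj,
    map_natCast, Complex.conj_ofReal]
  have h6 : ((rootOfUnity ^ 4) ^ (n + 1)) ^ (2 + ((0 : Fin 5) : ℕ)) =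
      (rootOfUnity ^ (n + 1)) ^ (2 + ((1 : Fin 5) : ℕ)) := by
    have h7 : (rootOfUnity ^ 4) ^ (n + 1) = (rootOfUnity ^ (n + 1)) ^ 4 := by
      rw [← pow_mul, ← pow_mul, mul_comm]
    rw [h7]
    simp only [Fin.coe_ofNat_eq_mod]
    norm_num
    linear_combination (rootOfUnity ^ (n + 1)) ^ 3 * h5
  rw [h6]

/-! ### Derivatives of the Barnes integrals -/

theorem DecaysOn.mono_rate {S : Set ℂ} {c c' : ℝ} {G : ℂ → ℂ} (h : DecaysOn S c G) (hc : c' ≤ c) :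
    DecaysOn S c' G := by
  obtain ⟨C, hC0, hC⟩ := h.exists_nonneg
  refine ⟨C, fun s hs => (hC s hs).trans ?_⟩
  gcongr

theorem DecaysOn.pow_mul {S : Set ℂ} {c₀ M : ℝ} {G : ℂ → ℂ} (h : DecaysOn S c₀ G)
    (hS : ∀ s ∈ S, |s.re| ≤ M) (i : ℕ) {c : ℝ} (hc : c < c₀) :
    DecaysOn S c (fun s => s ^ i * G s) := by
  induction i generalizing c with
  | zero => simpa using h.mono_rate hc.le
  | succ i ih =>
    refine ((ih (c := (c + c₀) / 2) (by linarith)).linear_mul (c' := c) (by linarith) hS 0).congr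
      fun s _ => ?_
    ring

/-- The integrals of `s ^ i * kernel k s * exp (s v)`. -/
noncomputable def momentInt (ε : ℝ) (k : Fin 4) (i : ℕ) (u : ℂ) : ℂ :=
  lineIntegral ε (fun s => s ^ i * kernel k s * Complex.exp (s * barnesArg k u))

theorem hasDerivAt_barnesArg (k : Fin 4) (u : ℂ) : HasDerivAt (barnesArg k) 1 u :=
  (hasDerivAt_id u).add_const _

theorem Phi_eq_momentInt (ε : ℝ) (k : Fin 4) (u : ℂ) :
    Phi ε k u = barnesPrefactor k * momentInt ε k 0 u := by
  rw [Phi_eq, momentInt]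
  simp

theorem abs_re_le_of_mem_vline {ε : ℝ} (s : ℂ) (hs : s ∈ vline ε) : |s.re| ≤ |ε| := by
  rw [show s.re = ε from hs]

theorem decaysOn_pow_mul_kernel {ε : ℝ} (h1 : -(1 / 5) < ε) (h2 : ε < 0) (k : Fin 4)
    (i : ℕ) {c : ℝ} (hc : c < ((k : ℕ) + 1) * Real.pi) :
    DecaysOn (vline ε) c (fun s => s ^ i * kernel k s) :=
  (decaysOn_kernel_vline (kernel_index_le k) (five_mul_ne_int h1 h2)).pow_mul
    abs_re_le_of_mem_vline i hc

theorem continuousOn_pow_mul_kernel {ε : ℝ} (h1 : -(1 / 5) < ε) (h2 : ε < 0) (k : Fin 4)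
    (i : ℕ) :
    ContinuousOn (fun s => s ^ i * kernel k s) (vline ε) :=
  ContinuousOn.mul (by fun_prop) (continuousOn_kernel (five_mul_ne_int h1 h2))

/-- Stated under the condition on `barnesArg` and not only on the strip, because for k ≠ 0 it is
needed at the conifold point, on the boundary of the strip. -/
theorem hasDerivAt_momentInt' {ε : ℝ} (h1 : -(1 / 5) < ε) (h2 : ε < 0) (k : Fin 4)
    (i : ℕ) {u : ℂ}
    (hu : |(barnesArg k u).im| < ((k : ℕ) + 1) * Real.pi) :
    HasDerivAt (momentInt ε k i) (momentInt ε k (i + 1) u) u := by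
  obtain ⟨c, hc1, hc2⟩ := exists_between hu
  have h := hasDerivAt_lineIntegral (continuousOn_pow_mul_kernel h1 h2 k i)
    (decaysOn_pow_mul_kernel h1 h2 k i hc2) hc1
  have h3 := HasDerivAt.comp u h (hasDerivAt_barnesArg k u)
  rw [mul_one] at h3
  refine h3.congr_deriv ?_
  rw [momentInt]
  refine lineIntegral_congr fun s _ => ?_
  ring

theorem hasDerivAt_momentInt {ε : ℝ} (h1 : -(1 / 5) < ε) (h2 : ε < 0) (k : Fin 4)
    (i : ℕ) {u : ℂ} (hu : u ∈ strip) :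
    HasDerivAt (momentInt ε k i) (momentInt ε k (i + 1) u) u :=
  hasDerivAt_momentInt' h1 h2 k i (abs_im_barnesArg_lt k hu)

theorem integrable_moment {ε : ℝ} (h1 : -(1 / 5) < ε) (h2 : ε < 0) (k : Fin 4)
    (i : ℕ) {u : ℂ} (hu : u ∈ strip) :
    MeasureTheory.Integrable (fun y : ℝ => (ε + y * Complex.I) ^ i *
      kernel k (ε + y * Complex.I) * Complex.exp ((ε + y * Complex.I) * barnesArg k u)) := by
  obtain ⟨c, hc1, hc2⟩ := exists_between (abs_im_barnesArg_lt k hu)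
  exact integrable_line (continuousOn_pow_mul_kernel h1 h2 k i)
    (decaysOn_pow_mul_kernel h1 h2 k i hc2) hc1

theorem sum_mul_momentInt {ε : ℝ} (h1 : -(1 / 5) < ε) (h2 : ε < 0) (k : Fin 4)
    (n : ℕ) (a : ℕ → ℂ) {u : ℂ} (hu : u ∈ strip) :
    ∑ i ∈ Finset.range n, a i * momentInt ε k i u =
      lineIntegral ε (fun s => (∑ i ∈ Finset.range n, a i * s ^ i) * kernel k s *
        Complex.exp (s * barnesArg k u)) := by
  simp only [momentInt, lineIntegral]
  have h3 : ∀ i ∈ Finset.range n, MeasureTheory.Integrable (fun y : ℝ => a i *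
      ((ε + y * Complex.I) ^ i * kernel k (ε + y * Complex.I) *
        Complex.exp ((ε + y * Complex.I) * barnesArg k u) * Complex.I)) :=
    fun i _ => ((integrable_moment h1 h2 k i hu).mul_const _).const_mul _
  have h4 : (fun y : ℝ => (∑ i ∈ Finset.range n, a i * ((ε : ℂ) + y * Complex.I) ^ i) *
      kernel k (ε + y * Complex.I) *
        Complex.exp ((ε + y * Complex.I) * barnesArg k u) * Complex.I) =
      fun y : ℝ => ∑ i ∈ Finset.range n, a i * ((ε + y * Complex.I) ^ i *
        kernel k (ε + y * Complex.I) *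
        Complex.exp ((ε + y * Complex.I) * barnesArg k u) * Complex.I) := by
    ext y
    rw [Finset.sum_mul, Finset.sum_mul, Finset.sum_mul]
    exact Finset.sum_congr rfl fun i _ => by ring
  rw [h4, MeasureTheory.integral_finsetSum _ h3, Finset.mul_sum]
  refine Finset.sum_congr rfl fun i _ => ?_
  rw [MeasureTheory.integral_const_mul]
  ring

/-! ### The kernel at `s = 0` -/

/-- The function `s ^ (k + 1) * kernel k s`, extended analytically to `s = 0`. -/
noncomputable def kernelReg (k : ℕ) (s : ℂ) : ℂ :=
  Complex.Gamma (5 * s + 1) * (-Complex.Gamma (1 - s)) ^ (k + 1) *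
    ((Complex.Gamma (s + 1))⁻¹) ^ (4 - k)

theorem kernel_eq_kernelReg_div (k : ℕ) {s : ℂ} (hs : s ≠ 0) :
    kernel k s = kernelReg k s / s ^ (k + 1) := by
  have h : Complex.Gamma (1 - s) = -s * Complex.Gamma (-s) := by
    rw [← Complex.Gamma_add_one _ (neg_ne_zero.2 hs)]
    ring_nf
  rw [kernel, kernelReg, h, show -(-s * Complex.Gamma (-s)) = s * Complex.Gamma (-s) by ring,
    mul_pow]
  field_simp

theorem differentiableAt_kernelReg (k : ℕ) {s : ℂ} (h1 : -(1 / 5) < s.re) (h2 : s.re < 1) :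
    DifferentiableAt ℂ (kernelReg k) s := by
  have hG : ∀ w : ℂ, 0 < w.re → DifferentiableAt ℂ Complex.Gamma w := fun w hw =>
    Complex.differentiableAt_Gamma w fun m hm => by
      have h3 := congrArg Complex.re hm
      simp at h3
      have h4 : (0 : ℝ) ≤ m := m.cast_nonneg
      linarith
  have a1 : DifferentiableAt ℂ (fun s : ℂ => Complex.Gamma (5 * s + 1)) s :=
    (hG (5 * s + 1) (by simp; linarith)).comp s (f := fun s : ℂ => 5 * s + 1) (by fun_prop)
  have a2 : DifferentiableAt ℂ (fun s : ℂ => Complex.Gamma (1 - s)) s :=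
    (hG (1 - s) (by simp; linarith)).comp s (f := fun s : ℂ => 1 - s) (by fun_prop)
  have a3 : DifferentiableAt ℂ (fun s : ℂ => (Complex.Gamma (s + 1))⁻¹) s :=
    (Complex.differentiable_one_div_Gamma (s + 1)).comp s (f := fun s : ℂ => s + 1) (by fun_prop)
  exact (a1.mul (a2.neg.pow _)).mul (a3.pow _)

theorem differentiableAt_kernel_of_ne_zero (k : ℕ) {s : ℂ} (h1 : -(1 / 5) < s.re) (h2 : s.re < 1)
    (hs : s ≠ 0) : DifferentiableAt ℂ (kernel k) s := by
  refine ((differentiableAt_kernelReg k h1 h2).div (by fun_prop : DifferentiableAt ℂ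
    (fun s : ℂ => s ^ (k + 1)) s) (pow_ne_zero _ hs)).congr_of_eventuallyEq ?_
  filter_upwards [isOpen_ne.mem_nhds hs] with w hw
  exact kernel_eq_kernelReg_div k hw

theorem abs_re_le_of_mem_tails {a b : ℝ} (s : ℂ) (hs : s ∈ tails a b) : |s.re| ≤ |a| + |b| := by
  rw [abs_le]
  have := neg_abs_le a
  have := le_abs_self b
  have := abs_nonneg a
  have := abs_nonneg b
  constructor <;> linarith [hs.1, hs.2.1]

/-- The pole at 0 has order k + 1 ≤ 4 and is the only one between the two lines, so s^4 removes it.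
-/
theorem lineIntegral_pow_four_mul_kernel {ε : ℝ} (h1 : -(1 / 5) < ε) (h2 : ε < 0) (k : Fin 4)
    {u : ℂ} (hu : u ∈ strip) :
    lineIntegral (ε + 1) (fun s => s ^ 4 * kernel k s * Complex.exp (s * barnesArg k u)) =
      lineIntegral ε (fun s => s ^ 4 * kernel k s * Complex.exp (s * barnesArg k u)) := by
  obtain ⟨c, hc1, hc2⟩ := exists_between (abs_im_barnesArg_lt k hu)
  have key := lineIntegral_sub_lineIntegral_zero (G := fun s => s ^ 4 * kernel k s) (a := ε)
    (b := ε + 1) (c := c) (n := 0) (A := fun _ => 0) (v := barnesArg k u) h2 (by linarith)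
    ?_ ?_ ?_ hc1
  · rw [Finset.sum_range_zero, neg_zero, sub_eq_zero] at key
    exact key.symm
  · intro s ha hb hs
    exact DifferentiableAt.mul (by fun_prop)
      (differentiableAt_kernel_of_ne_zero k (by linarith) (by linarith) hs)
  · have hcont : ContinuousAt (fun s : ℂ => s ^ (3 - (k : ℕ)) * kernelReg k s) 0 :=
      ContinuousAt.mul (by fun_prop)
        (differentiableAt_kernelReg k (by simp) (by simp)).continuousAt
    refine (IsBigO.congr' (hcont.isBigO_one ℂ |>.mono nhdsWithin_le_nhds) ?_ EventuallyEq.rfl)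
    filter_upwards [self_mem_nhdsWithin] with s hs
    have hs0 : s ≠ 0 := hs
    have h4 : s ^ 4 = s ^ (3 - (k : ℕ)) * s ^ ((k : ℕ) + 1) := by
      rw [← pow_add]
      congr 1
      omega
    rw [Finset.sum_range_zero, sub_zero, kernel_eq_kernelReg_div k hs0, h4]
    field_simp
  · exact (decaysOn_kernel (kernel_index_le k) _ _).pow_mul abs_re_le_of_mem_tails 4 hc2

theorem exp_barnesArg (k : Fin 4) (u : ℂ) :
    Complex.exp (barnesArg k u) = (-1) ^ ((k : ℕ) + 1) * Complex.exp u := by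
  fin_cases k <;> simp [barnesArg, Complex.exp_add] <;> norm_num

/-- The sign (-1)^(k+1) of the recursion cancels against e^v = (-1)^(k+1) z; this is why the even
Barnes integrals contain e^(πi) z. -/
theorem lineIntegral_shift_one {ε : ℝ} (h1 : -(1 / 5) < ε) (k : Fin 4) (u : ℂ)
    (g : ℂ → ℂ) :
    lineIntegral (ε + 1) (fun s => g s * kernel k s * Complex.exp (s * barnesArg k u)) =
      5 ^ 5 * Complex.exp u * lineIntegral ε (fun s => g (s + 1) * kernelRatio s * kernel k s *
        Complex.exp (s * barnesArg k u)) := by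
  have h0 := lineIntegral_add_left
    (fun s => g s * kernel k s * Complex.exp (s * barnesArg k u)) ε 1
  rw [h0, ← lineIntegral_const_mul]
  refine lineIntegral_congr fun s hs => ?_
  have hre : s.re = ε := hs
  rw [Complex.ofReal_one, kernel_add_one' (kernel_index_le k) (by linarith), add_mul,
    Complex.exp_add, one_mul, exp_barnesArg]
  have h : ((-1 : ℂ) ^ ((k : ℕ) + 1)) * (-1) ^ ((k : ℕ) + 1) = 1 := by rw [← mul_pow]; simp
  linear_combination (5 ^ 5 * g (s + 1) * kernelRatio s * kernel k s *
    Complex.exp (s * barnesArg k u) * Complex.exp u) * h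

/-- Differentiation multiplies the integrand by s. Moving the line of the integral with s^4 by one
unit turns s^4 into (s+1)^4, which cancels the denominator of `kernelRatio`. -/
theorem momentInt_picardFuchs {ε : ℝ} (h1 : -(1 / 5) < ε) (h2 : ε < 0) (k : Fin 4) {u : ℂ}
    (hu : u ∈ strip) :
    momentInt ε k 4 u = 5 ^ 5 * Complex.exp u * (momentInt ε k 4 u + 2 * momentInt ε k 3 u +
      7 / 5 * momentInt ε k 2 u + 2 / 5 * momentInt ε k 1 u + 24 / 625 * momentInt ε k 0 u) := by
  -- The coefficients of (s+1/5)(s+2/5)(s+3/5)(s+4/5).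
  have h3 := sum_mul_momentInt h1 h2 k 5 (fun i => if i = 0 then 24 / 625 else if i = 1 then 2 / 5
    else if i = 2 then 7 / 5 else if i = 3 then 2 else 1) hu
  simp only [Finset.sum_range_succ, Finset.sum_range_zero] at h3
  norm_num at h3
  have h4 : momentInt ε k 4 u + 2 * momentInt ε k 3 u + 7 / 5 * momentInt ε k 2 u +
      2 / 5 * momentInt ε k 1 u + 24 / 625 * momentInt ε k 0 u = lineIntegral ε (fun s =>
        (s + 1) ^ 4 * kernelRatio s * kernel k s * Complex.exp (s * barnesArg k u)) := by
    rw [show momentInt ε k 4 u + 2 * momentInt ε k 3 u + 7 / 5 * momentInt ε k 2 u +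
      2 / 5 * momentInt ε k 1 u + 24 / 625 * momentInt ε k 0 u = 24 / 625 * momentInt ε k 0 u +
      2 / 5 * momentInt ε k 1 u + 7 / 5 * momentInt ε k 2 u + 2 * momentInt ε k 3 u +
      momentInt ε k 4 u by ring, h3]
    refine lineIntegral_congr fun s hs => ?_
    have hs1 : s + 1 ≠ 0 := by
      intro h
      have h5 := congrArg Complex.re h
      have hre : s.re = ε := hs
      simp [hre] at h5
      linarith
    rw [kernelRatio]
    field_simp
    ring
  rw [h4, ← lineIntegral_shift_one h1 k u (fun s => s ^ 4),
    lineIntegral_pow_four_mul_kernel h1 h2 k hu]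
  rfl

/-! ### Periods -/

theorem isOpen_strip : IsOpen strip :=
  (isOpen_lt continuous_const Complex.continuous_im).inter
    (isOpen_lt Complex.continuous_im continuous_const)

theorem convex_strip : Convex ℝ strip :=
  (convex_halfSpace_im_gt _).inter (convex_halfSpace_im_lt _)

theorem thetaAdd_eq {F G : ℂ → ℂ} {G' c : ℂ} {u : ℂ} (hu : u ∈ strip)
    (hFG : ∀ u ∈ strip, F u = G u) (hG : HasDerivAt G G' u) :
    thetaAdd c F u = G' + c * G u := by
  have h : F =ᶠ[𝓝 u] G := by
    filter_upwards [isOpen_strip.mem_nhds hu] with w hw using hFG w hw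
  rw [thetaAdd, h.deriv_eq, hG.deriv, hFG u hu]

/-- The left-hand side of the Picard-Fuchs equation for a function with successive derivatives
`E 0, E 1, …`. -/
theorem picardFuchs_eq {E : ℕ → ℂ → ℂ} (hE : ∀ i, ∀ u ∈ strip, HasDerivAt (E i) (E (i + 1) u) u)
    {u : ℂ} (hu : u ∈ strip) :
    thetaAdd 0 (thetaAdd 0 (thetaAdd 0 (thetaAdd 0 (E 0)))) u -
        5 ^ 5 * Complex.exp u *
          thetaAdd (1 / 5) (thetaAdd (2 / 5) (thetaAdd (3 / 5) (thetaAdd (4 / 5) (E 0)))) u =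
      E 4 u - 5 ^ 5 * Complex.exp u *
        (E 4 u + 2 * E 3 u + 7 / 5 * E 2 u + 2 / 5 * E 1 u + 24 / 625 * E 0 u) := by
  have a1 : ∀ u ∈ strip, thetaAdd 0 (E 0) u = E 1 u := fun u hu => by
    rw [thetaAdd_eq hu (fun _ _ => rfl) (hE 0 u hu)]
    ring
  have a2 : ∀ u ∈ strip, thetaAdd 0 (thetaAdd 0 (E 0)) u = E 2 u := fun u hu => by
    rw [thetaAdd_eq hu a1 (hE 1 u hu)]
    ring
  have a3 : ∀ u ∈ strip, thetaAdd 0 (thetaAdd 0 (thetaAdd 0 (E 0))) u = E 3 u := fun u hu => by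
    rw [thetaAdd_eq hu a2 (hE 2 u hu)]
    ring
  have b1 : ∀ u ∈ strip, thetaAdd (4 / 5) (E 0) u = E 1 u + 4 / 5 * E 0 u := fun u hu =>
    thetaAdd_eq hu (fun _ _ => rfl) (hE 0 u hu)
  have b2 : ∀ u ∈ strip, thetaAdd (3 / 5) (thetaAdd (4 / 5) (E 0)) u =
      E 2 u + 7 / 5 * E 1 u + 12 / 25 * E 0 u := fun u hu => by
    rw [thetaAdd_eq hu b1 ((hE 1 u hu).fun_add ((hE 0 u hu).const_mul _))]
    ring
  have b3 : ∀ u ∈ strip, thetaAdd (2 / 5) (thetaAdd (3 / 5) (thetaAdd (4 / 5) (E 0))) u =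
      E 3 u + 9 / 5 * E 2 u + 26 / 25 * E 1 u + 24 / 125 * E 0 u := fun u hu => by
    rw [thetaAdd_eq hu b2 (((hE 2 u hu).fun_add ((hE 1 u hu).const_mul _)).fun_add
      ((hE 0 u hu).const_mul _))]
    ring
  rw [thetaAdd_eq hu a3 (hE 3 u hu), thetaAdd_eq hu b3 ((((hE 3 u hu).fun_add
    ((hE 2 u hu).const_mul _)).fun_add ((hE 1 u hu).const_mul _)).fun_add
      ((hE 0 u hu).const_mul _))]
  ring

theorem isPeriod_Phi {ε : ℝ} (h1 : -(1 / 5) < ε) (h2 : ε < 0) (k : Fin 4) :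
    IsPeriod (Phi ε k) := by
  have hE : ∀ i, ∀ u ∈ strip, HasDerivAt (fun u => barnesPrefactor k * momentInt ε k i u)
      (barnesPrefactor k * momentInt ε k (i + 1) u) u :=
    fun i u hu => (hasDerivAt_momentInt h1 h2 k i hu).const_mul _
  have hPhi : Phi ε k = fun u => barnesPrefactor k * momentInt ε k 0 u :=
    funext fun u => Phi_eq_momentInt ε k u
  refine ⟨fun u hu => ?_, fun u hu => ?_⟩
  · rw [hPhi]
    exact (hE 0 u hu).differentiableAt.differentiableWithinAt
  · rw [hPhi]
    refine (picardFuchs_eq (E := fun i u => barnesPrefactor k * momentInt ε k i u) hE hu).trans ?_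
    linear_combination barnesPrefactor k * momentInt_picardFuchs h1 h2 k hu

theorem hasDerivAt_iterate_deriv {F : ℂ → ℂ} (hF : DifferentiableOn ℂ F strip) (i : ℕ) :
    DifferentiableOn ℂ (deriv^[i] F) strip ∧
      ∀ u ∈ strip, HasDerivAt (deriv^[i] F) (deriv^[i + 1] F u) u := by
  have h : ∀ i, DifferentiableOn ℂ (deriv^[i] F) strip := by
    intro i
    induction i with
    | zero => exact hF
    | succ i ih =>
      rw [Function.iterate_succ_apply']
      exact ih.deriv isOpen_strip
  refine ⟨h i, fun u hu => ?_⟩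
  rw [Function.iterate_succ_apply']
  exact ((h i).differentiableAt (isOpen_strip.mem_nhds hu)).hasDerivAt

theorem isPeriod_iff {F : ℂ → ℂ} : IsPeriod F ↔ DifferentiableOn ℂ F strip ∧ ∀ u ∈ strip,
    deriv^[4] F u - 5 ^ 5 * Complex.exp u * (deriv^[4] F u + 2 * deriv^[3] F u +
      7 / 5 * deriv^[2] F u + 2 / 5 * deriv^[1] F u + 24 / 625 * F u) = 0 := by
  refine and_congr_right fun hF => forall₂_congr fun u hu => ?_
  exact Eq.congr_left (picardFuchs_eq (E := fun i => deriv^[i] F)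
    (fun i => (hasDerivAt_iterate_deriv hF i).2) hu)

theorem iterate_deriv_congr {F G : ℂ → ℂ} (h : ∀ u ∈ strip, F u = G u) (i : ℕ) :
    ∀ u ∈ strip, deriv^[i] F u = deriv^[i] G u := by
  induction i with
  | zero => exact h
  | succ i ih =>
    intro u hu
    rw [Function.iterate_succ_apply', Function.iterate_succ_apply']
    refine EventuallyEq.deriv_eq ?_
    filter_upwards [isOpen_strip.mem_nhds hu] with w hw using ih w hw

theorem IsPeriod.congr {F G : ℂ → ℂ} (hF : IsPeriod F) (h : ∀ u ∈ strip, G u = F u) :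
    IsPeriod G := by
  rw [isPeriod_iff] at hF ⊢
  refine ⟨hF.1.congr h, fun u hu => ?_⟩
  rw [iterate_deriv_congr h 4 u hu, iterate_deriv_congr h 3 u hu, iterate_deriv_congr h 2 u hu,
    iterate_deriv_congr h 1 u hu, h u hu]
  exact hF.2 u hu

theorem iterate_deriv_sum {ι : Type*} (s : Finset ι) (b : ι → ℂ) {F : ι → ℂ → ℂ}
    (hF : ∀ k ∈ s, DifferentiableOn ℂ (F k) strip) (i : ℕ) :
    ∀ u ∈ strip, deriv^[i] (fun u => ∑ k ∈ s, b k * F k u) u =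
      ∑ k ∈ s, b k * deriv^[i] (F k) u := by
  induction i with
  | zero => exact fun u _ => rfl
  | succ i ih =>
    intro u hu
    rw [Function.iterate_succ_apply']
    have h1 : HasDerivAt (fun u => ∑ k ∈ s, b k * deriv^[i] (F k) u)
        (∑ k ∈ s, b k * deriv^[i + 1] (F k) u) u :=
      HasDerivAt.fun_sum fun k hk => ((hasDerivAt_iterate_deriv (hF k hk) i).2 u hu).const_mul _
    rw [← h1.deriv]
    refine EventuallyEq.deriv_eq ?_
    filter_upwards [isOpen_strip.mem_nhds hu] with w hw using ih w hw

theorem IsPeriod.sum {ι : Type*} (s : Finset ι) (b : ι → ℂ) {F : ι → ℂ → ℂ}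
    (hF : ∀ k ∈ s, IsPeriod (F k)) : IsPeriod (fun u => ∑ k ∈ s, b k * F k u) := by
  have hd : ∀ k ∈ s, DifferentiableOn ℂ (F k) strip := fun k hk => (hF k hk).1
  rw [isPeriod_iff]
  refine ⟨DifferentiableOn.fun_sum fun k hk => (hd k hk).const_mul _, fun u hu => ?_⟩
  rw [iterate_deriv_sum s b hd 4 u hu, iterate_deriv_sum s b hd 3 u hu,
    iterate_deriv_sum s b hd 2 u hu, iterate_deriv_sum s b hd 1 u hu]
  simp only [Finset.mul_sum, ← Finset.sum_add_distrib, ← Finset.sum_sub_distrib]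
  refine Finset.sum_eq_zero fun k hk => ?_
  linear_combination b k * (isPeriod_iff.1 (hF k hk)).2 u hu

theorem IsPeriod.comb {ι : Type*} [Fintype ι] (b : ι → ℂ) {F : ι → ℂ → ℂ} {G : ℂ → ℂ}
    (hF : ∀ k, IsPeriod (F k)) (hG : ∀ u ∈ strip, G u = ∑ k, b k * F k u) : IsPeriod G :=
  (IsPeriod.sum Finset.univ b fun k _ => hF k).congr hG

/-! ### Uniqueness on the strip and the dimension of the space of periods -/

/-- Holomorphic functions on the strip which agree for `|z| > 5 ^ (-5)` are equal. -/
theorem eqOn_strip {F G : ℂ → ℂ} (hF : DifferentiableOn ℂ F strip)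
    (hG : DifferentiableOn ℂ G strip) (h : ∀ u ∈ strip, logConifold < u.re → F u = G u) :
    ∀ u ∈ strip, F u = G u := by
  set z : ℂ := ((logConifold + 1 : ℝ) : ℂ) + ((-Real.pi : ℝ) : ℂ) * Complex.I with hz
  have hz1 : z ∈ strip := by
    have := Real.pi_pos
    constructor <;> simp [hz] <;> linarith
  refine (hF.analyticOnNhd isOpen_strip).eqOn_of_preconnected_of_eventuallyEq
    (hG.analyticOnNhd isOpen_strip) convex_strip.isPreconnected hz1 ?_
  have h2 : {u : ℂ | logConifold < u.re} ∈ 𝓝 z :=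
    (isOpen_lt continuous_const Complex.continuous_re).mem_nhds (by simp [hz])
  filter_upwards [isOpen_strip.mem_nhds hz1, h2] with w hw1 hw2 using h w hw1 hw2

/-- The conifold point lifts to points with Im u in 2πℤ, none of which lies in the open strip; so
the equation has no singular point there. -/
theorem one_sub_exp_ne_zero {u : ℂ} (hu : u ∈ strip) : 1 - 5 ^ 5 * Complex.exp u ≠ 0 := by
  intro h
  have h1 : Complex.exp u = Complex.exp (logConifold : ℂ) := by
    rw [← Complex.ofReal_exp, exp_logConifold]
    push_cast
    norm_num
    linear_combination -h / 3125
  obtain ⟨n, hn⟩ := Complex.exp_eq_exp_iff_exists_int.1 h1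
  have h2 := congrArg Complex.im hn
  simp at h2
  have hpi := Real.pi_pos
  have h3 := hu.1
  have h4 := hu.2
  rw [h2] at h3 h4
  have h5 : (-1 : ℝ) < n := by nlinarith
  have h6 : (n : ℝ) < 0 := by nlinarith
  have h5' : -1 < n := by exact_mod_cast h5
  have h6' : n < 0 := by exact_mod_cast h6
  omega

/-- A period is determined by its first four derivatives at a point. -/
theorem IsPeriod.eq_zero {F : ℂ → ℂ} (hF : IsPeriod F) {p : ℂ} (hp : p ∈ strip)
    (h : ∀ i < 4, deriv^[i] F p = 0) : ∀ u ∈ strip, F u = 0 := by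
  obtain ⟨hd, hode⟩ := isPeriod_iff.1 hF
  have han : ∀ i, AnalyticAt ℂ (deriv^[i] F) p := fun i =>
    (hasDerivAt_iterate_deriv hd i).1.analyticAt (isOpen_strip.mem_nhds hp)
  have hord : ∀ i < 4, analyticOrderAt (deriv^[i] F) p =
      analyticOrderAt (deriv^[i + 1] F) p + 1 := by
    intro i hi
    have h1 := (han i).analyticOrderAt_deriv_add_one
    rw [h i hi] at h1
    rw [Function.iterate_succ_apply', h1]
    simp
  -- The first four derivatives vanish at p, so each of them has order at least n + 1. The equation
  -- expresses the fourth derivative through them with analytic coefficients, whence n ≥ n + 1 and n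
  -- = ∞.
  set n := analyticOrderAt (deriv^[4] F) p with hn
  have h3 : n + 1 ≤ analyticOrderAt (deriv^[3] F) p := (hord 3 (by norm_num)).ge
  have h2 : n + 1 ≤ analyticOrderAt (deriv^[2] F) p := by
    rw [hord 2 (by norm_num)]
    exact h3.trans le_self_add
  have h1 : n + 1 ≤ analyticOrderAt (deriv^[1] F) p := by
    rw [hord 1 (by norm_num)]
    exact h2.trans le_self_add
  have h0 : n + 1 ≤ analyticOrderAt (deriv^[0] F) p := by
    rw [hord 0 (by norm_num)]
    exact h1.trans le_self_add
  have hA : AnalyticAt ℂ (fun u : ℂ => 5 ^ 5 * Complex.exp u / (1 - 5 ^ 5 * Complex.exp u)) p := by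
    refine AnalyticAt.fun_div (by fun_prop) (by fun_prop) (one_sub_exp_ne_zero hp)
  have hmul : ∀ (c : ℂ) (g : ℂ → ℂ), AnalyticAt ℂ g p → n + 1 ≤ analyticOrderAt g p →
      n + 1 ≤ analyticOrderAt (fun u => c * g u) p := by
    intro c g hg hg1
    have := analyticOrderAt_mul (analyticAt_const (v := c) (x := p)) hg
    have h5 : analyticOrderAt ((fun _ => c) * g) p = analyticOrderAt (fun u => c * g u) p := rfl
    rw [← h5, this]
    exact hg1.trans le_add_self
  have hsum : n + 1 ≤ analyticOrderAt ((fun u => 2 * deriv^[3] F u) +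
      (fun u => 7 / 5 * deriv^[2] F u) + (fun u => 2 / 5 * deriv^[1] F u) +
      (fun u => 24 / 625 * deriv^[0] F u)) p := by
    refine le_trans (le_min (le_trans (le_min (le_trans (le_min ?_ ?_) le_analyticOrderAt_add) ?_)
      le_analyticOrderAt_add) ?_) le_analyticOrderAt_add
    · exact hmul _ _ (han 3) h3
    · exact hmul _ _ (han 2) h2
    · exact hmul _ _ (han 1) h1
    · exact hmul _ _ (han 0) h0
  have heq : deriv^[4] F =ᶠ[𝓝 p] (fun u : ℂ => 5 ^ 5 * Complex.exp u / (1 - 5 ^ 5 * Complex.exp u)) *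
      ((fun u => 2 * deriv^[3] F u) +
      (fun u => 7 / 5 * deriv^[2] F u) + (fun u => 2 / 5 * deriv^[1] F u) +
      (fun u => 24 / 625 * deriv^[0] F u)) := by
    filter_upwards [isOpen_strip.mem_nhds hp] with u hu
    have hne := one_sub_exp_ne_zero hu
    have := hode u hu
    simp only [Pi.mul_apply, Pi.add_apply, Function.iterate_zero, id_eq]
    rw [div_mul_eq_mul_div, eq_div_iff hne]
    linear_combination this
  have hsan : AnalyticAt ℂ ((fun u => 2 * deriv^[3] F u) +
      (fun u => 7 / 5 * deriv^[2] F u) + (fun u => 2 / 5 * deriv^[1] F u) +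
      (fun u => 24 / 625 * deriv^[0] F u)) p :=
    (((analyticAt_const.fun_mul (han 3)).add (analyticAt_const.fun_mul (han 2))).add
      (analyticAt_const.fun_mul (han 1))).add (analyticAt_const.fun_mul (han 0))
  have hfin : n + 1 ≤ n := by
    conv_rhs => rw [hn, analyticOrderAt_congr heq, analyticOrderAt_mul hA hsan]
    exact hsum.trans le_add_self
  have htop : n = ⊤ := by
    by_contra hne
    obtain ⟨m, hm⟩ := ENat.ne_top_iff_exists.1 hne
    rw [← hm] at hfin
    have : m + 1 ≤ m := by exact_mod_cast hfin
    omega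
  have hF0 : analyticOrderAt F p = ⊤ := by
    rw [htop] at h0
    simpa using h0
  have hev := analyticOrderAt_eq_top.1 hF0
  exact (hd.analyticOnNhd isOpen_strip).eqOn_zero_of_preconnected_of_eventuallyEq_zero
    convex_strip.isPreconnected hp hev

/-- Linearly independent periods `F 0, …, F 3` form a basis of the periods. -/
theorem IsPeriod.existsUnique_comb {F : Fin 4 → ℂ → ℂ} (hF : ∀ k, IsPeriod (F k))
    (hind : ∀ b : Fin 4 → ℂ, (∀ u ∈ strip, ∑ k, b k * F k u = 0) → b = 0) {G : ℂ → ℂ}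
    (hG : IsPeriod G) : ∃! b : Fin 4 → ℂ, ∀ u ∈ strip, G u = ∑ k, b k * F k u := by
  set p : ℂ := ((-Real.pi : ℝ) : ℂ) * Complex.I with hpdef
  have hp : p ∈ strip := by
    have := Real.pi_pos
    constructor <;> simp [hpdef] <;> linarith
  -- The Wronskian matrix at p: uniqueness of solutions makes it injective, hence surjective, so any
  -- initial data are matched by a combination of the F k.
  set J : (Fin 4 → ℂ) →ₗ[ℂ] (Fin 4 → ℂ) :=
    Matrix.toLin' (Matrix.of fun (i : Fin 4) (k : Fin 4) => deriv^[(i : ℕ)] (F k) p) with hJ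
  have hJapp : ∀ b i, J b i = ∑ k, b k * deriv^[(i : ℕ)] (F k) p := by
    intro b i
    rw [hJ, Matrix.toLin'_apply, Matrix.mulVec, dotProduct]
    exact Finset.sum_congr rfl fun k _ => mul_comm _ _
  have hd : ∀ k ∈ Finset.univ, DifferentiableOn ℂ (F k) strip := fun k _ => (hF k).1
  have hinj : Function.Injective J := by
    rw [← LinearMap.ker_eq_bot, LinearMap.ker_eq_bot']
    intro b hb
    refine hind b (IsPeriod.eq_zero (IsPeriod.sum Finset.univ b fun k _ => hF k) hp ?_)
    intro i hi
    rw [iterate_deriv_sum Finset.univ b hd i p hp]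
    have := congrFun hb ⟨i, hi⟩
    rw [hJapp] at this
    exact this
  obtain ⟨b, hb⟩ := LinearMap.injective_iff_surjective.1 hinj
    fun i : Fin 4 => deriv^[(i : ℕ)] G p
  have hGb : ∀ u ∈ strip, G u = ∑ k, b k * F k u := by
    -- The difference of G and the combination, written as one sum over `Option (Fin 4)` so that
    -- linearity of the equation applies directly.
    have hper : IsPeriod (fun u => ∑ k : Option (Fin 4), (k.elim (1 : ℂ) fun k => -b k) *
        (k.elim G F) u) := by
      refine IsPeriod.sum Finset.univ _ fun k _ => ?_
      cases k with
      | none => exact hG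
      | some k => exact hF k
    have hdo : ∀ k ∈ (Finset.univ : Finset (Option (Fin 4))),
        DifferentiableOn ℂ (k.elim G F) strip := by
      intro k _
      cases k with
      | none => exact hG.1
      | some k => exact (hF k).1
    have h0 := hper.eq_zero hp fun i hi => by
      rw [iterate_deriv_sum Finset.univ _ hdo i p hp, Fintype.sum_option]
      have := congrFun hb ⟨i, hi⟩
      rw [hJapp] at this
      simp only [Option.elim, neg_mul, Finset.sum_neg_distrib, one_mul]
      rw [this]
      ring
    intro u hu
    have h1 := h0 u hu
    rw [Fintype.sum_option] at h1
    simp only [Option.elim, neg_mul, Finset.sum_neg_distrib, one_mul] at h1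
    linear_combination h1
  refine ⟨b, hGb, fun b' hb' => ?_⟩
  have h0 := hind (b' - b) fun u hu => by
    simp only [Pi.sub_apply, sub_mul, Finset.sum_sub_distrib]
    rw [← hGb u hu, ← hb' u hu, sub_self]
  exact sub_eq_zero.1 h0

/-! ### The quotient of Gamma functions at `s = 0` -/

/-- Euler's limit formula for numerator and denominator; the powers of n cancel up to n^(-4), and
with (n+1)^4 from the factorials this leaves the correction (n/(n+1))^4. -/
theorem tendsto_prod_gammaRatio {s : ℂ} (hs : ‖s‖ ≤ 1 / 10) :
    Tendsto (fun n : ℕ => ∏ j ∈ Finset.range (n + 1),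
      ((1 + s / (j + 1)) ^ 5 / (1 + 5 * s / (j + 1)))) atTop
      (𝓝 (Complex.Gamma (5 * s + 1) / Complex.Gamma (s + 1) ^ 5)) := by
  have hre := (abs_le.1 ((Complex.abs_re_le_norm s).trans hs)).1
  have hG : Complex.Gamma (s + 1) ≠ 0 :=
    Complex.Gamma_ne_zero_of_re_pos (by simp; linarith)
  have h1 : Tendsto (fun n : ℕ => (((n : ℂ) / (n + 1)) ^ 4) *
      (Complex.GammaSeq (5 * s + 1) n / Complex.GammaSeq (s + 1) n ^ 5)) atTop
      (𝓝 (1 ^ 4 * (Complex.Gamma (5 * s + 1) / Complex.Gamma (s + 1) ^ 5))) :=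
    ((tendsto_natCast_div_add_atTop (1 : ℂ)).pow 4).mul
      ((Complex.GammaSeq_tendsto_Gamma _).div ((Complex.GammaSeq_tendsto_Gamma _).pow 5)
        (pow_ne_zero _ hG))
  rw [one_pow, one_mul] at h1
  refine h1.congr' ?_
  filter_upwards [eventually_ge_atTop 1] with n hn
  have hn0 : (n : ℂ) ≠ 0 := by exact_mod_cast (by omega : n ≠ 0)
  have hj : ∀ j : ℕ, ((j : ℂ) + 1) ≠ 0 := fun j => by exact_mod_cast j.succ_ne_zero
  have hf : ∀ w : ℂ, ∏ j ∈ Finset.range (n + 1), (w + 1 + j) =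
      ((n : ℂ) + 1) * (n.factorial : ℂ) * ∏ j ∈ Finset.range (n + 1), (1 + w / (j + 1)) := by
    intro w
    have h2 : ((n : ℂ) + 1) * (n.factorial : ℂ) = ∏ j ∈ Finset.range (n + 1), ((j : ℂ) + 1) := by
      have := Finset.prod_range_add_one_eq_factorial (n + 1)
      rw [Nat.factorial_succ] at this
      exact_mod_cast this.symm
    rw [h2, ← Finset.prod_mul_distrib]
    refine Finset.prod_congr rfl fun j _ => ?_
    have := hj j
    field_simp
    ring
  have hpow : (n : ℂ) ^ (5 * s + 1) * (n : ℂ) ^ 4 = ((n : ℂ) ^ (s + 1)) ^ 5 := by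
    rw [← Complex.cpow_nat_mul, ← Complex.cpow_natCast, ← Complex.cpow_add _ _ hn0]
    congr 1
    push_cast
    ring
  have hz : ∀ w : ℂ, (n : ℂ) ^ w ≠ 0 := fun w => by simp [Complex.cpow_eq_zero_iff, hn0]
  rw [Complex.GammaSeq, Complex.GammaSeq, hf, hf, Finset.prod_div_distrib, Finset.prod_pow]
  have hfac : (n.factorial : ℂ) ≠ 0 := by exact_mod_cast n.factorial_ne_zero
  have hnn := hj n
  have a1 := hz (s + 1)
  have e1 : (n : ℂ) ^ (5 * s + 1) = ((n : ℂ) ^ (s + 1)) ^ 5 / (n : ℂ) ^ 4 := by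
    rw [← hpow]
    field_simp
  rw [e1]
  generalize (n : ℂ) ^ (s + 1) = a at *
  generalize (∏ j ∈ Finset.range (n + 1), (1 + s / ((j : ℂ) + 1))) = p at *
  generalize (∏ j ∈ Finset.range (n + 1), (1 + 5 * s / ((j : ℂ) + 1))) = q at *
  generalize (n.factorial : ℂ) = f at *
  field_simp

theorem tendsto_sum_zeta {k : ℕ} (hk : 1 < k) :
    Tendsto (fun n : ℕ => ∑ j ∈ Finset.range (n + 1), 1 / ((j : ℂ) + 1) ^ k) atTop
      (𝓝 (riemannZeta k)) := by
  have h1 : Summable fun n : ℕ => 1 / (n : ℂ) ^ k := by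
    have := (Real.summable_one_div_nat_pow.2 hk)
    have h2 := Complex.ofRealCLM.summable this
    simpa using h2
  have h2 := h1.hasSum
  rw [← zeta_nat_eq_tsum_of_gt_one hk, ← hasSum_nat_add_iff' 1] at h2
  have h3 := h2.tendsto_sum_nat.comp (tendsto_add_atTop_nat 1)
  have hk0 : k ≠ 0 := by omega
  simpa [Function.comp_def, hk0] using h3

/-- The linear terms cancel, so no Euler constant appears in the expansion. The coefficients are 10
= (25 - 5)/2 and -40 = (5 - 125)/3. -/
theorem norm_log_ratio_le {x : ℂ} (hx : ‖x‖ ≤ 1 / 10) :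
    ‖5 * Complex.log (1 + x) - Complex.log (1 + 5 * x) - (10 * x ^ 2 - 40 * x ^ 3)‖ ≤
      400 * ‖x‖ ^ 4 := by
  have h5 : ‖5 * x‖ = 5 * ‖x‖ := by simp
  have h1 := Complex.norm_log_sub_logTaylor_le 3 (z := x) (by linarith)
  have h2 := Complex.norm_log_sub_logTaylor_le 3 (z := 5 * x) (by rw [h5]; linarith)
  have hT : ∀ z : ℂ, Complex.logTaylor (3 + 1) z = z - z ^ 2 / 2 + z ^ 3 / 3 := by
    intro z
    simp [Complex.logTaylor, Finset.sum_range_succ]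
    ring
  rw [hT] at h1 h2
  have hx0 := norm_nonneg x
  have b1 : (1 - ‖x‖)⁻¹ ≤ 2 := by
    rw [inv_le_comm₀ (by linarith) (by norm_num)]
    linarith
  have b2 : (1 - ‖5 * x‖)⁻¹ ≤ 2 := by
    rw [h5, inv_le_comm₀ (by linarith) (by norm_num)]
    linarith
  have c1 : ‖Complex.log (1 + x) - (x - x ^ 2 / 2 + x ^ 3 / 3)‖ ≤ ‖x‖ ^ 4 / 2 := by
    refine h1.trans ?_
    have := mul_le_mul_of_nonneg_left b1 (pow_nonneg hx0 4)
    norm_num at this ⊢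
    linarith
  have c2 : ‖Complex.log (1 + 5 * x) - (5 * x - (5 * x) ^ 2 / 2 + (5 * x) ^ 3 / 3)‖ ≤
      625 * ‖x‖ ^ 4 / 2 := by
    refine h2.trans ?_
    have := mul_le_mul_of_nonneg_left b2 (pow_nonneg (norm_nonneg (5 * x)) 4)
    rw [h5] at this ⊢
    norm_num [mul_pow] at this ⊢
    linarith
  rw [show 5 * Complex.log (1 + x) - Complex.log (1 + 5 * x) - (10 * x ^ 2 - 40 * x ^ 3) =
    5 * (Complex.log (1 + x) - (x - x ^ 2 / 2 + x ^ 3 / 3)) -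
    (Complex.log (1 + 5 * x) - (5 * x - (5 * x) ^ 2 / 2 + (5 * x) ^ 3 / 3)) by ring]
  refine (norm_sub_le _ _).trans ?_
  rw [norm_mul, Complex.norm_ofNat]
  have := pow_nonneg hx0 4
  linarith

/-- The expansion of `Γ(5 s + 1) / Γ(s + 1) ^ 5` at `s = 0`. -/
theorem gammaRatio_isBigO : (fun s : ℂ => Complex.Gamma (5 * s + 1) / Complex.Gamma (s + 1) ^ 5 -
    (1 + 10 * riemannZeta 2 * s ^ 2 - 40 * riemannZeta 3 * s ^ 3)) =O[𝓝 0] fun s => s ^ 4 := by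
  obtain ⟨M, hM⟩ : ∃ M : ℝ, ∀ n : ℕ, ∑ j ∈ Finset.range n, 1 / ((j : ℝ) + 1) ^ 2 ≤ M := by
    refine ⟨∑' j : ℕ, 1 / ((j : ℝ) + 1) ^ 2, fun n => ?_⟩
    exact (summable_const_div_sq 1).sum_le_tsum _ fun j _ => by positivity
  have hM0 : 0 ≤ M := by simpa using hM 0
  refine IsBigO.of_bound (400 * M + (54 * M) ^ 2) ?_
  -- Small enough for the logarithm estimate at every x = s/(j+1) and for the logarithm E n of the
  -- partial product to have norm at most 1, as the quadratic estimate of exp requires.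
  set δ : ℝ := min (1 / 10) (1 / (54 * M + 1)) with hδ
  have hδ0 : 0 < δ := by positivity
  filter_upwards [Metric.closedBall_mem_nhds (0 : ℂ) hδ0] with s hs
  rw [mem_closedBall_zero_iff] at hs
  have hs1 : ‖s‖ ≤ 1 / 10 := hs.trans (min_le_left _ _)
  have hs2 : 54 * M * ‖s‖ ≤ 1 := by
    have h3 : ‖s‖ ≤ 1 / (54 * M + 1) := hs.trans (min_le_right _ _)
    rw [le_div_iff₀ (by positivity)] at h3
    nlinarith [norm_nonneg s]
  set E : ℕ → ℂ := fun n => ∑ j ∈ Finset.range (n + 1),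
    (5 * Complex.log (1 + s / (j + 1)) - Complex.log (1 + 5 * (s / (j + 1)))) with hE
  set H : ℕ → ℕ → ℂ := fun k n => ∑ j ∈ Finset.range (n + 1), 1 / ((j : ℂ) + 1) ^ k with hH
  have hj1 : ∀ j : ℕ, ‖(j : ℂ) + 1‖ = (j : ℝ) + 1 := fun j => by
    rw [show (j : ℂ) + 1 = ((j + 1 : ℕ) : ℂ) by push_cast; rfl, Complex.norm_natCast]
    push_cast
    rfl
  have hx : ∀ j : ℕ, ‖s / ((j : ℂ) + 1)‖ ≤ ‖s‖ := by
    intro j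
    rw [norm_div, hj1]
    exact div_le_self (norm_nonneg s) (by linarith [(j.cast_nonneg : (0 : ℝ) ≤ j)])
  have hx2 : ∀ j : ℕ, ‖s / ((j : ℂ) + 1)‖ ^ 2 = ‖s‖ ^ 2 * (1 / ((j : ℝ) + 1) ^ 2) := by
    intro j
    rw [norm_div, hj1]
    field_simp
  have hfac : ∀ n, Complex.exp (E n) = ∏ j ∈ Finset.range (n + 1),
      ((1 + s / ((j : ℂ) + 1)) ^ 5 / (1 + 5 * s / ((j : ℂ) + 1))) := by
    intro n
    rw [hE, Complex.exp_sum]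
    refine Finset.prod_congr rfl fun j _ => ?_
    have hne : ∀ w : ℂ, ‖w‖ < 1 → 1 + w ≠ 0 := by
      intro w hw h
      rw [← eq_neg_iff_add_eq_zero] at h
      rw [← norm_neg, ← h] at hw
      simp at hw
    have e1 := Complex.exp_log (hne (s / (j + 1)) (by linarith [hx j]))
    have e2 := Complex.exp_log (hne (5 * (s / (j + 1))) (by
      rw [norm_mul, Complex.norm_ofNat]
      linarith [hx j]))
    rw [Complex.exp_sub, e2, mul_div_assoc]
    congr 1
    rw [show (5 : ℂ) * Complex.log (1 + s / (j + 1)) =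
      (5 : ℕ) * Complex.log (1 + s / (j + 1)) by push_cast; rfl, Complex.exp_nat_mul, e1]
  have hb : ∀ n, ‖E n - (10 * H 2 n * s ^ 2 - 40 * H 3 n * s ^ 3)‖ ≤ 400 * M * ‖s‖ ^ 4 := by
    intro n
    have h4 : E n - (10 * H 2 n * s ^ 2 - 40 * H 3 n * s ^ 3) = ∑ j ∈ Finset.range (n + 1),
        (5 * Complex.log (1 + s / (j + 1)) - Complex.log (1 + 5 * (s / (j + 1))) -
          (10 * (s / ((j : ℂ) + 1)) ^ 2 - 40 * (s / ((j : ℂ) + 1)) ^ 3)) := by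
      have e2 : 10 * H 2 n * s ^ 2 = ∑ j ∈ Finset.range (n + 1), 10 * (s / ((j : ℂ) + 1)) ^ 2 := by
        rw [hH, Finset.mul_sum, Finset.sum_mul]
        exact Finset.sum_congr rfl fun j _ => by rw [div_pow]; ring
      have e3 : 40 * H 3 n * s ^ 3 = ∑ j ∈ Finset.range (n + 1), 40 * (s / ((j : ℂ) + 1)) ^ 3 := by
        rw [hH, Finset.mul_sum, Finset.sum_mul]
        exact Finset.sum_congr rfl fun j _ => by rw [div_pow]; ring
      rw [e2, e3, hE, ← Finset.sum_sub_distrib, ← Finset.sum_sub_distrib]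
    rw [h4]
    refine (norm_sum_le _ _).trans ?_
    calc _ ≤ ∑ j ∈ Finset.range (n + 1), 400 * ‖s‖ ^ 4 * (1 / ((j : ℝ) + 1) ^ 2) := by
          refine Finset.sum_le_sum fun j _ => (norm_log_ratio_le ((hx j).trans hs1)).trans ?_
          have h5 := hx2 j
          have h6 : ‖s / ((j : ℂ) + 1)‖ ^ 2 ≤ ‖s‖ ^ 2 := by gcongr; exact hx j
          calc _ = 400 * (‖s / ((j : ℂ) + 1)‖ ^ 2 * ‖s / ((j : ℂ) + 1)‖ ^ 2) := by ring
            _ ≤ 400 * (‖s‖ ^ 2 * ‖s / ((j : ℂ) + 1)‖ ^ 2) := by gcongr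
            _ = _ := by rw [h5]; ring
      _ = 400 * ‖s‖ ^ 4 * ∑ j ∈ Finset.range (n + 1), 1 / ((j : ℝ) + 1) ^ 2 := by
          rw [Finset.mul_sum]
      _ ≤ 400 * ‖s‖ ^ 4 * M := by gcongr; exact hM _
      _ = _ := by ring
  -- For |x| ≤ 1/10 the constant is 54 = 14 + 40: the explicit terms give 10 + 40/10 and the error
  -- gives at most 400/10.
  have hEs : ∀ n, ‖E n‖ ≤ 54 * M * ‖s‖ ^ 2 := by
    intro n
    refine (norm_sum_le _ _).trans ?_
    calc _ ≤ ∑ j ∈ Finset.range (n + 1), 54 * ‖s‖ ^ 2 * (1 / ((j : ℝ) + 1) ^ 2) := by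
          refine Finset.sum_le_sum fun j _ => ?_
          have h7 := norm_log_ratio_le ((hx j).trans hs1)
          have hx1 := (hx j).trans hs1
          set x := s / ((j : ℂ) + 1) with hxd
          have h8 : ‖10 * x ^ 2 - 40 * x ^ 3‖ ≤ 14 * ‖x‖ ^ 2 := by
            refine (norm_sub_le _ _).trans ?_
            rw [norm_mul, norm_mul, norm_pow, norm_pow, Complex.norm_ofNat, Complex.norm_ofNat]
            have := mul_le_mul_of_nonneg_left hx1 (sq_nonneg ‖x‖)
            nlinarith
          have h9 : ‖x‖ ^ 4 ≤ ‖x‖ ^ 2 * (1 / 10) := by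
            have h10 : ‖x‖ ^ 2 ≤ 1 / 10 := by nlinarith [norm_nonneg x]
            have := mul_le_mul_of_nonneg_left h10 (sq_nonneg ‖x‖)
            nlinarith
          have h11 : ‖5 * Complex.log (1 + x) - Complex.log (1 + 5 * x)‖ ≤ 54 * ‖x‖ ^ 2 := by
            have := norm_add_le (5 * Complex.log (1 + x) - Complex.log (1 + 5 * x) -
              (10 * x ^ 2 - 40 * x ^ 3)) (10 * x ^ 2 - 40 * x ^ 3)
            rw [sub_add_cancel] at this
            linarith
          rw [mul_assoc, ← hx2 j]
          exact h11
      _ = 54 * ‖s‖ ^ 2 * ∑ j ∈ Finset.range (n + 1), 1 / ((j : ℝ) + 1) ^ 2 := by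
          rw [Finset.mul_sum]
      _ ≤ 54 * ‖s‖ ^ 2 * M := by gcongr; exact hM _
      _ = _ := by ring
  have hlim : Tendsto (fun n => ‖Complex.exp (E n) -
      (1 + 10 * H 2 n * s ^ 2 - 40 * H 3 n * s ^ 3)‖) atTop
      (𝓝 ‖Complex.Gamma (5 * s + 1) / Complex.Gamma (s + 1) ^ 5 -
        (1 + 10 * riemannZeta 2 * s ^ 2 - 40 * riemannZeta 3 * s ^ 3)‖) := by
    have t1 := tendsto_prod_gammaRatio hs1
    have t2 := tendsto_sum_zeta (k := 2) (by norm_num)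
    have t3 := tendsto_sum_zeta (k := 3) (by norm_num)
    push_cast at t2 t3
    refine (Tendsto.sub (t1.congr fun n => (hfac n).symm) ?_).norm
    exact ((tendsto_const_nhds.add ((t2.const_mul 10).mul_const _)).sub
      ((t3.const_mul 40).mul_const _))
  refine le_of_tendsto hlim (Eventually.of_forall fun n => ?_)
  have h12 : ‖E n‖ ≤ 1 := by
    refine (hEs n).trans ?_
    nlinarith [norm_nonneg s, mul_nonneg hM0 (norm_nonneg s)]
  have h13 := Complex.norm_exp_sub_one_sub_id_le h12
  have h14 : ‖E n‖ ^ 2 ≤ (54 * M) ^ 2 * ‖s‖ ^ 4 := by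
    calc ‖E n‖ ^ 2 ≤ (54 * M * ‖s‖ ^ 2) ^ 2 := by gcongr; exact hEs n
      _ = _ := by ring
  rw [show Complex.exp (E n) - (1 + 10 * H 2 n * s ^ 2 - 40 * H 3 n * s ^ 3) =
    (Complex.exp (E n) - 1 - E n) + (E n - (10 * H 2 n * s ^ 2 - 40 * H 3 n * s ^ 3)) by ring,
    norm_pow]
  refine (norm_add_le _ _).trans ?_
  linarith [hb n]

/-! ### Principal parts of the kernels at `s = 0` -/

theorem sin_sub_isBigO : (fun x : ℂ => Complex.sin x - (x - x ^ 3 / 6)) =O[𝓝 0] fun x => x ^ 5 := by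
  have h := Complex.exp_sub_sum_range_isBigO_pow 5
  have h1 := h.comp_tendsto (k := fun x : ℂ => -x * Complex.I) (l' := 𝓝 0)
    (Continuous.tendsto' (by fun_prop) _ _ (by simp))
  have h2 := h.comp_tendsto (k := fun x : ℂ => x * Complex.I) (l' := 𝓝 0)
    (Continuous.tendsto' (by fun_prop) _ _ (by simp))
  have e1 : ((fun x : ℂ => x ^ 5) ∘ fun x : ℂ => -x * Complex.I) =O[𝓝 0] fun x : ℂ => x ^ 5 :=
    IsBigO.of_bound 1 (Eventually.of_forall fun x => by simp)
  have e2 : ((fun x : ℂ => x ^ 5) ∘ fun x : ℂ => x * Complex.I) =O[𝓝 0] fun x : ℂ => x ^ 5 :=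
    IsBigO.of_bound 1 (Eventually.of_forall fun x => by simp)
  refine (((h1.trans e1).sub (h2.trans e2)).const_mul_left (Complex.I / 2)).congr_left fun x => ?_
  have hI3 : Complex.I ^ 3 = -Complex.I := by
    rw [pow_succ, Complex.I_sq]; ring
  have hI4 : Complex.I ^ 4 = 1 := Complex.I_pow_four
  simp only [Function.comp_apply, Finset.sum_range_succ, Finset.sum_range_zero, Nat.factorial,
    mul_pow, Complex.I_sq, hI3, hI4, Complex.sin]
  push_cast
  ring_nf
  simp only [Complex.I_sq]
  ring

/-- Expansion up to `O(s ^ 4)` of `s` times the reflection factor `-π / sin (π s)`. -/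
theorem sineFactor_isBigO : (fun s : ℂ => -(Real.pi * s) / Complex.sin (Real.pi * s) +
    (1 + riemannZeta 2 * s ^ 2)) =O[𝓝[≠] 0] fun s => s ^ 4 := by
  have hpi : (Real.pi : ℂ) ≠ 0 := by exact_mod_cast Real.pi_ne_zero
  have h := (sin_sub_isBigO.comp_tendsto (k := fun s : ℂ => Real.pi * s) (l' := 𝓝 0)
    (Continuous.tendsto' (by fun_prop) _ _ (by simp))).mono (nhdsWithin_le_nhds (s := {0}ᶜ))
  have h5 : (fun s : ℂ => Complex.sin (Real.pi * s) - (Real.pi * s - (Real.pi * s) ^ 3 / 6))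
      =O[𝓝[≠] 0] fun s => s ^ 5 := by
    refine h.trans (IsBigO.of_bound (Real.pi ^ 5) (Eventually.of_forall fun s => ?_))
    simp [mul_pow, abs_of_pos Real.pi_pos]
  have hlim : Tendsto (fun s : ℂ => Complex.sin (Real.pi * s) / s) (𝓝[≠] 0) (𝓝 Real.pi) := by
    have hd : HasDerivAt (fun s : ℂ => Complex.sin (Real.pi * s)) (Real.pi : ℂ) 0 := by
      have := ((hasDerivAt_id (0 : ℂ)).const_mul (Real.pi : ℂ)).csin
      simpa using this
    have := hd.tendsto_slope
    refine this.congr' ?_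
    filter_upwards [self_mem_nhdsWithin] with s hs
    simp [slope_def_field]
  have hne : ∀ᶠ s : ℂ in 𝓝[≠] 0, Complex.sin (Real.pi * s) / s ≠ 0 := hlim.eventually_ne hpi
  have hinv : (fun s : ℂ => (Complex.sin (Real.pi * s) / s)⁻¹) =O[𝓝[≠] 0] fun _ => (1 : ℂ) :=
    (hlim.inv₀ hpi).isBigO_one ℂ
  -- Since ζ(2) = π²/6 the cubic terms cancel, and the polynomial part reduces to -(π^5/36) s^5.
  have hnum : (fun s : ℂ => -(Real.pi : ℂ) * s + (1 + riemannZeta 2 * s ^ 2) *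
      Complex.sin (Real.pi * s)) =O[𝓝[≠] 0] fun s => s ^ 5 := by
    have hbd : (fun s : ℂ => 1 + riemannZeta 2 * s ^ 2) =O[𝓝[≠] 0] fun _ => (1 : ℂ) := by
      have : ContinuousAt (fun s : ℂ => 1 + riemannZeta 2 * s ^ 2) 0 := by fun_prop
      exact (this.isBigO_one ℂ).mono nhdsWithin_le_nhds
    have h6 := hbd.mul h5
    simp only [one_mul] at h6
    have h7 : (fun s : ℂ => -((Real.pi : ℂ) ^ 5 / 36) * s ^ 5) =O[𝓝[≠] 0] fun s => s ^ 5 :=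
      (isBigO_refl _ _).const_mul_left _
    refine (h6.add h7).congr_left fun s => ?_
    rw [riemannZeta_two]
    ring
  have h8 := hnum.mul hinv
  have h9 : (fun s : ℂ => s ^ 5 * 1 * s⁻¹) =O[𝓝[≠] 0] fun s => s ^ 4 := by
    refine IsBigO.of_bound 1 ?_
    filter_upwards [self_mem_nhdsWithin] with s hs
    have hs0 : s ≠ 0 := hs
    refine le_of_eq ?_
    rw [one_mul]
    congr 1
    field_simp
  refine ((h8.mul (isBigO_refl (fun s : ℂ => s⁻¹) _)).trans h9).congr' ?_ EventuallyEq.rfl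
  filter_upwards [self_mem_nhdsWithin, hne] with s hs hs1
  have hs0 : s ≠ 0 := hs
  have hsin : Complex.sin (Real.pi * s) ≠ 0 := fun h0 => hs1 (by rw [h0, zero_div])
  field_simp

/-- Reflection turns each Γ(-s)Γ(s+1) into -π / sin(πs), so that k enters only through a power of an
elementary function. -/
theorem kernel_eq_gammaRatio_mul {k : ℕ} (hk : k ≤ 3) {s : ℂ} (h1 : -1 < s.re) (hs : s ≠ 0) :
    kernel k s = Complex.Gamma (5 * s + 1) / Complex.Gamma (s + 1) ^ 5 *
      (-(Real.pi * s) / Complex.sin (Real.pi * s)) ^ (k + 1) / s ^ (k + 1) := by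
  have hG : Complex.Gamma (s + 1) ≠ 0 :=
    Complex.Gamma_ne_zero_of_re_pos (by simp; linarith)
  have hrefl : Complex.Gamma (s + 1) * Complex.Gamma (-s) =
      -(Real.pi * s) / Complex.sin (Real.pi * s) / s := by
    have := Complex.Gamma_mul_Gamma_one_sub (-s)
    rw [show 1 - -s = s + 1 by ring, mul_neg, Complex.sin_neg] at this
    rw [mul_comm, this]
    field_simp
  rw [← mul_div_assoc', ← div_pow, ← hrefl, kernel, mul_pow]
  have h5 : Complex.Gamma (s + 1) ^ 5 = Complex.Gamma (s + 1) ^ (k + 1) *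
      Complex.Gamma (s + 1) ^ (4 - k) := by
    rw [← pow_add]
    congr 1
    omega
  rw [h5, inv_pow]
  field_simp

theorem IsBigO.mul_sub_mul {l : Filter ℂ} {f g p q : ℂ → ℂ} {n : ℂ → ℂ}
    (hf : (fun s => f s - p s) =O[l] n) (hg : (fun s => g s - q s) =O[l] n)
    (hf1 : f =O[l] fun _ => (1 : ℂ)) (hq1 : q =O[l] fun _ => (1 : ℂ)) :
    (fun s => f s * g s - p s * q s) =O[l] n := by
  have h1 := hf1.mul hg
  have h2 := hf.mul hq1
  simp only [one_mul, mul_one] at h1 h2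
  refine (h1.add h2).congr_left fun s => ?_
  ring

/-- The numerators of the principal part of `kernel k` at `s = 0`. -/
noncomputable def polarCoeff (k j : ℕ) : ℂ :=
  (-1) ^ (k + 1) * (if j = k then 1 else if j + 2 = k then (k + 11) * riemannZeta 2
    else if j + 3 = k then -40 * riemannZeta 3 else 0)

/-- The coefficient of ζ(2) is 10 from the Gamma ratio plus k + 1 from the sine factors. -/
theorem kernelReg_isBigO {k : ℕ} (hk : k ≤ 3) : (fun s : ℂ => kernelReg k s -
    (-1) ^ (k + 1) * (1 + (k + 11) * riemannZeta 2 * s ^ 2 - 40 * riemannZeta 3 * s ^ 3))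
      =O[𝓝[≠] 0] fun s => s ^ 4 := by
  have hc1 : ∀ {g : ℂ → ℂ}, ContinuousAt g 0 → g =O[𝓝[≠] 0] fun _ => (1 : ℂ) := fun hg =>
    (hg.isBigO_one ℂ).mono nhdsWithin_le_nhds
  have hs4 : (fun s : ℂ => s ^ 4) =O[𝓝[≠] 0] fun _ => (1 : ℂ) := hc1 (by fun_prop)
  set Q : ℂ → ℂ := fun s => -(Real.pi * s) / Complex.sin (Real.pi * s) with hQ
  have hQ1 : (fun s => Q s - -(1 + riemannZeta 2 * s ^ 2)) =O[𝓝[≠] 0] fun s => s ^ 4 :=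
    sineFactor_isBigO.congr_left fun s => by ring
  have hQb : Q =O[𝓝[≠] 0] fun _ => (1 : ℂ) :=
    ((hQ1.trans hs4).add (hc1 (g := fun s : ℂ => -(1 + riemannZeta 2 * s ^ 2))
      (by fun_prop))).congr_left fun s => by ring
  have hQn : ∀ n : ℕ, (fun s => Q s ^ n - (-(1 + riemannZeta 2 * s ^ 2)) ^ n)
      =O[𝓝[≠] 0] fun s => s ^ 4 := by
    intro n
    induction n with
    | zero => simpa using isBigO_zero _ _
    | succ n ih =>
      simp only [pow_succ (n := n)]
      exact IsBigO.mul_sub_mul ih hQ1 ((hQb.pow n).congr_right fun s => by simp)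
        (hc1 (by fun_prop))
  have hQn' : ∀ n : ℕ, (fun s => Q s ^ n - (-1) ^ n * (1 + n * riemannZeta 2 * s ^ 2))
      =O[𝓝[≠] 0] fun s => s ^ 4 := by
    intro n
    induction n with
    | zero => simpa using isBigO_zero _ _
    | succ n ih =>
      have h := IsBigO.mul_sub_mul ih hQ1 ((hQb.pow n).congr_right fun s => by simp)
        (hc1 (by fun_prop))
      have h2 : (fun s : ℂ => (-1) ^ (n + 1) * (n * riemannZeta 2 ^ 2) * s ^ 4)
        =O[𝓝[≠] 0] fun s => s ^ 4 := (isBigO_refl _ _).const_mul_left _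
      refine (h.add h2).congr_left fun s => ?_
      push_cast
      ring
  have hR := gammaRatio_isBigO.mono (nhdsWithin_le_nhds (s := {0}ᶜ))
  have hRb : (fun s : ℂ => Complex.Gamma (5 * s + 1) / Complex.Gamma (s + 1) ^ 5)
      =O[𝓝[≠] 0] fun _ => (1 : ℂ) :=
    ((hR.trans hs4).add (hc1 (g := fun s : ℂ => 1 + 10 * riemannZeta 2 * s ^ 2 -
      40 * riemannZeta 3 * s ^ 3) (by fun_prop))).congr_left fun s => by ring
  have h := IsBigO.mul_sub_mul hR (hQn' (k + 1)) hRb (hc1 (by fun_prop))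
  have hrest : (fun s : ℂ => ((-1) ^ (k + 1) * ((k + 1) * riemannZeta 2 * (10 * riemannZeta 2) -
      (k + 1) * riemannZeta 2 * (40 * riemannZeta 3) * s)) * s ^ 4)
      =O[𝓝[≠] 0] fun s => s ^ 4 := by
    have := (hc1 (g := fun s : ℂ => (-1) ^ (k + 1) * ((k + 1) * riemannZeta 2 *
      (10 * riemannZeta 2) - (k + 1) * riemannZeta 2 * (40 * riemannZeta 3) * s))
      (by fun_prop)).mul (isBigO_refl (fun s : ℂ => s ^ 4) (𝓝[≠] 0))
    simpa only [one_mul] using this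
  refine (h.add hrest).congr' ?_ EventuallyEq.rfl
  have hnear : ∀ᶠ s : ℂ in 𝓝[≠] 0, -1 < s.re := nhdsWithin_le_nhds
    ((isOpen_lt continuous_const Complex.continuous_re).mem_nhds (by simp))
  filter_upwards [self_mem_nhdsWithin, hnear] with s hs hs1
  have hs0 : s ≠ 0 := hs
  have hk1 := kernel_eq_gammaRatio_mul hk hs1 hs0
  rw [kernel_eq_kernelReg_div k hs0, div_left_inj' (pow_ne_zero _ hs0)] at hk1
  rw [hk1]
  push_cast
  ring

theorem kernel_principalPart {k : ℕ} (hk : k ≤ 3) : (fun s : ℂ => kernel k s -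
    ∑ j ∈ Finset.range (k + 1), polarCoeff k j / s ^ (j + 1)) =O[𝓝[≠] 0] fun _ => (1 : ℂ) := by
  have hc1 : ∀ {g : ℂ → ℂ}, ContinuousAt g 0 → g =O[𝓝[≠] 0] fun _ => (1 : ℂ) := fun hg =>
    (hg.isBigO_one ℂ).mono nhdsWithin_le_nhds
  have h := (kernelReg_isBigO hk).mul (isBigO_refl (fun s : ℂ => (s ^ (k + 1))⁻¹) (𝓝[≠] 0))
  have h1 : (fun s : ℂ => s ^ 4 * (s ^ (k + 1))⁻¹) =O[𝓝[≠] 0] fun _ => (1 : ℂ) := by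
    refine (hc1 (g := fun s : ℂ => s ^ (3 - k)) (by fun_prop)).congr' ?_ EventuallyEq.rfl
    filter_upwards [self_mem_nhdsWithin] with s hs
    have hs0 : s ≠ 0 := hs
    rw [← div_eq_mul_inv, eq_div_iff (pow_ne_zero _ hs0), ← pow_add]
    congr 1
    omega
  -- For small k some terms of the expansion are no longer polar after division by s^(k+1); they go
  -- into the bounded part.
  have h2 : (fun s : ℂ => (-1) ^ (k + 1) * ((if k < 2 then (k + 11) * riemannZeta 2 * s ^ (1 - k)
      else 0) - (if k < 3 then 40 * riemannZeta 3 * s ^ (2 - k) else 0)))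
      =O[𝓝[≠] 0] fun _ => (1 : ℂ) := by
    refine hc1 ?_
    split_ifs <;> fun_prop
  refine ((h.trans h1).add h2).congr' ?_ EventuallyEq.rfl
  filter_upwards [self_mem_nhdsWithin] with s hs
  have hs0 : s ≠ 0 := hs
  rw [kernel_eq_kernelReg_div k hs0]
  generalize kernelReg k s = w
  interval_cases k <;> simp [polarCoeff, Finset.sum_range_succ] <;> field_simp <;> ring

/-! ### The Barnes integrals at large radius -/

theorem exists_principalPart {h : ℂ → ℂ} (hh : AnalyticAt ℂ h 0) (k : ℕ) : ∃ B : ℕ → ℂ,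
    (fun s : ℂ => h s / s ^ (k + 1) - ∑ j ∈ Finset.range (k + 1), B j / s ^ (j + 1))
      =O[𝓝[≠] 0] fun _ => (1 : ℂ) := by
  obtain ⟨F, hF, hF1⟩ := hh.exists_eq_sum_add_pow_mul (k + 1)
  refine ⟨fun j => iteratedDeriv (k - j) h 0 / ((k - j).factorial : ℂ), ?_⟩
  refine ((hF.continuousAt.isBigO_one ℂ).mono nhdsWithin_le_nhds).congr' ?_ EventuallyEq.rfl
  filter_upwards [self_mem_nhdsWithin] with s hs
  have hs0 : s ≠ 0 := hs
  rw [hF1, ← Finset.sum_range_reflect, add_div, Finset.sum_div]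
  have : ∀ j ∈ Finset.range (k + 1), (s ^ (k + 1 - 1 - j) / ((k + 1 - 1 - j).factorial : ℂ)) •
      iteratedDeriv (k + 1 - 1 - j) h 0 / s ^ (k + 1) =
      iteratedDeriv (k - j) h 0 / ((k - j).factorial : ℂ) / s ^ (j + 1) := by
    intro j hj
    have hj' : j ≤ k := Nat.lt_succ_iff.1 (Finset.mem_range.1 hj)
    have e : s ^ (k + 1) = s ^ (k - j) * s ^ (j + 1) := by
      rw [← pow_add]
      congr 1
      omega
    rw [Nat.add_sub_cancel, e, smul_eq_mul]
    field_simp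
  rw [Finset.sum_congr rfl this, smul_eq_mul, mul_div_cancel_left₀ _ (pow_ne_zero _ hs0)]
  ring

theorem norm_polynomial_le {k : ℕ} (A : ℕ → ℂ) {v : ℂ} (hv : 1 ≤ ‖v‖) :
    ‖∑ j ∈ Finset.range (k + 1), A j * (v ^ j / (j.factorial : ℂ))‖ ≤
      (∑ j ∈ Finset.range (k + 1), ‖A j‖) * ‖v‖ ^ k := by
  rw [Finset.sum_mul]
  refine (norm_sum_le _ _).trans (Finset.sum_le_sum fun j hj => ?_)
  rw [norm_mul, norm_div, norm_pow, Complex.norm_natCast]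
  have h1 : (1 : ℝ) ≤ j.factorial := by exact_mod_cast j.factorial_pos
  have h2 : ‖v‖ ^ j ≤ ‖v‖ ^ k := pow_le_pow_right₀ hv (Nat.lt_succ_iff.1 (Finset.mem_range.1 hj))
  have h3 : ‖v‖ ^ j / (j.factorial : ℝ) ≤ ‖v‖ ^ k := (div_le_self (by positivity) h1).trans h2
  gcongr

/-- Crossing s = 0 produces the polynomial, and the shifted integral is 5^5 z times an integral over
the original line with the extra factor `kernelRatio`. On that line e^(sv) still grows as Re v → -∞,
so it is moved on to Re s = 1/2, at the cost of another polynomial of degree k in v. -/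
theorem exists_momentInt_bound {ε : ℝ} (h1 : -(1 / 5) < ε) (h2 : ε < 0) (k : Fin 4) {c : ℝ}
    (hc : c < ((k : ℕ) + 1) * Real.pi) :
    ∃ K, ∀ u : ℂ, u.re ≤ -1 → |(barnesArg k u).im| ≤ c →
      ‖momentInt ε k 0 u + ∑ j ∈ Finset.range ((k : ℕ) + 1),
        polarCoeff k j * (barnesArg k u ^ j / (j.factorial : ℂ))‖ ≤
        K * (‖barnesArg k u‖ ^ (k : ℕ) * ‖Complex.exp u‖) := by
  have hk := kernel_index_le k
  have hratio : ∀ s : ℂ, -(1 / 5) < s.re → DifferentiableAt ℂ kernelRatio s := by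
    intro s hs
    have hs1 : (s + 1) ^ 4 ≠ 0 := by
      refine pow_ne_zero _ fun h => ?_
      have := congrArg Complex.re h
      simp at this
      linarith
    unfold kernelRatio
    exact DifferentiableAt.fun_div (by fun_prop) (by fun_prop) hs1
  have han : AnalyticAt ℂ (fun s => kernelRatio s * kernelReg k s) 0 := by
    have hU : IsOpen {s : ℂ | -(1 / 5) < s.re ∧ s.re < 1} :=
      (isOpen_lt continuous_const Complex.continuous_re).inter
        (isOpen_lt Complex.continuous_re continuous_const)
    have hdiff : DifferentiableOn ℂ (fun s => kernelRatio s * kernelReg k s)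
        {s : ℂ | -(1 / 5) < s.re ∧ s.re < 1} := fun s hs =>
      ((hratio s hs.1).mul (differentiableAt_kernelReg k hs.1 hs.2)).differentiableWithinAt
    exact hdiff.analyticAt (hU.mem_nhds (by simp))
  obtain ⟨B, hB⟩ := exists_principalPart han k
  have hB' : (fun s : ℂ => kernelRatio s * kernel k s -
      ∑ j ∈ Finset.range ((k : ℕ) + 1), B j / s ^ (j + 1)) =O[𝓝[≠] 0] fun _ => (1 : ℂ) := by
    refine hB.congr' ?_ EventuallyEq.rfl
    filter_upwards [self_mem_nhdsWithin] with s hs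
    rw [kernel_eq_kernelReg_div k hs, mul_div_assoc]
  have hhalf : ∀ n : ℤ, 5 * (1 / 2 : ℝ) ≠ n := by
    intro n hn
    have h3 : (5 : ℝ) = ((2 * n : ℤ) : ℝ) := by push_cast; linarith
    have h4 : (5 : ℤ) = 2 * n := by exact_mod_cast h3
    omega
  have hdec : DecaysOn (vline (1 / 2)) (((k : ℕ) + 1) * Real.pi)
      (fun s => kernelRatio s * kernel k s) :=
    (decaysOn_kernel_vline hk hhalf).bounded_mul fun s hs => norm_kernelRatio_le (by
      rw [show s.re = 1 / 2 from hs]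
      norm_num)
  obtain ⟨K, hK⟩ := lineIntegral_isBounded hdec hc
  refine ⟨5 ^ 5 * (K + ∑ j ∈ Finset.range ((k : ℕ) + 1), ‖B j‖), fun u hu hv => ?_⟩
  set v := barnesArg k u with hvdef
  have hvc := hv.trans_lt hc
  have hre : v.re = u.re := by
    rw [hvdef, barnesArg]
    split_ifs <;> simp
  have hv1 : 1 ≤ ‖v‖ := by
    refine le_trans ?_ (Complex.abs_re_le_norm v)
    rw [hre, abs_of_nonpos (by linarith)]
    linarith
  have s1 := lineIntegral_sub_lineIntegral_zero (a := ε) (b := ε + 1) h2 (by linarith)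
    (fun s ha hb hs => differentiableAt_kernel_of_ne_zero k (by linarith) (by linarith) hs)
    (kernel_principalPart hk) (decaysOn_kernel hk _ _) hvc
  have s2 := lineIntegral_sub_lineIntegral_zero (G := fun s => kernelRatio s * kernel k s)
    (a := ε) (b := 1 / 2) h2 (by norm_num)
    (fun s ha hb hs => (hratio s (by linarith)).mul
      (differentiableAt_kernel_of_ne_zero k (by linarith) (by linarith) hs)) hB'
    ((decaysOn_kernel hk _ _).bounded_mul (M := 1) fun s hs => norm_kernelRatio_le
      (by linarith [hs.1])) hvc
  have s3 := lineIntegral_shift_one h1 k u (fun _ => 1)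
  simp only [one_mul] at s3
  rw [← hvdef] at s3
  have hmom : momentInt ε k 0 u = lineIntegral ε (fun s => kernel k s * Complex.exp (s * v)) := by
    simp [momentInt, hvdef]
  rw [hmom]
  have e : lineIntegral ε (fun s => kernel k s * Complex.exp (s * v)) +
      ∑ j ∈ Finset.range ((k : ℕ) + 1), polarCoeff k j * (v ^ j / (j.factorial : ℂ)) =
      5 ^ 5 * Complex.exp u *
        (lineIntegral (1 / 2) (fun s => kernelRatio s * kernel k s * Complex.exp (s * v)) -
        ∑ j ∈ Finset.range ((k : ℕ) + 1), B j * (v ^ j / (j.factorial : ℂ))) := by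
    linear_combination s1 + s3 + 5 ^ 5 * Complex.exp u * s2
  rw [e, norm_mul, norm_mul, norm_pow, Complex.norm_ofNat]
  have hK1 := hK v hv
  have hK0 : 0 ≤ K := by
    have := (norm_nonneg _).trans hK1
    by_contra hneg
    push Not at hneg
    have := mul_neg_of_neg_of_pos hneg (Real.exp_pos (1 / 2 * v.re))
    linarith
  have hexp : Real.exp (1 / 2 * v.re) ≤ 1 := Real.exp_le_one_iff.2 (by rw [hre]; linarith)
  have hpow : 1 ≤ ‖v‖ ^ (k : ℕ) := one_le_pow₀ hv1
  have hfin : ‖lineIntegral (1 / 2) (fun s => kernelRatio s * kernel k s * Complex.exp (s * v)) -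
        ∑ j ∈ Finset.range ((k : ℕ) + 1), B j * (v ^ j / (j.factorial : ℂ))‖ ≤
      (K + ∑ j ∈ Finset.range ((k : ℕ) + 1), ‖B j‖) * ‖v‖ ^ (k : ℕ) := by
    refine (norm_sub_le _ _).trans ?_
    rw [add_mul]
    refine add_le_add (hK1.trans ?_) (norm_polynomial_le B hv1)
    exact mul_le_mul_of_nonneg_left (hexp.trans hpow) hK0
  calc _ ≤ 5 ^ 5 * ‖Complex.exp u‖ *
        ((K + ∑ j ∈ Finset.range ((k : ℕ) + 1), ‖B j‖) * ‖v‖ ^ (k : ℕ)) := by gcongr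
    _ = _ := by ring

theorem logConifold_neg : logConifold < 0 := by
  have := Real.log_pos (show (1 : ℝ) < 5 by norm_num)
  rw [logConifold]
  linarith

/-- The circle |z| = 5^(-5) is reached by continuity from inside, where closing the contour to the
right is justified. -/
theorem Phi_zero_eq_fundSeries {ε : ℝ} (h1 : -(1 / 5) < ε) (h2 : ε < 0) {u : ℂ}
    (hu : u ∈ strip) (hre : u.re ≤ logConifold) : Phi ε 0 u = fundSeries u := by
  have hg : Tendsto (fun t : ℝ => u - t) (𝓝[>] 0) (𝓝 u) :=
    (Continuous.tendsto' (by fun_prop) _ _ (by simp)).mono_left nhdsWithin_le_nhds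
  have ha : Tendsto (fun t : ℝ => Phi ε 0 (u - t)) (𝓝[>] 0) (𝓝 (Phi ε 0 u)) :=
    (((isPeriod_Phi h1 h2 0).1.differentiableAt (isOpen_strip.mem_nhds hu)).continuousAt.tendsto).comp
      hg
  have hmem : ∀ t : ℝ, 0 < t → u - t ∈ strip ∧ (u - t).re < logConifold := by
    intro t ht
    refine ⟨⟨?_, ?_⟩, ?_⟩
    · simpa using hu.1
    · simpa using hu.2
    · simp
      linarith
  have hb : Tendsto (fun t : ℝ => fundSeries (u - t)) (𝓝[>] 0) (𝓝 (fundSeries u)) := by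
    refine (continuousOn_fundSeries u hre).tendsto.comp (tendsto_nhdsWithin_iff.2 ⟨hg, ?_⟩)
    filter_upwards [self_mem_nhdsWithin] with t ht using (hmem t ht).2.le
  refine tendsto_nhds_unique_of_eventuallyEq ha hb ?_
  filter_upwards [self_mem_nhdsWithin] with t ht
  exact Phi_zero_eq_fundSeries_of_lt h1 h2 (hmem t ht).1 (hmem t ht).2

theorem exists_fundSeries_sub_one_bound :
    ∃ K, ∀ u : ℂ, u.re ≤ logConifold → ‖fundSeries u - 1‖ ≤ K * ‖Complex.exp u‖ := by
  set S : ℝ := ∑' n : ℕ, fundCoeff (n + 1) * ((5 : ℝ) ^ (-5 : ℤ)) ^ n with hS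
  have hq : ((5 : ℝ) ^ (-5 : ℤ)) ≠ 0 := by positivity
  have hsum : Summable fun n : ℕ => fundCoeff (n + 1) * ((5 : ℝ) ^ (-5 : ℤ)) ^ n := by
    have h := ((summable_nat_add_iff 1).2 summable_fundCoeff).mul_right ((5 : ℝ) ^ (-5 : ℤ))⁻¹
    refine h.congr fun n => ?_
    rw [pow_succ]
    field_simp
  refine ⟨S, fun u hu => ?_⟩
  have h := hasSum_fundSeries hu
  rw [← hasSum_nat_add_iff' 1] at h
  have h0 : ∑ i ∈ Finset.range 1, (fundCoeff i : ℂ) * Complex.exp u ^ i = 1 := by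
    simp [fundCoeff]
  rw [h0] at h
  have hz : ‖Complex.exp u‖ ≤ (5 : ℝ) ^ (-5 : ℤ) := by
    rw [Complex.norm_exp, ← exp_logConifold]
    exact Real.exp_le_exp.2 hu
  have hb := hsum.hasSum.mul_right ‖Complex.exp u‖
  rw [← h.tsum_eq]
  refine tsum_of_norm_bounded hb fun n => ?_
  rw [norm_mul, norm_pow, Complex.norm_real, Real.norm_of_nonneg (fundCoeff_pos _).le, pow_succ,
    ← mul_assoc]
  have := fundCoeff_pos (n + 1)
  gcongr

/-- Monodromy around `z = 0` relates `Φ_1` and `Φ_0`. -/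
theorem momentInt_one_add_two_pi_I {ε : ℝ} (h1 : -(1 / 5) < ε) (h2 : ε < 0) {u : ℂ}
    (hu : u ∈ strip) : momentInt ε 1 0 (u + 2 * Real.pi * Complex.I) - momentInt ε 1 0 u =
      -(2 * Real.pi * Complex.I) * momentInt ε 0 0 u := by
  have hint : ∀ v : ℂ, |v.im| < 2 * Real.pi → MeasureTheory.Integrable (fun y : ℝ =>
      kernel 1 (ε + y * Complex.I) * Complex.exp ((ε + y * Complex.I) * v) * Complex.I) := by
    intro v hv
    refine (integrable_line (continuousOn_kernel (five_mul_ne_int h1 h2))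
      (decaysOn_kernel_vline (by norm_num) (five_mul_ne_int h1 h2)) ?_).mul_const _
    push_cast
    linarith
  have i1 := hint (u + 2 * Real.pi * Complex.I) (by
    have := hu.1
    have := hu.2
    have := Real.pi_pos
    rw [abs_lt]
    constructor <;> simp <;> linarith)
  have i2 := hint u (by
    have := hu.1
    have := hu.2
    have := Real.pi_pos
    rw [abs_lt]
    constructor <;> linarith)
  have hb1 : ∀ w : ℂ, barnesArg 1 w = w := fun w => by simp [barnesArg]
  have hb0 : barnesArg 0 u = u + Real.pi * Complex.I := by simp [barnesArg]
  have e : ∀ w : ℂ, momentInt ε 1 0 w =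
      lineIntegral ε (fun s => kernel 1 s * Complex.exp (s * w)) := fun w => by
    simp [momentInt, hb1]
  have e0 : momentInt ε 0 0 u =
      lineIntegral ε (fun s => kernel 0 s * Complex.exp (s * (u + Real.pi * Complex.I))) := by
    simp [momentInt, hb0]
  rw [e, e, e0, ← lineIntegral_const_mul]
  simp only [lineIntegral]
  rw [← mul_sub, ← MeasureTheory.integral_sub i1 i2]
  congr 2
  ext y
  set s : ℂ := ε + y * Complex.I with hs
  have hre : s.re = ε := by simp [hs]
  have hsin : Complex.sin (Real.pi * s) ≠ 0 := by
    intro h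
    obtain ⟨n, hn⟩ := Complex.sin_eq_zero_iff.1 h
    have hpi : (Real.pi : ℂ) ≠ 0 := by exact_mod_cast Real.pi_ne_zero
    rw [mul_comm] at hn
    replace hn := mul_right_cancel₀ hpi hn
    have h3 := congrArg Complex.re hn
    rw [hre] at h3
    simp at h3
    exact five_mul_ne_int h1 h2 (5 * n) (by push_cast; rw [h3])
  have hG : Complex.Gamma (s + 1) ≠ 0 :=
    Complex.Gamma_ne_zero_of_re_pos (by simp [hre]; linarith)
  have hrefl : Complex.Gamma (-s) * Complex.Gamma (s + 1) * Complex.sin (Real.pi * s) =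
      -Real.pi := by
    have := Complex.Gamma_mul_Gamma_one_sub (-s)
    rw [show 1 - -s = s + 1 by ring, mul_neg, Complex.sin_neg] at this
    rw [this]
    field_simp
  -- The difference of the exponentials contains sin(πs), which cancels Γ(-s)Γ(s+1) up to -π and
  -- lowers k from 1 to 0.
  have hk : kernel 1 s = kernel 0 s * (Complex.Gamma (-s) * Complex.Gamma (s + 1)) := by
    simp only [kernel, Nat.sub_zero, Nat.add_one_sub_one, inv_pow]
    field_simp
    ring
  have hexp : Complex.exp (s * (u + 2 * Real.pi * Complex.I)) - Complex.exp (s * u) =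
      2 * Complex.I * Complex.sin (Real.pi * s) *
        Complex.exp (s * (u + Real.pi * Complex.I)) := by
    have e1 : Complex.exp (s * (u + 2 * Real.pi * Complex.I)) =
        Complex.exp (s * (u + Real.pi * Complex.I)) * Complex.exp (Real.pi * s * Complex.I) := by
      rw [← Complex.exp_add]
      ring_nf
    have e2 : Complex.exp (s * u) =
        Complex.exp (s * (u + Real.pi * Complex.I)) * Complex.exp (-(Real.pi * s) * Complex.I) := by
      rw [← Complex.exp_add]
      ring_nf
    rw [e1, e2, Complex.sin]
    ring_nf
    rw [Complex.I_sq]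
    ring
  rw [hk]
  linear_combination kernel 0 s * (Complex.Gamma (-s) * Complex.Gamma (s + 1)) * Complex.I * hexp +
    2 * Complex.I ^ 2 * kernel 0 s * Complex.exp (s * (u + Real.pi * Complex.I)) * hrefl

theorem polar_sum_one (v : ℂ) :
    ∑ j ∈ Finset.range 2, polarCoeff 1 j * (v ^ j / (j.factorial : ℂ)) = v := by
  simp [polarCoeff]

theorem polar_sum_two (v : ℂ) :
    ∑ j ∈ Finset.range 3, polarCoeff 2 j * (v ^ j / (j.factorial : ℂ)) =
      -(13 * Real.pi ^ 2 / 6) - v ^ 2 / 2 := by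
  simp [polarCoeff, Finset.sum_range_succ, riemannZeta_two]
  ring

theorem polar_sum_three (v : ℂ) :
    ∑ j ∈ Finset.range 4, polarCoeff 3 j * (v ^ j / (j.factorial : ℂ)) =
      -40 * riemannZeta 3 + 7 * Real.pi ^ 2 / 3 * v + v ^ 3 / 6 := by
  simp [polarCoeff, Finset.sum_range_succ, riemannZeta_two, Nat.factorial]
  ring

theorem eventually_largeRadius (M : ℝ) : ∀ᶠ u in largeRadius, u ∈ strip ∧ u.re ≤ M := by
  refine Filter.Eventually.and ?_ ?_
  · exact mem_inf_of_right (mem_principal_self _)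
  · exact mem_inf_of_left (preimage_mem_comap (Iic_mem_atBot M))

theorem norm_barnesArg_le (k : Fin 4) {u : ℂ} (hu : 1 ≤ ‖u‖) : ‖barnesArg k u‖ ≤ 8 * ‖u‖ := by
  have hpi := Real.pi_lt_four
  rw [barnesArg]
  refine (norm_add_le _ _).trans ?_
  split_ifs
  · rw [norm_mul, Complex.norm_I, mul_one, Complex.norm_real, Real.norm_of_nonneg Real.pi_pos.le]
    linarith
  · rw [norm_zero]
    linarith

theorem one_le_norm_of_re_le {u : ℂ} (hu : u.re ≤ -1) : 1 ≤ ‖u‖ := by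
  refine le_trans ?_ (Complex.abs_re_le_norm u)
  rw [abs_of_nonpos (by linarith)]
  linarith

/-- The bound c must lie strictly below (k+1)π on the whole strip; that is possible for k = 2 and k
= 3 only. -/
theorem momentInt_isBigO {ε : ℝ} (h1 : -(1 / 5) < ε) (h2 : ε < 0) (k : Fin 4) {c : ℝ}
    (hc : c < ((k : ℕ) + 1) * Real.pi) (hk : ∀ u ∈ strip, |(barnesArg k u).im| ≤ c) :
    (fun u => momentInt ε k 0 u + ∑ j ∈ Finset.range ((k : ℕ) + 1),
        polarCoeff k j * (barnesArg k u ^ j / (j.factorial : ℂ)))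
      =O[largeRadius] fun u => u ^ (k : ℕ) * Complex.exp u := by
  obtain ⟨K, hK⟩ := exists_momentInt_bound h1 h2 k hc
  refine IsBigO.of_bound (|K| * 8 ^ (k : ℕ)) ?_
  filter_upwards [eventually_largeRadius (-1)] with u hu
  refine (hK u hu.2 (hk u hu.1)).trans ?_
  have h3 := norm_barnesArg_le k (one_le_norm_of_re_le hu.2)
  rw [norm_mul, norm_pow]
  calc K * (‖barnesArg k u‖ ^ (k : ℕ) * ‖Complex.exp u‖) ≤
      |K| * ((8 * ‖u‖) ^ (k : ℕ) * ‖Complex.exp u‖) := by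
        gcongr
        exact le_abs_self K
    _ = _ := by rw [mul_pow]; ring

/-- The Barnes estimate degenerates at both edges of the strip, so the power series is used. -/
theorem Phi_zero_isBigO {ε : ℝ} (h1 : -(1 / 5) < ε) (h2 : ε < 0) :
    (fun u => Phi ε 0 u - 1) =O[largeRadius] fun u => Complex.exp u := by
  obtain ⟨K, hK⟩ := exists_fundSeries_sub_one_bound
  refine IsBigO.of_bound K ?_
  filter_upwards [eventually_largeRadius logConifold] with u hu
  rw [Phi_zero_eq_fundSeries h1 h2 hu.1 hu.2]
  exact hK u hu.2

/-- For -π ≤ Im u the Barnes estimate is uniform. For Im u < -π it is applied at u + 2πi, outside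
the strip but still in the domain of convergence, and the difference is a multiple of Φ_0 = 1 +
O(z). -/
theorem Phi_one_isBigO {ε : ℝ} (h1 : -(1 / 5) < ε) (h2 : ε < 0) :
    (fun u => Phi ε 1 u - 1 / (2 * Real.pi * Complex.I) * u)
      =O[largeRadius] fun u => u * Complex.exp u := by
  obtain ⟨K, hK⟩ := exists_momentInt_bound h1 h2 1 (c := Real.pi) (by
    have := Real.pi_pos
    norm_num
    linarith)
  obtain ⟨L, hL⟩ := exists_fundSeries_sub_one_bound
  have hb1 : ∀ w : ℂ, barnesArg 1 w = w := fun w => by simp [barnesArg]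
  have hpi : (Real.pi : ℂ) ≠ 0 := by exact_mod_cast Real.pi_ne_zero
  have hpi0 := Real.pi_pos
  have hmom : (fun u => momentInt ε 1 0 u + u) =O[largeRadius] fun u => u * Complex.exp u := by
    refine IsBigO.of_bound (8 * |K| + 7 * |L|) ?_
    -- This bound on Re u yields both Re u ≤ -1 and |z| ≤ 5^(-5).
    filter_upwards [eventually_largeRadius (logConifold - 1)] with u hu
    have hre : u.re ≤ -1 := by linarith [hu.2, logConifold_neg]
    have hu1 := one_le_norm_of_re_le hre
    have hK' : ∀ w : ℂ, w.re ≤ -1 → |w.im| ≤ Real.pi →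
        ‖momentInt ε 1 0 w + w‖ ≤ |K| * (‖w‖ * ‖Complex.exp w‖) := by
      intro w hw hw1
      have := hK w hw (by rwa [hb1])
      rw [hb1] at this
      have h5 := polar_sum_one w
      simp only [Fin.val_one, pow_one] at this
      rw [h5] at this
      refine this.trans ?_
      gcongr
      exact le_abs_self K
    rw [norm_mul]
    have hE := norm_nonneg (Complex.exp u)
    by_cases him : -Real.pi ≤ u.im
    · have := hK' u hre (abs_le.2 ⟨him, by linarith [hu.1.2]⟩)
      nlinarith [abs_nonneg K, abs_nonneg L, norm_nonneg u, mul_nonneg (norm_nonneg u) hE,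
        mul_nonneg (abs_nonneg K) (mul_nonneg (norm_nonneg u) hE),
        mul_nonneg (abs_nonneg L) (mul_nonneg (norm_nonneg u) hE)]
    · push Not at him
      set w := u + 2 * Real.pi * Complex.I with hw
      have a1 := hK' w (by simpa [hw] using hre) (by
        have := hu.1.1
        rw [abs_le]
        constructor <;> simp [hw] <;> linarith)
      have a2 := momentInt_one_add_two_pi_I h1 h2 hu.1
      rw [← hw] at a2
      have a3 := Phi_zero_eq_fundSeries h1 h2 hu.1 (by linarith [hu.2])
      rw [Phi_eq_momentInt, show barnesPrefactor 0 = 1 from rfl, one_mul] at a3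
      have a4 := hL u (by linarith [hu.2])
      rw [← a3] at a4
      have hwexp : Complex.exp w = Complex.exp u := by
        rw [hw, Complex.exp_add, Complex.exp_two_pi_mul_I, mul_one]
      have h2pi : ‖(2 * Real.pi * Complex.I : ℂ)‖ ≤ 7 := by
        rw [norm_mul, Complex.norm_I, norm_mul, Complex.norm_real, Complex.norm_ofNat,
          Real.norm_of_nonneg hpi0.le]
        linarith [Real.pi_lt_d2]
      have hwn : ‖w‖ ≤ 8 * ‖u‖ := (norm_add_le _ _).trans (by linarith)
      rw [hwexp] at a1
      have e : momentInt ε 1 0 u + u = (momentInt ε 1 0 w + w) +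
          2 * Real.pi * Complex.I * (momentInt ε 0 0 u - 1) := by
        linear_combination -a2 - hw
      rw [e]
      refine (norm_add_le _ _).trans ?_
      rw [norm_mul (2 * Real.pi * Complex.I : ℂ)]
      have b1 : |K| * (‖w‖ * ‖Complex.exp u‖) ≤ |K| * (8 * ‖u‖ * ‖Complex.exp u‖) := by gcongr
      have b2 : ‖momentInt ε 0 0 u - 1‖ ≤ |L| * (‖u‖ * ‖Complex.exp u‖) := by
        refine a4.trans ?_
        calc L * ‖Complex.exp u‖ ≤ |L| * (1 * ‖Complex.exp u‖) := by
              rw [one_mul]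
              gcongr
              exact le_abs_self L
          _ ≤ _ := by gcongr
      have b3 : ‖(2 * Real.pi * Complex.I : ℂ)‖ * ‖momentInt ε 0 0 u - 1‖ ≤
          7 * (|L| * (‖u‖ * ‖Complex.exp u‖)) := by gcongr
      linarith
  refine (hmom.const_mul_left (-(1 / (2 * Real.pi * Complex.I)))).congr_left fun u => ?_
  rw [Phi_eq_momentInt, barnesPrefactor]
  ring

/-- The polynomial is expanded at v = u + πi: the constant is -13/12 + 1/4 = -5/6, and the cross
term gives log z / (2πi). -/
theorem Phi_two_isBigO {ε : ℝ} (h1 : -(1 / 5) < ε) (h2 : ε < 0) :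
    (fun u => Phi ε 2 u -
      (-(1 / (4 * (Real.pi : ℂ) ^ 2)) * u ^ 2 + 1 / (2 * Real.pi * Complex.I) * u - 5 / 6))
      =O[largeRadius] fun u => u ^ 2 * Complex.exp u := by
  have hpi : (Real.pi : ℂ) ≠ 0 := by exact_mod_cast Real.pi_ne_zero
  have hb : ∀ w : ℂ, barnesArg 2 w = w + Real.pi * Complex.I := fun w => by simp [barnesArg]
  have hmom := momentInt_isBigO h1 h2 2 (c := Real.pi) (by
    have := Real.pi_pos
    norm_num
    linarith) fun u hu => by
      have := hu.1
      have := hu.2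
      rw [hb, abs_le]
      constructor <;> simp <;> linarith
  refine (hmom.const_mul_left (-(1 / (2 * (Real.pi : ℂ) ^ 2)))).congr_left fun u => ?_
  have h5 := polar_sum_two (u + Real.pi * Complex.I)
  simp only [Fin.val_two, hb]
  rw [h5, Phi_eq_momentInt, barnesPrefactor]
  have hI : 1 / (2 * Real.pi * Complex.I) = -Complex.I / (2 * Real.pi) := by
    rw [div_eq_div_iff (by simp [hpi]) (by simp [hpi])]
    linear_combination (2 * Real.pi : ℂ) * Complex.I_sq
  rw [hI]
  field_simp
  linear_combination ((24 : ℂ) * Real.pi ^ 2) * Complex.I_sq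

theorem Phi_three_isBigO {ε : ℝ} (h1 : -(1 / 5) < ε) (h2 : ε < 0) :
    (fun u => Phi ε 3 u - (Complex.I / (8 * (Real.pi : ℂ) ^ 3) * u ^ 3 +
      7 * Complex.I / (4 * Real.pi) * u + loopConstant))
      =O[largeRadius] fun u => u ^ 3 * Complex.exp u := by
  have hpi : (Real.pi : ℂ) ≠ 0 := by exact_mod_cast Real.pi_ne_zero
  have hb : ∀ w : ℂ, barnesArg 3 w = w := fun w => by
    norm_num [barnesArg]
  have hmom := momentInt_isBigO h1 h2 3 (c := 2 * Real.pi) (by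
    have := Real.pi_pos
    norm_num
    linarith) fun u hu => by
      have := hu.1
      have := hu.2
      have := Real.pi_pos
      rw [hb, abs_le]
      constructor <;> linarith
  refine (hmom.const_mul_left (1 / (2 * Real.pi * Complex.I) ^ 3 * (-6))).congr_left fun u => ?_
  have h5 := polar_sum_three u
  have h3 : ((3 : Fin 4) : ℕ) = 3 := rfl
  simp only [h3, hb]
  rw [h5, Phi_eq_momentInt, barnesPrefactor, loopConstant, zetaThree]
  have hI : 1 / (2 * Real.pi * Complex.I) ^ 3 = Complex.I / (8 * (Real.pi : ℂ) ^ 3) := by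
    rw [div_eq_div_iff (by simp [hpi]) (by simp [hpi])]
    linear_combination (-8 * (Real.pi : ℂ) ^ 3) * Complex.I_pow_four
  rw [hI]
  field_simp
  ring

/-! ### Independence at large radius -/

instance largeRadius_neBot : NeBot largeRadius := by
  refine comap_inf_principal_neBot_of_image_mem (by infer_instance) ?_
  refine mem_of_superset univ_mem fun x _ => ⟨x + ((-Real.pi : ℝ) : ℂ) * Complex.I, ⟨?_, ?_⟩, ?_⟩
  · have := Real.pi_pos
    simp
    linarith
  · have := Real.pi_pos
    simpa
  · simp

theorem tendsto_neg_re_largeRadius : Tendsto (fun u : ℂ => -u.re) largeRadius atTop :=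
  tendsto_neg_atBot_atTop.comp (tendsto_comap.mono_left inf_le_left)

theorem tendsto_inv_largeRadius : Tendsto (fun u : ℂ => u⁻¹) largeRadius (𝓝 0) := by
  rw [tendsto_zero_iff_norm_tendsto_zero]
  simp only [norm_inv]
  exact tendsto_inv_atTop_zero.comp (tendsto_atTop_mono
    (fun u => (neg_le_abs _).trans (Complex.abs_re_le_norm u)) tendsto_neg_re_largeRadius)

theorem tendsto_pow_mul_exp_largeRadius (n : ℕ) :
    Tendsto (fun u : ℂ => u ^ n * Complex.exp u) largeRadius (𝓝 0) := by
  have h1 : Tendsto (fun u : ℂ => (-u.re + 7) ^ n * Real.exp (-(-u.re + 7))) largeRadius (𝓝 0) :=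
    (Real.tendsto_pow_mul_exp_neg_atTop_nhds_zero n).comp
      (tendsto_atTop_add_const_right _ _ tendsto_neg_re_largeRadius)
  have h2 := h1.const_mul (Real.exp 7)
  rw [mul_zero] at h2
  refine squeeze_zero_norm' ?_ h2
  filter_upwards [eventually_largeRadius 0] with u hu
  have h3 : ‖u‖ ≤ -u.re + 7 := by
    refine (Complex.norm_le_abs_re_add_abs_im u).trans ?_
    rw [abs_of_nonpos hu.2, abs_of_neg hu.1.2]
    linarith [hu.1.1, Real.pi_lt_d2]
  rw [norm_mul, norm_pow, Complex.norm_exp]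
  calc ‖u‖ ^ n * Real.exp u.re ≤ (-u.re + 7) ^ n * Real.exp u.re := by gcongr
    _ = Real.exp 7 * ((-u.re + 7) ^ n * Real.exp (-(-u.re + 7))) := by
      rw [show u.re = 7 + -(-u.re + 7) by ring, Real.exp_add]
      ring_nf

/-- A cubic polynomial in `log z` which tends to zero at large radius vanishes. -/
theorem cubic_eq_zero {c₀ c₁ c₂ c₃ : ℂ} (h : Tendsto
    (fun u : ℂ => c₀ + c₁ * u + c₂ * u ^ 2 + c₃ * u ^ 3) largeRadius (𝓝 0)) :
    c₀ = 0 ∧ c₁ = 0 ∧ c₂ = 0 ∧ c₃ = 0 := by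
  have hinv := tendsto_inv_largeRadius
  have hne : ∀ᶠ u in largeRadius, u ≠ 0 := by
    filter_upwards [eventually_largeRadius (-1)] with u hu h0
    have := hu.2
    rw [h0] at this
    norm_num at this
  -- Division by u^n isolates the leading coefficient; the coefficients are removed from the top
  -- degree down.
  have key : ∀ (n : ℕ) (c : ℂ) (r : ℂ → ℂ), Tendsto (fun u => r u * u ^ n) largeRadius (𝓝 0) →
      Tendsto r largeRadius (𝓝 c) → c = 0 := by
    intro n c r h1 h2
    have h3 := h1.mul (hinv.pow n)
    refine tendsto_nhds_unique h2 (Tendsto.congr' ?_ (h3.trans (by simp)))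
    filter_upwards [hne] with u hu
    rw [mul_assoc, ← mul_pow, mul_inv_cancel₀ hu, one_pow, mul_one]
  have h3 : c₃ = 0 := by
    refine key 3 c₃ (fun u => c₀ * u⁻¹ ^ 3 + c₁ * u⁻¹ ^ 2 + c₂ * u⁻¹ + c₃) ?_ ?_
    · refine h.congr' ?_
      filter_upwards [hne] with u hu
      field_simp
    · have := ((((hinv.pow 3).const_mul c₀).add ((hinv.pow 2).const_mul c₁)).add
        (hinv.const_mul c₂)).add_const c₃
      simpa using this
  have h2 : c₂ = 0 := by
    refine key 2 c₂ (fun u => c₀ * u⁻¹ ^ 2 + c₁ * u⁻¹ + c₂) ?_ ?_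
    · refine h.congr' ?_
      filter_upwards [hne] with u hu
      rw [h3]
      field_simp
      ring
    · have := (((hinv.pow 2).const_mul c₀).add (hinv.const_mul c₁)).add_const c₂
      simpa using this
  have h1 : c₁ = 0 := by
    refine key 1 c₁ (fun u => c₀ * u⁻¹ + c₁) ?_ ?_
    · refine h.congr' ?_
      filter_upwards [hne] with u hu
      rw [h3, h2]
      field_simp
      ring
    · have := (hinv.const_mul c₀).add_const c₁
      simpa using this
  refine ⟨?_, h1, h2, h3⟩
  refine key 0 c₀ (fun _ => c₀) (h.congr fun u => ?_) tendsto_const_nhds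
  rw [h3, h2, h1]
  ring

/-- The polynomials in `log z` to which the `Φ_k` are asymptotic at large radius. -/
noncomputable def phiLead : Fin 4 → ℂ → ℂ
  | 0, _ => 1
  | 1, u => 1 / (2 * Real.pi * Complex.I) * u
  | 2, u => -(1 / (4 * (Real.pi : ℂ) ^ 2)) * u ^ 2 + 1 / (2 * Real.pi * Complex.I) * u - 5 / 6
  | 3, u => Complex.I / (8 * (Real.pi : ℂ) ^ 3) * u ^ 3 + 7 * Complex.I / (4 * Real.pi) * u +
      loopConstant

theorem tendsto_Phi_sub_phiLead {ε : ℝ} (h1 : -(1 / 5) < ε) (h2 : ε < 0) (k : Fin 4) :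
    Tendsto (fun u => Phi ε k u - phiLead k u) largeRadius (𝓝 0) := by
  fin_cases k
  · have := tendsto_pow_mul_exp_largeRadius 0
    simp only [pow_zero, one_mul] at this
    exact (Phi_zero_isBigO h1 h2).trans_tendsto this
  · have := tendsto_pow_mul_exp_largeRadius 1
    simp only [pow_one] at this
    exact (Phi_one_isBigO h1 h2).trans_tendsto this
  · exact (Phi_two_isBigO h1 h2).trans_tendsto (tendsto_pow_mul_exp_largeRadius 2)
  · exact (Phi_three_isBigO h1 h2).trans_tendsto (tendsto_pow_mul_exp_largeRadius 3)

/-- Triangular in the degrees of log z: b 3, b 2, b 1, b 0 vanish in turn. The free constant c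
serves two uses: 0 for independence of the Φ_k, and the loop constant for uniqueness of the central
charge. -/
theorem phiLead_independent {b : Fin 4 → ℂ} (c : ℂ)
    (h : Tendsto (fun u => ∑ k, b k * phiLead k u - b 3 * c) largeRadius (𝓝 0)) : b = 0 := by
  have hpi : (Real.pi : ℂ) ≠ 0 := by exact_mod_cast Real.pi_ne_zero
  have h3 := cubic_eq_zero (c₀ := b 0 - 5 / 6 * b 2 + b 3 * (loopConstant - c))
    (c₁ := b 1 * (1 / (2 * Real.pi * Complex.I)) + b 2 * (1 / (2 * Real.pi * Complex.I)) +
      b 3 * (7 * Complex.I / (4 * Real.pi)))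
    (c₂ := -(b 2 * (1 / (4 * (Real.pi : ℂ) ^ 2))))
    (c₃ := b 3 * (Complex.I / (8 * (Real.pi : ℂ) ^ 3))) (h.congr fun u => by
      simp only [Fin.sum_univ_four, phiLead]
      ring)
  obtain ⟨e0, e1, e2, e3⟩ := h3
  have b3 : b 3 = 0 := by simpa [hpi] using e3
  have b2 : b 2 = 0 := by simpa [hpi] using e2
  have b1 : b 1 = 0 := by simpa [hpi, b2, b3] using e1
  have b0 : b 0 = 0 := by simpa [b2, b3] using e0
  ext k
  fin_cases k <;> assumption

theorem Phi_independent {ε : ℝ} (h1 : -(1 / 5) < ε) (h2 : ε < 0) {b : Fin 4 → ℂ}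
    (h : ∀ u ∈ strip, ∑ k, b k * Phi ε k u = 0) : b = 0 := by
  refine phiLead_independent 0 ?_
  simp only [mul_zero, sub_zero]
  have h3 : Tendsto (fun u => ∑ k, b k * (Phi ε k u - phiLead k u)) largeRadius (𝓝 (∑ k, b k * 0)) :=
    tendsto_finsetSum _ fun k _ => (tendsto_Phi_sub_phiLead h1 h2 k).const_mul _
  have h4 := h3.neg
  simp only [mul_zero, Finset.sum_const_zero, neg_zero] at h4
  refine h4.congr' ?_
  filter_upwards [eventually_largeRadius 0] with u hu
  simp only [mul_sub, Finset.sum_sub_distrib]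
  rw [h u hu.1]
  ring

/-! ### The periods `ϖ_j` -/

/-- The coefficients of the `ϖ_j` in terms of the `Φ_k`. -/
noncomputable def varpiMatrix : Fin 5 → Fin 4 → ℂ :=
  ![![1, 0, 0, 0], ![1, 5, 0, 5 / 6], ![-4, -10, -(5 / 2), -(5 / 2)], ![6, 10, 5, 5 / 2],
    ![-4, -5, -(5 / 2), -(5 / 6)]]

/-- The five values are recovered from four combinations only on the hyperplane where they sum to 0;
the last row encodes ϖ_4 = -(ϖ_0 + … + ϖ_3). -/
theorem varpiMatrix_phiComb (j : Fin 5) {x : Fin 5 → ℂ} (hx : ∑ i, x i = 0) :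
    ∑ k, varpiMatrix j k * phiComb k x = x j := by
  simp only [Fin.sum_univ_five] at hx
  fin_cases j <;> simp [varpiMatrix, phiComb, Fin.sum_univ_four] <;>
    first | ring1 | linear_combination -hx

theorem phiComb_varpiMatrix (k : Fin 4) (y : Fin 4 → ℂ) :
    phiComb k (fun j => ∑ i, varpiMatrix j i * y i) = y k := by
  fin_cases k <;> simp [varpiMatrix, phiComb, Fin.sum_univ_four] <;> ring

theorem sum_varpiMatrix (k : Fin 4) : ∑ j, varpiMatrix j k = 0 := by
  fin_cases k <;> simp [varpiMatrix, Fin.sum_univ_five] <;> norm_num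

theorem varpiSeries_eq_sum_Phi {ε : ℝ} (h1 : -(1 / 5) < ε) (h2 : ε < 0) (j : Fin 5) {u : ℂ}
    (hu : u ∈ strip) (hre : logConifold < u.re) :
    varpiSeries j u = ∑ k, varpiMatrix j k * Phi ε k u := by
  rw [← varpiMatrix_phiComb j (sum_varpiSeries hre.le)]
  exact Finset.sum_congr rfl fun k _ => by rw [Phi_eq_phiComb_varpiSeries h1 h2 k hu hre]

/-- The Barnes integrals provide the continuation: the relations valid for |z| > 5^(-5) are inverted
and taken as definition. The line -1/10 is an arbitrary admissible choice. -/
theorem exists_isVarpi : ∃ ϖ : Fin 5 → ℂ → ℂ, IsVarpi ϖ := by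
  have h1 : -(1 / 5) < (-(1 / 10) : ℝ) := by norm_num
  have h2 : (-(1 / 10) : ℝ) < 0 := by norm_num
  refine ⟨fun j u => ∑ k, varpiMatrix j k * Phi (-(1 / 10)) k u, fun j => ⟨?_, ?_⟩⟩
  · exact DifferentiableOn.fun_sum fun k _ => (isPeriod_Phi h1 h2 k).1.const_mul _
  · exact fun u hu hre => (varpiSeries_eq_sum_Phi h1 h2 j hu hre).symm

theorem IsVarpi.eq_sum_Phi {ϖ : Fin 5 → ℂ → ℂ} (h : IsVarpi ϖ) {ε : ℝ} (h1 : -(1 / 5) < ε)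
    (h2 : ε < 0) (j : Fin 5) : ∀ u ∈ strip, ϖ j u = ∑ k, varpiMatrix j k * Phi ε k u :=
  eqOn_strip (h j).1 (DifferentiableOn.fun_sum fun k _ => (isPeriod_Phi h1 h2 k).1.const_mul _)
    fun u hu hre => ((h j).2 u hu hre).trans (varpiSeries_eq_sum_Phi h1 h2 j hu hre)

theorem IsVarpi.isPeriod {ϖ : Fin 5 → ℂ → ℂ} (h : IsVarpi ϖ) (j : Fin 5) : IsPeriod (ϖ j) :=
  IsPeriod.comb (varpiMatrix j) (fun k => isPeriod_Phi (ε := -(1 / 10)) (by norm_num) (by norm_num) k)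
    (h.eq_sum_Phi (by norm_num) (by norm_num) j)

theorem IsVarpi.Phi_eq {ϖ : Fin 5 → ℂ → ℂ} (h : IsVarpi ϖ) {ε : ℝ} (h1 : -(1 / 5) < ε)
    (h2 : ε < 0) (k : Fin 4) {u : ℂ} (hu : u ∈ strip) : Phi ε k u = phiComb k fun j => ϖ j u := by
  rw [← phiComb_varpiMatrix k fun k => Phi ε k u]
  congr 1
  ext j
  exact (h.eq_sum_Phi h1 h2 j u hu).symm

theorem IsVarpi.sum_eq_zero {ϖ : Fin 5 → ℂ → ℂ} (h : IsVarpi ϖ) {u : ℂ} (hu : u ∈ strip) :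
    ∑ j, ϖ j u = 0 := by
  have h1 : ∀ j ∈ Finset.univ, ϖ j u = ∑ k, varpiMatrix j k * Phi (-(1 / 10)) k u :=
    fun j _ => h.eq_sum_Phi (by norm_num) (by norm_num) j u hu
  rw [Finset.sum_congr rfl h1, Finset.sum_comm]
  refine Finset.sum_eq_zero fun k _ => ?_
  rw [← Finset.sum_mul, sum_varpiMatrix, zero_mul]

theorem IsVarpi.independent {ϖ : Fin 5 → ℂ → ℂ} (h : IsVarpi ϖ) {b : Fin 4 → ℂ}
    (hb : ∀ u ∈ strip, ∑ k : Fin 4, b k * ϖ k.castSucc u = 0) : b = 0 := by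
  have h1 : -(1 / 5) < (-(1 / 10) : ℝ) := by norm_num
  have h2 : (-(1 / 10) : ℝ) < 0 := by norm_num
  have h3 := Phi_independent h1 h2 (b := fun l => ∑ k : Fin 4, b k * varpiMatrix k.castSucc l)
    fun u hu => by
      rw [← hb u hu]
      simp only [h.eq_sum_Phi h1 h2 _ u hu, Finset.sum_mul, Finset.mul_sum]
      rw [Finset.sum_comm]
      exact Finset.sum_congr rfl fun k _ => Finset.sum_congr rfl fun l _ => by ring
  have e0 := congrFun h3 0
  have e1 := congrFun h3 1
  have e2 := congrFun h3 2
  have e3 := congrFun h3 3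
  simp [varpiMatrix, Fin.sum_univ_four] at e0 e1 e2 e3
  have b3 : b 3 = 0 := by
    linear_combination (6 / 5 : ℂ) * (e1 / 6 - e3) + (6 / 5 : ℂ) * (1 / 3) * e2
  have b2 : b 2 = 0 := by linear_combination (-2 / 5 : ℂ) * e2 + 2 * b3
  have b1 : b 1 = 0 := by linear_combination (1 / 5 : ℂ) * e1 + 2 * b2 - 2 * b3
  have b0 : b 0 = 0 := by linear_combination e0 - b1 + 4 * b2 - 6 * b3
  ext k
  fin_cases k <;> assumption

/-! ### The conifold point -/

theorem IsVarpi.eq_varpiSeries {ϖ : Fin 5 → ℂ → ℂ} (h : IsVarpi ϖ) (j : Fin 5) {u : ℂ}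
    (hu : u ∈ strip) (hre : logConifold ≤ u.re) : ϖ j u = varpiSeries j u := by
  have hg : Tendsto (fun t : ℝ => u + t) (𝓝[>] 0) (𝓝 u) :=
    (Continuous.tendsto' (by fun_prop) _ _ (by simp)).mono_left nhdsWithin_le_nhds
  have ha : Tendsto (fun t : ℝ => ϖ j (u + t)) (𝓝[>] 0) (𝓝 (ϖ j u)) :=
    ((h j).1.differentiableAt (isOpen_strip.mem_nhds hu)).continuousAt.tendsto.comp hg
  have hmem : ∀ t : ℝ, 0 < t → u + t ∈ strip ∧ logConifold < (u + t).re := by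
    intro t ht
    refine ⟨⟨?_, ?_⟩, ?_⟩
    · simpa using hu.1
    · simpa using hu.2
    · simp
      linarith
  have hb : Tendsto (fun t : ℝ => varpiSeries j (u + t)) (𝓝[>] 0) (𝓝 (varpiSeries j u)) := by
    refine (continuousOn_varpiSeries j u hre).tendsto.comp (tendsto_nhdsWithin_iff.2 ⟨hg, ?_⟩)
    filter_upwards [self_mem_nhdsWithin] with t ht using (hmem t ht).2.le
  refine tendsto_nhds_unique_of_eventuallyEq ha hb ?_
  filter_upwards [self_mem_nhdsWithin] with t ht
  exact (h j).2 _ (hmem t ht).1 (hmem t ht).2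

/-- The path `|z| = 5 ^ (-5)`, `arg z → 0` in the strip. -/
theorem tendsto_conifold_path : Tendsto (fun t : ℝ => (logConifold : ℂ) - t * Complex.I) (𝓝[>] 0)
    (𝓝[strip ∩ {u | u.re = logConifold}] (logConifold : ℂ)) := by
  refine tendsto_nhdsWithin_iff.2 ⟨(Continuous.tendsto' (by fun_prop) _ _ (by simp)).mono_left
    nhdsWithin_le_nhds, ?_⟩
  have hpi : (0 : ℝ) < 2 * Real.pi := by linarith [Real.pi_pos]
  filter_upwards [Ioo_mem_nhdsGT hpi] with t ht
  refine ⟨⟨?_, ?_⟩, ?_⟩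
  · simpa using ht.2
  · simpa using ht.1
  · simp

instance conifold_path_neBot :
    NeBot (𝓝[strip ∩ {u | u.re = logConifold}] (logConifold : ℂ)) :=
  tendsto_conifold_path.neBot

theorem tendsto_varpiSeries_conifold (j : Fin 5) {S : Set ℂ} (hS : ∀ u ∈ S, logConifold ≤ u.re) :
    Tendsto (varpiSeries j) (𝓝[S] (logConifold : ℂ)) (𝓝 (varpiSeries j logConifold)) :=
  (continuousOn_varpiSeries j (logConifold : ℂ) (by simp)).tendsto.mono_left (nhdsWithin_mono _ hS)

theorem tendsto_fundSeries_conifold {S : Set ℂ} (hS : ∀ u ∈ S, u.re ≤ logConifold) :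
    Tendsto fundSeries (𝓝[S] (logConifold : ℂ)) (𝓝 (fundSeries logConifold)) :=
  (continuousOn_fundSeries (logConifold : ℂ) (by simp)).tendsto.mono_left (nhdsWithin_mono _ hS)

theorem IsVarpi.zero_eq_fundSeries {ϖ : Fin 5 → ℂ → ℂ} (h : IsVarpi ϖ) {u : ℂ} (hu : u ∈ strip)
    (hre : u.re ≤ logConifold) : ϖ 0 u = fundSeries u := by
  have h1 : -(1 / 5) < (-(1 / 10) : ℝ) := by norm_num
  have h2 : (-(1 / 10) : ℝ) < 0 := by norm_num
  rw [← Phi_zero_eq_fundSeries h1 h2 hu hre]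
  exact (h.Phi_eq h1 h2 0 hu).symm

/-- On the circle |z| = 5^(-5) both series converge and represent ϖ_0; the conifold point is
approached along that circle. -/
theorem varpiSeries_zero_logConifold :
    varpiSeries 0 logConifold = fundSeries logConifold := by
  obtain ⟨ϖ, h⟩ := exists_isVarpi
  refine tendsto_nhds_unique_of_eventuallyEq
    (tendsto_varpiSeries_conifold 0 (S := strip ∩ {u | u.re = logConifold}) fun u hu => hu.2.ge)
    (tendsto_fundSeries_conifold fun u hu => hu.2.le) ?_
  filter_upwards [self_mem_nhdsWithin] with u hu
  rw [← h.eq_varpiSeries 0 hu.1 hu.2.ge, h.zero_eq_fundSeries hu.1 hu.2.le]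

/-- The strip is cut along |z| = 5^(-5); on each half a uniformly convergent series is available,
and the two have the same value at the conifold. -/
theorem IsVarpi.tendsto_zero_conifold {ϖ : Fin 5 → ℂ → ℂ} (h : IsVarpi ϖ) :
    Tendsto (ϖ 0) (𝓝[strip] (logConifold : ℂ)) (𝓝 (fundSeries logConifold)) := by
  have hs : strip = (strip ∩ {u | u.re ≤ logConifold}) ∪ (strip ∩ {u | logConifold ≤ u.re}) := by
    ext u
    simp only [Set.mem_union, Set.mem_inter_iff, Set.mem_ofPred_eq]
    have := le_total u.re logConifold
    tauto
  rw [hs, nhdsWithin_union, tendsto_sup]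
  constructor
  · refine (tendsto_fundSeries_conifold fun u hu => hu.2).congr' ?_
    filter_upwards [self_mem_nhdsWithin] with u hu
    exact (h.zero_eq_fundSeries hu.1 hu.2).symm
  · rw [← varpiSeries_zero_logConifold]
    refine (tendsto_varpiSeries_conifold 0 fun u hu => hu.2).congr' ?_
    filter_upwards [self_mem_nhdsWithin] with u hu
    exact (h.eq_varpiSeries 0 hu.1 hu.2).symm

/-- For k ≥ 1 the conifold point lies inside the domain of convergence |Im v| < (k+1)π; for k = 0 it
lies on its boundary. -/
theorem continuousAt_Phi_conifold {ε : ℝ} (h1 : -(1 / 5) < ε) (h2 : ε < 0) {k : Fin 4}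
    (hk : k ≠ 0) : ContinuousAt (Phi ε k) (logConifold : ℂ) := by
  have him : |(barnesArg k logConifold).im| < ((k : ℕ) + 1) * Real.pi := by
    have hpi := Real.pi_pos
    fin_cases k
    · exact absurd rfl hk
    all_goals norm_num [barnesArg, abs_of_pos hpi, hpi]
  have h3 := ((hasDerivAt_momentInt' h1 h2 k 0 him).const_mul (barnesPrefactor k)).continuousAt
  exact h3.congr (Eventually.of_forall fun u => (Phi_eq_momentInt ε k u).symm)

/-- The limit exists because every Φ_k has one, also from the side |z| < 5^(-5) where the series of
ϖ_j is useless; its value is then read off along the circle |z| = 5^(-5). -/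
theorem IsVarpi.tendsto_conifold {ϖ : Fin 5 → ℂ → ℂ} (h : IsVarpi ϖ) (j : Fin 5) :
    Tendsto (ϖ j) (𝓝[strip] (logConifold : ℂ)) (𝓝 (varpiSeries j logConifold)) := by
  have h1 : -(1 / 5) < (-(1 / 10) : ℝ) := by norm_num
  have h2 : (-(1 / 10) : ℝ) < 0 := by norm_num
  have hPhi : ∀ k : Fin 4, ∃ L, Tendsto (Phi (-(1 / 10)) k) (𝓝[strip] (logConifold : ℂ)) (𝓝 L) := by
    intro k
    by_cases hk : k = 0
    · subst hk
      refine ⟨_, h.tendsto_zero_conifold.congr' ?_⟩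
      filter_upwards [self_mem_nhdsWithin] with u hu
      exact (h.Phi_eq h1 h2 0 hu).symm
    · exact ⟨_, (continuousAt_Phi_conifold h1 h2 hk).tendsto.mono_left nhdsWithin_le_nhds⟩
  choose L hL using hPhi
  have hlim : Tendsto (ϖ j) (𝓝[strip] (logConifold : ℂ)) (𝓝 (∑ k, varpiMatrix j k * L k)) := by
    refine (tendsto_finsetSum _ fun k _ => (hL k).const_mul (varpiMatrix j k)).congr' ?_
    filter_upwards [self_mem_nhdsWithin] with u hu
    exact (h.eq_sum_Phi h1 h2 j u hu).symm
  have he : varpiSeries j logConifold = ∑ k, varpiMatrix j k * L k := by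
    refine tendsto_nhds_unique_of_eventuallyEq
      (tendsto_varpiSeries_conifold j (S := strip ∩ {u | u.re = logConifold}) fun u hu => hu.2.ge)
      (hlim.mono_left (nhdsWithin_mono _ Set.inter_subset_left)) ?_
    filter_upwards [self_mem_nhdsWithin] with u hu
    exact (h.eq_varpiSeries j hu.1 hu.2.ge).symm
  rwa [he]

theorem varpiSeries_zero_eq_one_logConifold :
    varpiSeries 0 logConifold = varpiSeries 1 logConifold := by
  rw [varpiSeries_one_eq_conj, varpiSeries_zero_logConifold, fundSeries_logConifold,
    Complex.conj_ofReal]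

/-! ### The large radius central charge -/

/-- The coefficients of `f` up to degree three. -/
def HasCoeffs (f : PowerSeries ℂ) (a b c d : ℂ) : Prop :=
  PowerSeries.coeff 0 f = a ∧ PowerSeries.coeff 1 f = b ∧ PowerSeries.coeff 2 f = c ∧
    PowerSeries.coeff 3 f = d

theorem HasCoeffs.mul {f g : PowerSeries ℂ} {a b c d a' b' c' d' : ℂ} (hf : HasCoeffs f a b c d)
    (hg : HasCoeffs g a' b' c' d') : HasCoeffs (f * g) (a * a') (a * b' + b * a')
      (a * c' + b * b' + c * a') (a * d' + b * c' + c * b' + d * a') := by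
  obtain ⟨rfl, rfl, rfl, rfl⟩ := hf
  obtain ⟨rfl, rfl, rfl, rfl⟩ := hg
  refine ⟨?_, ?_, ?_, ?_⟩ <;>
    simp [PowerSeries.coeff_mul, Finset.Nat.antidiagonal_succ] <;> ring

theorem HasCoeffs.refl (f : PowerSeries ℂ) : HasCoeffs f (PowerSeries.coeff 0 f)
    (PowerSeries.coeff 1 f) (PowerSeries.coeff 2 f) (PowerSeries.coeff 3 f) := ⟨rfl, rfl, rfl, rfl⟩

theorem hasCoeffs_toddLine (a : ℂ) : HasCoeffs (toddLine a) 1 (a / 2) (a ^ 2 / 12) 0 := by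
  refine ⟨?_, ?_, ?_, ?_⟩ <;>
    simp [toddLine, PowerSeries.coeff_rescale, bernoulli'PowerSeries, bernoulli'_two,
      bernoulli'_three, bernoulli'_one, Nat.factorial] <;> ring

theorem hasCoeffs_expClass (a : ℂ) : HasCoeffs (expClass a) 1 a (a ^ 2 / 2) (a ^ 3 / 6) := by
  refine ⟨?_, ?_, ?_, ?_⟩ <;>
    simp [expClass, PowerSeries.coeff_rescale, PowerSeries.coeff_exp, Nat.factorial] <;> ring

/-- Coefficients are compared in td(X) td(𝒪(5)) = td(𝒪(1))^5, which avoids expanding the inverse.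
The vanishing linear term is the Calabi–Yau condition. -/
theorem hasCoeffs_toddX : HasCoeffs toddX 1 0 (5 / 6) 0 := by
  have h1 := hasCoeffs_toddLine 1
  have h5 : HasCoeffs (toddLine 1 ^ 5) 1 (5 / 2) (35 / 12) (25 / 12) := by
    have := (((h1.mul h1).mul h1).mul h1).mul h1
    rw [← pow_two, ← pow_succ, ← pow_succ, ← pow_succ] at this
    norm_num at this
    exact this
  have hT : toddX * toddLine 5 = toddLine 1 ^ 5 := by
    rw [toddX, mul_assoc, PowerSeries.inv_mul_cancel, mul_one]
    rw [← PowerSeries.coeff_zero_eq_constantCoeff_apply, (hasCoeffs_toddLine 5).1]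
    exact one_ne_zero
  have h := (HasCoeffs.refl toddX).mul (hasCoeffs_toddLine 5)
  rw [hT] at h
  obtain ⟨a0, a1, a2, a3⟩ := h
  obtain ⟨b0, b1, b2, b3⟩ := h5
  rw [b0] at a0
  rw [b1] at a1
  rw [b2] at a2
  rw [b3] at a3
  have c0 : PowerSeries.coeff 0 toddX = 1 := by linear_combination -a0
  rw [c0] at a1 a2 a3
  have c1 : PowerSeries.coeff 1 toddX = 0 := by linear_combination -a1
  rw [c1] at a2 a3
  have c2 : PowerSeries.coeff 2 toddX = 5 / 6 := by linear_combination -a2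
  rw [c2] at a3
  exact ⟨c0, c1, c2, by linear_combination -a3⟩

/-- Squaring determines the root only up to sign; the constant term selects the one starting with 1.
-/
theorem coeff_zero_sqrtClass {f : PowerSeries ℂ} (hf : PowerSeries.constantCoeff f = 1) :
    PowerSeries.coeff 0 (sqrtClass f) = 1 := by
  have hc : PowerSeries.constantCoeff (f - 1) = 0 := by simp [hf]
  have hs : PowerSeries.HasSubst (f - 1) := PowerSeries.HasSubst.of_constantCoeff_zero' hc
  have h1 : PowerSeries.subst (f - 1) (1 : PowerSeries ℂ) = 1 := by
    rw [← PowerSeries.coe_substAlgHom hs, map_one]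
  have h2 : PowerSeries.constantCoeff (PowerSeries.binomialSeries ℂ (1 / 2 : ℚ) - 1) = 0 := by
    rw [map_sub, PowerSeries.binomialSeries_constantCoeff, map_one, sub_self]
  have h3 : sqrtClass f =
      PowerSeries.subst (f - 1) (PowerSeries.binomialSeries ℂ (1 / 2 : ℚ) - 1) + 1 := by
    have := PowerSeries.subst_add hs (PowerSeries.binomialSeries ℂ (1 / 2 : ℚ) - 1) 1
    rw [sub_add_cancel, h1] at this
    exact this
  have h4 : PowerSeries.constantCoeff (PowerSeries.subst (f - 1)
      (PowerSeries.binomialSeries ℂ (1 / 2 : ℚ) - 1)) = 0 :=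
    PowerSeries.constantCoeff_subst_eq_zero hc _ h2
  rw [h3, PowerSeries.coeff_zero_eq_constantCoeff_apply, map_add, h4, map_one, zero_add]

theorem hasCoeffs_sqrt_toddX : HasCoeffs (sqrtClass toddX) 1 0 (5 / 12) 0 := by
  have hc : PowerSeries.constantCoeff toddX = 1 := by
    rw [← PowerSeries.coeff_zero_eq_constantCoeff_apply, hasCoeffs_toddX.1]
  have h := (HasCoeffs.refl (sqrtClass toddX)).mul (HasCoeffs.refl (sqrtClass toddX))
  have hsq := sqrtClass_sq toddX hc
  rw [← sq, hsq] at h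
  obtain ⟨-, a1, a2, a3⟩ := h
  obtain ⟨-, b1, b2, b3⟩ := hasCoeffs_toddX
  have c0 := coeff_zero_sqrtClass hc
  rw [b1, c0] at a1
  rw [b2, c0] at a2
  rw [b3, c0] at a3
  have c1 : PowerSeries.coeff 1 (sqrtClass toddX) = 0 := by linear_combination -a1 / 2
  rw [c1] at a2 a3
  have c2 : PowerSeries.coeff 2 (sqrtClass toddX) = 5 / 12 := by linear_combination -a2 / 2
  rw [c2] at a3
  exact ⟨c0, c1, c2, by linear_combination -a3 / 2⟩

theorem classicalCharge_chO (m : ℤ) (t : ℂ) : classicalCharge (chO m) t =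
    5 / 12 * (m - t) * (2 * m ^ 2 + 2 * t ^ 2 - 4 * m * t + 5) := by
  have h : expClass (-t) * chO m = expClass (-t + m) :=
    PowerSeries.exp_mul_exp_eq_exp_add (-t) (m : ℂ)
  rw [classicalCharge, h, integralX, ((hasCoeffs_expClass _).mul hasCoeffs_sqrt_toddX).2.2.2]
  ring

/-! ### The exact central charge of the line bundles -/

/-- The coefficients of the central charge of `𝒪_X(m)` with respect to the `Φ_k`. -/
noncomputable def chargeCoeff (m : ℤ) : Fin 4 → ℂ :=
  ![5 / 6 * m * (m ^ 2 + 5), -(5 / 2 * (m ^ 2 + m + 2)), 5 / 2 * m, -(5 / 6)]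

theorem sum_chargeCoeff (m : ℤ) (y : Fin 4 → ℂ) : ∑ k, chargeCoeff m k * y k =
    5 / 6 * m * (m ^ 2 + 5) * y 0 - 5 / 2 * (m ^ 2 + m + 2) * y 1 + 5 / 2 * m * y 2 -
      5 / 6 * y 3 := by
  simp [chargeCoeff, Fin.sum_univ_four]
  ring

/-- In τ = log z / (2πi) the leading terms are 1, τ, τ² + τ - 5/6 and τ³ - 7τ/2 plus the loop
constant; the coefficients of the charge are those matching the cubic in m - τ. -/
theorem sum_chargeCoeff_phiLead (m : ℤ) (u : ℂ) : ∑ k, chargeCoeff m k * phiLead k u =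
    classicalCharge (chO m) (1 / (2 * Real.pi * Complex.I) * u) +
      chargeCoeff m 3 * loopConstant := by
  have hpi : (Real.pi : ℂ) ≠ 0 := by exact_mod_cast Real.pi_ne_zero
  set τ : ℂ := 1 / (2 * Real.pi * Complex.I) * u with hτ
  have hu : u = 2 * Real.pi * Complex.I * τ := by
    rw [hτ]
    field_simp
  have e2 : phiLead 2 u = τ ^ 2 + τ - 5 / 6 := by
    simp only [phiLead]
    rw [← hτ, hu]
    field_simp
    linear_combination (-(24 : ℂ) * τ ^ 2) * Complex.I_sq
  have e3 : phiLead 3 u = τ ^ 3 - 7 / 2 * τ + loopConstant := by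
    simp only [phiLead]
    have a1 : Complex.I / (8 * (Real.pi : ℂ) ^ 3) * u ^ 3 = Complex.I ^ 4 * τ ^ 3 := by
      rw [hu]
      clear_value τ
      field_simp
      ring
    have a2 : 7 * Complex.I / (4 * Real.pi) * u = 7 / 2 * Complex.I ^ 2 * τ := by
      rw [hu]
      clear_value τ
      field_simp
      ring
    rw [a1, a2, Complex.I_pow_four, Complex.I_sq]
    ring
  rw [sum_chargeCoeff, classicalCharge_chO, e2, e3]
  simp only [phiLead, chargeCoeff]
  rw [← hτ]
  simp
  ring

theorem isBigO_pow_largeRadius {m n : ℕ} (h : m ≤ n) :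
    (fun u : ℂ => u ^ m) =O[largeRadius] fun u => u ^ n := by
  refine IsBigO.of_bound 1 ?_
  filter_upwards [eventually_largeRadius (-1)] with u hu
  rw [norm_pow, norm_pow, one_mul]
  exact pow_le_pow_right₀ (one_le_norm_of_re_le hu.2) h

/-- The difference is ((Φ_1 - τ) - τ(Φ_0 - 1)) / Φ_0 with τ = log z / (2πi), and Φ_0 tends to 1. -/
theorem mirrorMap_isBigO {ε : ℝ} (h1 : -(1 / 5) < ε) (h2 : ε < 0) :
    (fun u => mirrorMap ε u - 1 / (2 * Real.pi * Complex.I) * u)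
      =O[largeRadius] fun u => u * Complex.exp u := by
  have hlim : Tendsto (Phi ε 0) largeRadius (𝓝 1) := by
    have := (tendsto_Phi_sub_phiLead h1 h2 0).add_const 1
    rw [zero_add] at this
    exact this.congr fun u => by simp [phiLead]
  have hinv : (fun u => (Phi ε 0 u)⁻¹) =O[largeRadius] fun _ => (1 : ℂ) :=
    (hlim.inv₀ one_ne_zero).isBigO_one ℂ
  have hτ : (fun u : ℂ => 1 / (2 * Real.pi * Complex.I) * u) =O[largeRadius] fun u => u :=
    (isBigO_refl _ _).const_mul_left _
  have h3 := ((Phi_one_isBigO h1 h2).sub (hτ.mul (Phi_zero_isBigO h1 h2))).mul hinv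
  simp only [mul_one] at h3
  refine h3.congr' ?_ EventuallyEq.rfl
  filter_upwards [hlim.eventually_ne one_ne_zero] with u hu
  rw [mirrorMap]
  generalize Phi ε 1 u = x
  generalize 1 / (2 * Real.pi * Complex.I) * u = y
  field_simp
  ring

/-- The charge is a cubic polynomial, so a change δ of its argument changes it by δ times a factor
of size O((log z)^2); as δ = O(z log z), the product tends to 0. -/
theorem tendsto_classicalCharge_sub {ε : ℝ} (h1 : -(1 / 5) < ε) (h2 : ε < 0) (m : ℤ) :
    Tendsto (fun u => classicalCharge (chO m) (mirrorMap ε u) -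
      classicalCharge (chO m) (1 / (2 * Real.pi * Complex.I) * u)) largeRadius (𝓝 0) := by
  set δ : ℂ → ℂ := fun u => mirrorMap ε u - 1 / (2 * Real.pi * Complex.I) * u with hδ
  have hδ0 : δ =O[largeRadius] fun u => u * Complex.exp u := mirrorMap_isBigO h1 h2
  have hone : (fun _ : ℂ => (1 : ℂ)) =O[largeRadius] fun u => u := by
    simpa using isBigO_pow_largeRadius (m := 0) (n := 1) (by norm_num)
  have hδ1 : δ =O[largeRadius] fun u => u := by
    have h3 := tendsto_pow_mul_exp_largeRadius 1
    simp only [pow_one] at h3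
    exact ((hδ0.trans_tendsto h3).isBigO_one ℂ).trans hone
  have hx : (fun u : ℂ => (m : ℂ) - 1 / (2 * Real.pi * Complex.I) * u) =O[largeRadius]
      fun u => u := by
    refine IsBigO.sub ?_ ((isBigO_refl _ _).const_mul_left _)
    simpa using hone.const_mul_left (m : ℂ)
  have hq := ((((hx.pow 2).const_mul_left (5 / 2)).sub
    (((hx.mul hδ1).congr_right fun u => (sq u).symm).const_mul_left (5 / 2))).add
      ((hδ1.pow 2).const_mul_left (5 / 6))).add
        ((hone.pow 2).const_mul_left (25 / 12))
  have h4 := hδ0.mul hq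
  have h5 : Tendsto (fun u : ℂ => u * Complex.exp u * u ^ 2) largeRadius (𝓝 0) :=
    (tendsto_pow_mul_exp_largeRadius 3).congr fun u => by ring
  have h6 := (h4.trans_tendsto h5).neg
  rw [neg_zero] at h6
  refine h6.congr fun u => ?_
  have e : mirrorMap ε u = δ u + 1 / (2 * Real.pi * Complex.I) * u := by rw [hδ]; ring
  rw [classicalCharge_chO, classicalCharge_chO, e]
  generalize 1 / (2 * Real.pi * Complex.I) * u = τ
  ring

theorem tendsto_charge {ε : ℝ} (h1 : -(1 / 5) < ε) (h2 : ε < 0) (m : ℤ) :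
    Tendsto (fun u => ∑ k, chargeCoeff m k * Phi ε k u -
      (classicalCharge (chO m) (mirrorMap ε u) + chargeCoeff m 3 * loopConstant))
      largeRadius (𝓝 0) := by
  have h3 : Tendsto (fun u => ∑ k, chargeCoeff m k * (Phi ε k u - phiLead k u)) largeRadius
      (𝓝 (∑ k, chargeCoeff m k * 0)) :=
    tendsto_finsetSum _ fun k _ => (tendsto_Phi_sub_phiLead h1 h2 k).const_mul _
  have h4 := h3.sub (tendsto_classicalCharge_sub h1 h2 m)
  simp only [mul_zero, Finset.sum_const_zero, sub_zero] at h4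
  refine h4.congr fun u => ?_
  simp only [mul_sub, Finset.sum_sub_distrib]
  rw [sum_chargeCoeff_phiLead]
  ring

/-- For uniqueness, subtract the known solution: the mirror map terms cancel, and what remains is
the leading polynomial of the difference minus its own loop constant, which tends to 0 only if all
coefficients vanish. -/
theorem isCentralCharge_chO_iff {ε : ℝ} (h1 : -(1 / 5) < ε) (h2 : ε < 0) (m : ℤ) (Z : ℂ → ℂ) :
    IsCentralCharge ε (chO m) Z ↔ ∀ u ∈ strip, Z u = ∑ k, chargeCoeff m k * Phi ε k u := by
  have hstrip : ∀ᶠ u in largeRadius, u ∈ strip :=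
    (eventually_largeRadius 0).mono fun u hu => hu.1
  constructor
  · rintro ⟨-, b, hb, hlim⟩
    have h3 : b - chargeCoeff m = 0 := by
      refine phiLead_independent loopConstant ?_
      have h4 := (hlim.sub (tendsto_charge h1 h2 m))
      have h5 : Tendsto (fun u => ∑ k, (b k - chargeCoeff m k) * (Phi ε k u - phiLead k u))
          largeRadius (𝓝 (∑ k, (b k - chargeCoeff m k) * 0)) :=
        tendsto_finsetSum _ fun k _ => (tendsto_Phi_sub_phiLead h1 h2 k).const_mul _
      have h6 := h4.sub h5
      simp only [mul_zero, Finset.sum_const_zero, sub_zero] at h6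
      refine h6.congr' ?_
      filter_upwards [hstrip] with u hu
      rw [hb u hu]
      simp only [mul_sub, sub_mul, Finset.sum_sub_distrib, Pi.sub_apply]
      ring
    rw [sub_eq_zero.1 h3] at hb
    exact hb
  · intro hZ
    refine ⟨IsPeriod.comb _ (isPeriod_Phi h1 h2) hZ, chargeCoeff m, hZ, ?_⟩
    refine (tendsto_charge h1 h2 m).congr' ?_
    filter_upwards [hstrip] with u hu
    rw [hZ u hu]

theorem sum_chargeCoeff_phiComb (m : ℤ) (x : Fin 5 → ℂ) :
    ∑ k, chargeCoeff m k * phiComb k x = 1 / 6 * (5 * m ^ 3 + 3 * m ^ 2 + 16 * m + 6) * x 0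
      - 1 / 2 * (3 * m ^ 2 + 3 * m + 2) * x 1 - m ^ 2 * x 2 - 1 / 2 * m * (m - 1) * x 3 := by
  rw [sum_chargeCoeff]
  simp only [phiComb]
  ring

theorem IsVarpi.isCentralCharge_iff {ϖ : Fin 5 → ℂ → ℂ} (h : IsVarpi ϖ) {ε : ℝ}
    (h1 : -(1 / 5) < ε) (h2 : ε < 0) (m : ℤ) (Z : ℂ → ℂ) :
    IsCentralCharge ε (chO m) Z ↔ ∀ u ∈ strip, Z u =
      1 / 6 * (5 * m ^ 3 + 3 * m ^ 2 + 16 * m + 6) * ϖ 0 u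
        - 1 / 2 * (3 * m ^ 2 + 3 * m + 2) * ϖ 1 u
        - m ^ 2 * ϖ 2 u - 1 / 2 * m * (m - 1) * ϖ 3 u := by
  rw [isCentralCharge_chO_iff h1 h2]
  refine forall₂_congr fun u hu => ?_
  rw [← sum_chargeCoeff_phiComb m fun j => ϖ j u]
  simp only [h.Phi_eq h1 h2 _ hu]

end Quintic

/-! ### The complete statement, assembled -/

theorem mainTheorem5 :
    -- the series for the `ϖ_j` converge for `|z| ≥ 5 ^ (-5)` and continue analytically
    (∀ (j : Fin 5) (u : ℂ), Quintic.logConifold ≤ u.re → Summable (Quintic.varpiTerm j u)) ∧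
    (∃ ϖ : Fin 5 → ℂ → ℂ, Quintic.IsVarpi ϖ) ∧
    ∀ ϖ : Fin 5 → ℂ → ℂ, Quintic.IsVarpi ϖ →
      -- `ϖ_0, …, ϖ_3` is a basis of the periods
      (∀ j, Quintic.IsPeriod (ϖ j)) ∧
      (∀ u ∈ Quintic.strip, ∑ j, ϖ j u = 0) ∧
      (∀ F : ℂ → ℂ, Quintic.IsPeriod F →
        ∃! b : Fin 4 → ℂ, ∀ u ∈ Quintic.strip, F u = ∑ k : Fin 4, b k * ϖ k.castSucc u) ∧
      -- at the conifold point `ϖ_0` is given by a convergent real series, `ϖ_1` is its conjugate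
      (∀ j, Tendsto (ϖ j) (𝓝[Quintic.strip] (Quintic.logConifold : ℂ))
        (𝓝 (Quintic.varpiSeries j Quintic.logConifold))) ∧
      (∀ x : ℝ, Quintic.logConifold ≤ x →
        Quintic.varpiSeries 1 x = (starRingEnd ℂ) (Quintic.varpiSeries 0 x)) ∧
      Summable (fun n : ℕ => Quintic.fundCoeff n * ((5 : ℝ) ^ (-5 : ℤ)) ^ n) ∧
      Quintic.varpiSeries 0 Quintic.logConifold =
        ((∑' n : ℕ, Quintic.fundCoeff n * ((5 : ℝ) ^ (-5 : ℤ)) ^ n : ℝ) : ℂ) ∧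
      Quintic.varpiSeries 0 Quintic.logConifold = Quintic.varpiSeries 1 Quintic.logConifold ∧
      ∀ ε : ℝ, -(1 / 5) < ε → ε < 0 →
        -- the Barnes integrals converge
        (∀ (k : Fin 4), ∀ u ∈ Quintic.strip, MeasureTheory.Integrable
          (fun y : ℝ => Quintic.barnesIntegrand k u (ε + y * Complex.I))) ∧
        -- their expansions at large radius
        (∀ u ∈ Quintic.strip, u.re ≤ Quintic.logConifold →
          HasSum (fun n : ℕ => (Quintic.fundCoeff n : ℂ) * Complex.exp u ^ n)
            (Quintic.Phi ε 0 u)) ∧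
        ((fun u => Quintic.Phi ε 1 u - 1 / (2 * Real.pi * Complex.I) * u)
          =O[Quintic.largeRadius] fun u => u * Complex.exp u) ∧
        ((fun u => Quintic.Phi ε 2 u -
            (-(1 / (4 * (Real.pi : ℂ) ^ 2)) * u ^ 2 + 1 / (2 * Real.pi * Complex.I) * u - 5 / 6))
          =O[Quintic.largeRadius] fun u => u ^ 2 * Complex.exp u) ∧
        ((fun u => Quintic.Phi ε 3 u -
            (Complex.I / (8 * (Real.pi : ℂ) ^ 3) * u ^ 3 + 7 * Complex.I / (4 * Real.pi) * u +
              Quintic.loopConstant))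
          =O[Quintic.largeRadius] fun u => u ^ 3 * Complex.exp u) ∧
        -- their analytic continuation
        (∀ u ∈ Quintic.strip,
          Quintic.Phi ε 0 u = ϖ 0 u ∧
          Quintic.Phi ε 1 u = -(1 / 5) * (ϖ 0 u - 3 * ϖ 1 u - 2 * ϖ 2 u - ϖ 3 u) ∧
          Quintic.Phi ε 2 u = 2 / 5 * (-2 * ϖ 0 u + ϖ 2 u + ϖ 3 u) ∧
          Quintic.Phi ε 3 u = -(6 / 5) * (2 * ϖ 1 u + 2 * ϖ 2 u + ϖ 3 u)) ∧
        -- the central charge of `𝒪_X(m)`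
        (∀ (m : ℤ) (t : ℂ), Quintic.classicalCharge (Quintic.chO m) t =
          5 / 12 * (m - t) * (2 * m ^ 2 + 2 * t ^ 2 - 4 * m * t + 5)) ∧
        (∀ (m : ℤ) (Z : ℂ → ℂ), Quintic.IsCentralCharge ε (Quintic.chO m) Z ↔
          ∀ u ∈ Quintic.strip, Z u =
            5 / 6 * m * (m ^ 2 + 5) * Quintic.Phi ε 0 u
              - 5 / 2 * (m ^ 2 + m + 2) * Quintic.Phi ε 1 u
              + 5 / 2 * m * Quintic.Phi ε 2 u - 5 / 6 * Quintic.Phi ε 3 u) ∧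
        (∀ (m : ℤ) (Z : ℂ → ℂ), Quintic.IsCentralCharge ε (Quintic.chO m) Z ↔
          ∀ u ∈ Quintic.strip, Z u =
            1 / 6 * (5 * m ^ 3 + 3 * m ^ 2 + 16 * m + 6) * ϖ 0 u
              - 1 / 2 * (3 * m ^ 2 + 3 * m + 2) * ϖ 1 u
              - m ^ 2 * ϖ 2 u - 1 / 2 * m * (m - 1) * ϖ 3 u) ∧
        -- `𝒪_X` becomes massless at the conifold point
        (∀ Z : ℂ → ℂ, Quintic.IsCentralCharge ε (Quintic.chO 0) Z →
          (∀ u ∈ Quintic.strip, Z u = ϖ 0 u - ϖ 1 u) ∧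
          Tendsto Z (𝓝[Quintic.strip] (Quintic.logConifold : ℂ)) (𝓝 0)) := by
  refine ⟨Quintic.summable_varpiTerm, Quintic.exists_isVarpi, fun ϖ h => ?_⟩
  refine ⟨h.isPeriod, fun u hu => h.sum_eq_zero hu,
    fun F hF => Quintic.IsPeriod.existsUnique_comb (F := fun k => ϖ k.castSucc)
      (fun k => h.isPeriod _) (fun b hb => h.independent hb) hF,
    h.tendsto_conifold, fun x _ => Quintic.varpiSeries_one_eq_conj x, Quintic.summable_fundCoeff,
    Quintic.varpiSeries_zero_logConifold.trans Quintic.fundSeries_logConifold,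
    Quintic.varpiSeries_zero_eq_one_logConifold, fun ε h1 h2 => ?_⟩
  refine ⟨fun k u hu => Quintic.integrable_barnesIntegrand h1 h2 k hu, fun u hu hre => ?_,
    Quintic.Phi_one_isBigO h1 h2, Quintic.Phi_two_isBigO h1 h2, Quintic.Phi_three_isBigO h1 h2,
    fun u hu => ⟨h.Phi_eq h1 h2 0 hu, h.Phi_eq h1 h2 1 hu, h.Phi_eq h1 h2 2 hu,
      h.Phi_eq h1 h2 3 hu⟩,
    Quintic.classicalCharge_chO, fun m Z => ?_, h.isCentralCharge_iff h1 h2, fun Z hZ => ?_⟩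
  · rw [Quintic.Phi_zero_eq_fundSeries h1 h2 hu hre]
    exact Quintic.hasSum_fundSeries hre
  · rw [Quintic.isCentralCharge_chO_iff h1 h2]
    simp only [Quintic.sum_chargeCoeff]
  · have hZ' : ∀ u ∈ Quintic.strip, Z u = ϖ 0 u - ϖ 1 u := fun u hu => by
      rw [(h.isCentralCharge_iff h1 h2 0 Z).1 hZ u hu]
      push_cast
      ring
    refine ⟨hZ', ?_⟩
    have hlim := (h.tendsto_conifold 0).sub (h.tendsto_conifold 1)
    rw [Quintic.varpiSeries_zero_eq_one_logConifold, sub_self] at hlim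
    refine hlim.congr' ?_
    filter_upwards [self_mem_nhdsWithin] with u hu
    exact (hZ' u hu).symm
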